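/- Let $n\ge 1$ and $1\le p<\infty$. Let $m:\mathbb R^n\times\mathbb R^n\to\mathbb R$ be measurable with $m_-\le m(x,h)\le m_+$ for a.e. $(x,h)$, where $0<m_-\le m_+<\infty$ are constants, and suppose that there is a function $a:\mathbb R^n\times\mathbb S^{n-1}\to\mathbb R$ such that for a.e. $x\in\mathbb R^n$ $$m(x,r\omega)=a(x,\omega)+O(r)\quad\text{as } r\downarrow 0,\ \text{uniformly in } \omega\in\mathbb S^{n-1}$$ (that is, for a.e. $x$ there are $C,\delta>0$, possibly depending on $x$, with $|m(x,r\omega)-a(x,\omega)|\le Cr$ for a.e. $\omega$ and a.e. $r\in(0,\delta)$). For $0\le s<1$ put $$[u]_{s,p}^p=\iint_{\mathbb R^n\times\mathbb R^n}\frac{|u(x)-u(x-h)|^p}{|h|^{n+sp}}\,dx\,dh,\qquad J_{m,s}(u)=\frac{1-s}{p}\iint_{\mathbb R^n\times\mathbb R^n} m(x,h)\frac{|u(x)-u(x-h)|^p}{|h|^{n+sp}}\,dx\,dh,$$ $$\mathcal A(x,\xi)=\frac1p\int_{\mathbb S^{n-1}}a(x,\omega)\,|\xi\cdot\omega|^p\,d\mathcal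 H^{n-1}(\omega).$$ Let $0\le s_k<1$ with $s_k\to 1$, and let $u_k\in L^p(\mathbb R^n)$ satisfy $$\sup_k\,(1-s_k)[u_k]_{s_k,p}^p<\infty,\qquad \sup_k\|u_k\|_{L^p(\mathbb R^n)}<\infty .$$ Then there are $u\in L^p(\mathbb R^n)$ and a subsequence $(u_{k_j})$ with $u_{k_j}\to u$ in $L^p_{\rm loc}(\mathbb R^n)$. If moreover $p>1$, then $u$ and the subsequence can be chosen such that in addition $u\in W^{1,p}(\mathbb R^n)$ and $$\int_{\mathbb R^n}\mathcal A(x,\nabla u)\,dx\le p\,\liminf_{k\to\infty}J_{m,s_k}(u_k)=\liminf_{k\to\infty}\,(1-s_k)\iint_{\mathbb R^n\times\mathbb R^n} m(x,h)\frac{|u_k(x)-u_k(x-h)|^p}{|h|^{n+s_kp}}\,dx\,dh .$$ Furthermore (the $\Gamma$-liminf inequality), if $p>1$, then for every subsequence $(u_{k_j})$ and every measurable $u$ with $u_{k_j}\to u$ in $L^p_{\rm loc}(\mathbb R^n)$ one has $u\in W^{1,p}(\mathbb R^n)$ and $$\int_{\mathbb R^n}\mathcal A(x,\nabla u)\,dx\le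 p\,\liminf_{j\to\infty}J_{m,s_{k_j}}(u_{k_j}).$$ -/

import Mathlib

open MeasureTheory Filter Set
open scoped Topology ENNReal

noncomputable section

/-- The `p`-th power `[u]_{s,p}^p` of the Gagliardo seminorm of `u : ℝⁿ → ℝ`, with values in
`[0, ∞]`; the integration variable is `z = (x, h)`. -/
def gagliardoPow {n : ℕ} (s p : ℝ) (u : EuclideanSpace ℝ (Fin n) → ℝ) : ℝ≥0∞ :=
  ∫⁻ z : EuclideanSpace ℝ (Fin n) × EuclideanSpace ℝ (Fin n),
    ENNReal.ofReal (|u z.1 - u (z.1 - z.2)| ^ p / ‖z.2‖ ^ ((n : ℝ) + s * p))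

/-- The anisotropic fractional energy
`J_{m,s}(u) = (1 - s)/p ∬ m(x,h) |u(x) - u(x-h)|^p / |h|^{n+sp} dx dh`, with values in `[0, ∞]`. -/
def anisoEnergy {n : ℕ} (m : EuclideanSpace ℝ (Fin n) → EuclideanSpace ℝ (Fin n) → ℝ) (s p : ℝ)
    (u : EuclideanSpace ℝ (Fin n) → ℝ) : ℝ≥0∞ :=
  ENNReal.ofReal ((1 - s) / p) *
    ∫⁻ z : EuclideanSpace ℝ (Fin n) × EuclideanSpace ℝ (Fin n),
      ENNReal.ofReal
        (m z.1 z.2 * (|u z.1 - u (z.1 - z.2)| ^ p / ‖z.2‖ ^ ((n : ℝ) + s * p)))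

/-- The surface measure of the unit sphere of `ℝⁿ`, that is the `(n-1)`-dimensional Hausdorff
measure in its usual normalization: the total mass is `n` times the volume of the unit ball. -/
abbrev sphereMeasure (n : ℕ) : Measure (Metric.sphere (0 : EuclideanSpace ℝ (Fin n)) 1) :=
  (volume : Measure (EuclideanSpace ℝ (Fin n))).toSphere

/-- `𝒜(x, ξ) = 1/p ∫_{S^{n-1}} a(x,ω) |ξ · ω|^p dℋ^{n-1}(ω)`. -/
def localDensity {n : ℕ}
    (a : EuclideanSpace ℝ (Fin n) → Metric.sphere (0 : EuclideanSpace ℝ (Fin n)) 1 → ℝ) (p : ℝ)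
    (x ξ : EuclideanSpace ℝ (Fin n)) : ℝ≥0∞ :=
  ENNReal.ofReal (1 / p) *
    ∫⁻ ω : Metric.sphere (0 : EuclideanSpace ℝ (Fin n)) 1, ENNReal.ofReal (a x ω * |inner ℝ ξ (ω : EuclideanSpace ℝ (Fin n))| ^ p)
      ∂(sphereMeasure n)

/-- `m` is a measurable kernel, bounded between two positive constants almost everywhere. -/
structure IsEllipticKernel {n : ℕ}
    (m : EuclideanSpace ℝ (Fin n) → EuclideanSpace ℝ (Fin n) → ℝ) : Prop where
  aestronglyMeasurable : AEStronglyMeasurable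
    (fun z : EuclideanSpace ℝ (Fin n) × EuclideanSpace ℝ (Fin n) => m z.1 z.2) volume
  bounds : ∃ mlo mhi : ℝ, 0 < mlo ∧
    ∀ᵐ z : EuclideanSpace ℝ (Fin n) × EuclideanSpace ℝ (Fin n),
      mlo ≤ m z.1 z.2 ∧ m z.1 z.2 ≤ mhi

/-- `m(x, rω) = a(x, ω) + O(r)` as `r ↓ 0`, uniformly in `ω ∈ S^{n-1}`, for almost every `x`.
As `m` is a class of functions modulo null sets, the bound is asked for almost all `ω` and `r`. -/
def HasRadialLimit {n : ℕ} (m : EuclideanSpace ℝ (Fin n) → EuclideanSpace ℝ (Fin n) → ℝ)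
    (a : EuclideanSpace ℝ (Fin n) → Metric.sphere (0 : EuclideanSpace ℝ (Fin n)) 1 → ℝ) : Prop :=
  ∀ᵐ x : EuclideanSpace ℝ (Fin n), ∃ C δ : ℝ, 0 < δ ∧
    ∀ᵐ ω : Metric.sphere (0 : EuclideanSpace ℝ (Fin n)) 1 ∂(sphereMeasure n), ∀ᵐ r : ℝ, r ∈ Ioo 0 δ →
      |m x (r • (ω : EuclideanSpace ℝ (Fin n))) - a x ω| ≤ C * r

/-- `g` is the weak (distributional) gradient of `u` on `ℝⁿ`. -/
structure IsWeakGradient {n : ℕ} (u : EuclideanSpace ℝ (Fin n) → ℝ)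
    (g : EuclideanSpace ℝ (Fin n) → EuclideanSpace ℝ (Fin n)) : Prop where
  locallyIntegrable : LocallyIntegrable u
  locallyIntegrable_grad : LocallyIntegrable g
  integral_eq : ∀ ψ : EuclideanSpace ℝ (Fin n) → ℝ, ContDiff ℝ (⊤ : ℕ∞) ψ → HasCompactSupport ψ →
    ∀ i : Fin n,
      ∫ x, u x * fderiv ℝ ψ x (EuclideanSpace.single i 1) = - ∫ x, g x i * ψ x

/-- `u ∈ W^{1,p}(ℝⁿ)` with weak gradient `g`. -/
structure MemSobolevOne {n : ℕ} (p : ℝ) (u : EuclideanSpace ℝ (Fin n) → ℝ)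
    (g : EuclideanSpace ℝ (Fin n) → EuclideanSpace ℝ (Fin n)) : Prop where
  memLp : MemLp u (ENNReal.ofReal p)
  memLp_grad : MemLp g (ENNReal.ofReal p)
  isWeakGradient : IsWeakGradient u g

/-- `v_j → w` in `L^p_loc(ℝⁿ)`. -/
def TendstoLpLoc {n : ℕ} (p : ℝ) (v : ℕ → EuclideanSpace ℝ (Fin n) → ℝ)
    (w : EuclideanSpace ℝ (Fin n) → ℝ) : Prop :=
  ∀ K : Set (EuclideanSpace ℝ (Fin n)), IsCompact K →
    Tendsto (fun j => eLpNorm (fun x => v j x - w x) (ENNReal.ofReal p) (volume.restrict K))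
      atTop (𝓝 0)

end

/-! Γ-liminf inequality. In polar coordinates `h = rω`, with `c = p(1-s)`, the Jacobian, the kernel
and the factor `|h|^p` hidden in a difference quotient combine to the density `c r^{c-1}`. On
`(0,1)` this is a probability measure `ρ_k`, and it concentrates at `r = 0` as `s_k → 1`. Hence `p²
J_{m,s_k}(u_k)` dominates the integral over the sphere of `E_k(ω) = ∫ ρ_k(dr) ∫ m(x,rω) |(u_k(x) -
u_k(x-rω))/r|^p dx` (`lintegral_sphere_powerMeasure_le`).

Fix `ω`. The weight depends on `r` and tends to `a(x,ω)` without uniformity in `x`, so the bound is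
obtained by duality. For a test function `φ`, a discrete integration by parts compares `-∫ v ∂_ω φ`
with the `ρ_k`-average of the difference quotients of `u_k` paired with `φ`. Hölder with weight `m`
bounds that average by `E_k^{1/p} (∫ (∫ m^{1-q} dρ_k) |φ|^q dx)^{1/q}`, and the inner average tends
to `a^{1-q}` by dominated convergence. The converse Hölder inequality with weight `w = a^{1-q}`
returns `∫ w^{1-p} |∂_ω v|^p`, and `w^{1-p} = a` because `(1-q)(1-p) = 1`. So `∫ a |∂_ω v|^p dx ≤
liminf E_k(ω)` (`exists_directional_derivative_liminf_le`). Fatou's lemma on the sphere gives the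
inequality; directions with an `L^p` derivative form a subspace containing almost every direction,
hence a full gradient exists (`exists_memLp_gradient`).

Compactness. Let `F(h) = ∫ |u(x) - u(x-h)|^p dx`. Since `F(2h) ≤ 2^p F(h)`, the energies of
successive dyadic annuli decrease by at most the factor `θ = 2^{-p(1-s)}`, so one annulus carries at
most the fraction `1 - θ ≤ p(1-s)` of the whole energy
(`setLIntegral_annulus_translationEnergy_le`). Mollification with a kernel living in the annulus of
scale `t` is therefore `L^p`-close to `u_k` uniformly in `k`. For fixed `t` the mollified functions
are bounded and equi-Lipschitz, so a diagonal subsequence converges, and letting `t → 0` makes `u_k`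
itself Cauchy (`exists_subseq_tendstoLpLoc`). -/

noncomputable section

/-! ### Duality in `L^q`: converse Hölder and representation of functionals on finite measure
spaces. -/

/-- Converse of a weighted Hölder inequality. -/
theorem lintegral_rpow_le_of_forall_integral_mul_le {α : Type*} [MeasurableSpace α]
    {μ : Measure α} {p q : ℝ} (hpq : p.HolderConjugate q) {w : α → ℝ≥0∞} (hw : Measurable w)
    {lo hi : ℝ≥0∞} (hlo : lo ≠ 0) (hlo' : lo ≠ ∞) (hhi : hi ≠ ∞) (hwlo : ∀ x, lo ≤ w x) (hwhi : ∀ x, w x ≤ hi)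
    {h : α → ℝ} (hm : Measurable h) (hh : MemLp h (ENNReal.ofReal p) μ) {C : ℝ≥0∞}
    (hC : ∀ ψ : α → ℝ, MemLp ψ (ENNReal.ofReal q) μ →
      ‖∫ x, h x * ψ x ∂μ‖ₑ ≤ C * (∫⁻ x, w x * ‖ψ x‖ₑ ^ q ∂μ) ^ (1 / q)) :
    ∫⁻ x, w x ^ (1 - p) * ‖h x‖ₑ ^ p ∂μ ≤ C ^ p := by
  have hp0 := hpq.pos
  have hq0 := hpq.symm.pos
  have hp1 := hpq.lt
  have hw0 : ∀ x, w x ≠ 0 := fun x h0 => hlo (by simpa [h0] using hwlo x)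
  have hwt : ∀ x, w x ≠ ∞ := fun x h0 => hhi (by simpa [h0] using hwhi x)
  set W : α → ℝ := fun x => ((w x) ^ (1 - p)).toReal with hW
  have hWt : ∀ x, (w x) ^ (1 - p) ≠ ∞ := fun x => ENNReal.rpow_ne_top_of_ne_zero (hw0 x) (hwt x)
  -- The extremal function for Hölder's inequality: both `h ψ` and `w |ψ|^q` equal `w^{1-p} |h|^p`.
  set ψ : α → ℝ := fun x => SignType.sign (h x) * |h x| ^ (p - 1) * W x with hψ
  have hsm : Measurable fun x => ((SignType.sign (h x) : SignType) : ℝ) := by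
    have : (fun x => ((SignType.sign (h x) : SignType) : ℝ)) =
        fun x => if 0 < h x then (1 : ℝ) else if h x < 0 then -1 else 0 := by
      funext x
      rcases lt_trichotomy (h x) 0 with h1 | h1 | h1
      · simp [h1, h1.not_gt]
      · simp [h1]
      · simp [h1]
    rw [this]
    exact Measurable.ite (measurableSet_lt measurable_const hm) measurable_const
      (Measurable.ite (measurableSet_lt hm measurable_const) measurable_const measurable_const)
  have hψm : Measurable ψ := by
    refine (hsm.mul ?_).mul ?_
    · exact (hm.abs).pow_const _
    · exact (hw.pow_const _).ennreal_toReal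
  have hψe : ∀ x, w x * ‖ψ x‖ₑ ^ q = w x ^ (1 - p) * ‖h x‖ₑ ^ p := by
    intro x
    rcases eq_or_ne (h x) 0 with h0 | h0
    · simp [ψ, h0, hp0, hq0]
    have e1 : ‖ψ x‖ₑ = ‖h x‖ₑ ^ (p - 1) * w x ^ (1 - p) := by
      have : ‖ψ x‖ = |h x| ^ (p - 1) * W x := by
        simp only [ψ, norm_mul, Real.norm_eq_abs]
        rw [abs_of_nonneg (ENNReal.toReal_nonneg), abs_of_nonneg (Real.rpow_nonneg (abs_nonneg _) _)]
        rcases lt_or_gt_of_ne h0 with h1 | h1 <;> simp [h1, hW]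
      rw [← ofReal_norm, this, ENNReal.ofReal_mul (by positivity), hW,
        ENNReal.ofReal_toReal (hWt x), ← ENNReal.ofReal_rpow_of_nonneg (abs_nonneg _) (by linarith),
        ← Real.enorm_eq_ofReal_abs]
    rw [e1, ENNReal.mul_rpow_of_nonneg _ _ hq0.le, ← ENNReal.rpow_mul, ← ENNReal.rpow_mul,
      hpq.sub_one_mul_conj, show (1 - p) * q = -p by linarith [hpq.sub_one_mul_conj],
      mul_left_comm, mul_comm]
    congr 1
    nth_rewrite 1 [← ENNReal.rpow_one (w x)]
    rw [← ENNReal.rpow_add _ _ (hw0 x) (hwt x), sub_eq_add_neg]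
  have hI : ∫⁻ x, w x * ‖ψ x‖ₑ ^ q ∂μ = ∫⁻ x, w x ^ (1 - p) * ‖h x‖ₑ ^ p ∂μ :=
    lintegral_congr hψe
  have hp0' : ENNReal.ofReal p ≠ 0 := by simpa using hp0
  have hq0' : ENNReal.ofReal q ≠ 0 := by simpa using hq0
  -- Finiteness is what later allows dividing `I ≤ C I^{1/q}` by `I^{1/q}`; it comes from `w^{1-p} ≤
  -- lo^{1-p}`.
  have hfin : ∫⁻ x, w x ^ (1 - p) * ‖h x‖ₑ ^ p ∂μ ≠ ∞ := by
    have h1 := (eLpNorm_lt_top_iff_lintegral_rpow_enorm_lt_top hp0' ENNReal.ofReal_ne_top).1 hh.2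
    rw [ENNReal.toReal_ofReal hp0.le] at h1
    refine ((lintegral_mono (g := fun x => lo ^ (1 - p) * ‖h x‖ₑ ^ p) fun x => ?_).trans_lt ?_).ne
    · dsimp only
      gcongr ?_ * _
      rw [show (1 - p) = -(p - 1) by ring, ENNReal.rpow_neg, ENNReal.rpow_neg]
      gcongr
      exact hwlo x
    · rw [lintegral_const_mul _ (hm.enorm.pow_const _)]
      refine ENNReal.mul_lt_top ?_ h1
      exact (ENNReal.rpow_ne_top_of_ne_zero hlo hlo').lt_top
  have hψL : MemLp ψ (ENNReal.ofReal q) μ := by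
    refine ⟨hψm.aestronglyMeasurable,
      (eLpNorm_lt_top_iff_lintegral_rpow_enorm_lt_top hq0' ENNReal.ofReal_ne_top).2 ?_⟩
    rw [ENNReal.toReal_ofReal hq0.le]
    have : lo * ∫⁻ x, ‖ψ x‖ₑ ^ q ∂μ < ∞ := by
      rw [← lintegral_const_mul _ (hψm.enorm.pow_const _)]
      refine (lintegral_mono fun x => ?_).trans_lt (hI ▸ hfin.lt_top)
      gcongr
      exact hwlo x
    by_contra hcon
    simp only [not_lt, top_le_iff] at hcon
    rw [hcon, ENNReal.mul_top hlo] at this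
    exact lt_irrefl _ this
  have key := hC ψ hψL
  have hprod : ∀ x, h x * ψ x = (w x ^ (1 - p) * ‖h x‖ₑ ^ p).toReal := by
    intro x
    rw [ENNReal.toReal_mul, ← ENNReal.toReal_rpow ‖h x‖ₑ, toReal_enorm, Real.norm_eq_abs]
    rcases eq_or_ne (h x) 0 with h0 | h0
    · simp [h0, hp0.ne']
    · have h2 : h x * (SignType.sign (h x) : ℝ) = |h x| := by
        rw [mul_comm]; exact sign_mul_self (h x)
      have : |h x| ^ p = |h x| * |h x| ^ (p - 1) := by
        rw [← Real.rpow_one_add' (abs_nonneg _) (by linarith)]; ring_nf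
      calc h x * ψ x = (h x * (SignType.sign (h x) : ℝ)) * |h x| ^ (p - 1) * W x := by
            simp only [ψ]; ring
        _ = _ := by rw [h2, this]; ring
  have hint : ‖∫ x, h x * ψ x ∂μ‖ₑ = ∫⁻ x, w x ^ (1 - p) * ‖h x‖ₑ ^ p ∂μ := by
    simp_rw [hprod]
    rw [integral_toReal (f := fun x => w x ^ (1 - p) * ‖h x‖ₑ ^ p)
      ((hw.pow_const _).mul (hm.enorm.pow_const _)).aemeasurable]
    · rw [Real.enorm_eq_ofReal ENNReal.toReal_nonneg, ENNReal.ofReal_toReal hfin]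
    · refine Eventually.of_forall fun x => ENNReal.mul_lt_top (hWt x).lt_top ?_
      exact ENNReal.rpow_lt_top_of_nonneg hp0.le enorm_ne_top
  rw [hint, hI] at key
  set I := ∫⁻ x, w x ^ (1 - p) * ‖h x‖ₑ ^ p ∂μ
  rcases eq_or_ne I 0 with h0 | h0
  · simp [h0]
  have h3 : I = I ^ (1 / p) * I ^ (1 / q) := by
    rw [← ENNReal.rpow_add _ _ h0 hfin, one_div, one_div, hpq.inv_add_inv_eq_one, ENNReal.rpow_one]
  have h4 : I ^ (1 / p) ≤ C := by
    have h5 : I ^ (1 / q) ≠ 0 := by simp [h0, hfin]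
    have h6 : I ^ (1 / q) ≠ ∞ := by simp [h0, hfin]
    nth_rewrite 1 [h3] at key
    exact (ENNReal.mul_le_mul_iff_left h5 h6).1 key
  calc I = (I ^ (1 / p)) ^ p := by
        rw [← ENNReal.rpow_mul, one_div_mul_cancel hp0.ne', ENNReal.rpow_one]
    _ ≤ C ^ p := by gcongr

/-- The signed measure `E ↦ Λ 1_E` attached to a continuous functional on `L^q` of a finite
measure. -/
def signedMeasureOfFunctional {α : Type*} [MeasurableSpace α] {μ : Measure α} [IsFiniteMeasure μ]
    {q : ℝ≥0∞} [Fact (1 ≤ q)] (hq : q ≠ ∞) (Λ : Lp ℝ q μ →L[ℝ] ℝ) : SignedMeasure α where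
  measureOf' E := open scoped Classical in
    if h : MeasurableSet E then Λ (indicatorConstLp q h (measure_ne_top μ E) 1) else 0
  empty' := by simp
  not_measurable' E hE := by simp [hE]
  m_iUnion' f hf hd := by
    have hU : MeasurableSet (⋃ i, f i) := MeasurableSet.iUnion hf
    simp only [hf, hU, dite_true]
    have hsum : ∀ s : Finset ℕ, ∑ i ∈ s, Λ (indicatorConstLp q (hf i) (measure_ne_top μ _) 1) =
        Λ (indicatorConstLp q (s.measurableSet_biUnion fun i _ => hf i)
          (measure_ne_top μ (⋃ i ∈ s, f i)) 1) := by
      intro s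
      induction s using Finset.induction_on with
      | empty => simp
      | insert i s his ih =>
        rw [Finset.sum_insert his, ih, ← map_add]
        congr 1
        have hdis : Disjoint (f i) (⋃ j ∈ s, f j) := by
          simp only [disjoint_iUnion_right]
          intro j hj
          exact hd fun h => his (h ▸ hj)
        rw [← indicatorConstLp_disjoint_union (hf i) (s.measurableSet_biUnion fun i _ => hf i)
          (measure_ne_top μ _) (measure_ne_top μ _) hdis]
        congr 1
        simp
    unfold HasSum
    simp_rw [hsum]
    -- Countable additivity: as `q < ∞`, indicators of finite partial unions converge in `L^q` once
    -- the remaining measure tends to zero.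
    refine (Λ.continuous.tendsto _).comp ?_
    refine tendsto_indicatorConstLp_set hq ?_
    have h1 : Tendsto (fun s : Finset ℕ => μ ((⋃ i, f i) \ ⋃ i ∈ s, f i)) atTop (𝓝 0) := by
      have h2 : ∀ s : Finset ℕ, μ ((⋃ i, f i) \ ⋃ i ∈ s, f i) =
          μ (⋃ i, f i) - ∑ i ∈ s, μ (f i) := by
        intro s
        rw [measure_sdiff (iUnion₂_subset fun i _ => subset_iUnion f i)
          (s.measurableSet_biUnion fun i _ => hf i).nullMeasurableSet (measure_ne_top _ _),
          measure_biUnion_finset (fun i _ j _ h => hd h) fun i _ => hf i]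
      simp_rw [h2]
      have h3 : Tendsto (fun s : Finset ℕ => ∑ i ∈ s, μ (f i)) atTop (𝓝 (μ (⋃ i, f i))) := by
        rw [measure_iUnion hd hf]
        exact ENNReal.summable.hasSum
      have h4 := ENNReal.Tendsto.sub (tendsto_const_nhds (x := μ (⋃ i, f i))) h3
        (Or.inl (measure_ne_top _ _))
      simpa using h4
    refine h1.congr fun s => ?_
    rw [Set.symmDiff_def, sdiff_eq_bot_iff.2 (show (⋃ i ∈ s, f i) ⊆ ⋃ i, f i from
      iUnion₂_subset fun i _ => subset_iUnion f i)]
    simp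

theorem signedMeasureOfFunctional_apply {α : Type*} [MeasurableSpace α] {μ : Measure α}
    [IsFiniteMeasure μ] {q : ℝ≥0∞} [Fact (1 ≤ q)] (hq : q ≠ ∞) (Λ : Lp ℝ q μ →L[ℝ] ℝ)
    {E : Set α} (hE : MeasurableSet E) :
    signedMeasureOfFunctional hq Λ E = Λ (indicatorConstLp q hE (measure_ne_top μ E) 1) := by
  classical
  exact dif_pos hE

/-- Two continuous functionals on `L^q` of a finite measure agree if they agree on indicators. -/
theorem clm_Lp_eq_of_indicator {α : Type*} [MeasurableSpace α] {μ : Measure α}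
    [IsFiniteMeasure μ] {q : ℝ≥0∞} [Fact (1 ≤ q)] (hq : q ≠ ∞) (Λ M : Lp ℝ q μ →L[ℝ] ℝ)
    (h : ∀ {E : Set α} (hE : MeasurableSet E),
      Λ (indicatorConstLp q hE (measure_ne_top μ E) 1) =
        M (indicatorConstLp q hE (measure_ne_top μ E) 1)) : Λ = M := by
  ext f
  refine Lp.induction hq (motive := fun f => Λ f = M f) ?_ ?_ ?_ f
  · intro c s hs hμs
    rw [Lp.simpleFunc.coe_indicatorConst]
    have : indicatorConstLp q hs hμs.ne c = c • indicatorConstLp q hs (measure_ne_top μ s) (1 : ℝ) := by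
      refine Lp.ext ?_
      filter_upwards [indicatorConstLp_coeFn (μ := μ) (p := q) (hs := hs) (hμs := hμs.ne) (c := c),
        Lp.coeFn_smul c (indicatorConstLp q hs (measure_ne_top μ s) (1 : ℝ)),
        indicatorConstLp_coeFn (μ := μ) (p := q) (hs := hs) (hμs := measure_ne_top μ s)
          (c := (1 : ℝ))] with x h1 h2 h3
      rw [h1, h2, Pi.smul_apply, h3]
      by_cases hx : x ∈ s <;> simp [hx]
    rw [this, map_smul, map_smul, h]
  · intro f g hf hg _ h1 h2
    rw [map_add, map_add, h1, h2]
  · exact isClosed_eq Λ.continuous M.continuous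

/-- The dual of `L^q` of a finite measure is `L^p`, for `1 < p, q < ∞` conjugate. -/
theorem exists_memLp_forall_functional_eq_integral {α : Type*} [MeasurableSpace α] {μ : Measure α}
    [IsFiniteMeasure μ] {p q : ℝ} (hpq : p.HolderConjugate q) [Fact (1 ≤ ENNReal.ofReal q)]
    (Λ : Lp ℝ (ENNReal.ofReal q) μ →L[ℝ] ℝ) :
    ∃ g : α → ℝ, Measurable g ∧ MemLp g (ENNReal.ofReal p) μ ∧
      ∀ f : Lp ℝ (ENNReal.ofReal q) μ, Λ f = ∫ x, g x * f x ∂μ := by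
  have hp0 := hpq.pos
  have hq := ENNReal.ofReal_ne_top (r := q)
  have : Fact (1 ≤ ENNReal.ofReal p) := ⟨by simpa using hpq.lt.le⟩
  have := hpq.ennrealOfReal
  set lam := signedMeasureOfFunctional hq Λ with hlam
  have hac : lam ≪ᵥ μ.toENNRealVectorMeasure := by
    refine VectorMeasure.AbsolutelyContinuous.mk fun E hE h0 => ?_
    rw [Measure.toENNRealVectorMeasure_apply_measurable hE] at h0
    rw [hlam, signedMeasureOfFunctional_apply hq Λ hE]
    have : indicatorConstLp (ENNReal.ofReal q) hE (measure_ne_top μ E) (1 : ℝ) = 0 := by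
      rw [Lp.eq_zero_iff_ae_eq_zero]
      refine indicatorConstLp_coeFn.trans ?_
      exact indicator_meas_zero h0
    rw [this, map_zero]
  set f := lam.rnDeriv μ with hf
  have hfm : Measurable f := SignedMeasure.measurable_rnDeriv _ _
  have hfi : Integrable f μ := SignedMeasure.integrable_rnDeriv _ _
  have hfE : ∀ {E : Set α} (hE : MeasurableSet E),
      Λ (indicatorConstLp (ENNReal.ofReal q) hE (measure_ne_top μ E) 1) = ∫ x in E, f x ∂μ := by
    intro E hE
    rw [← signedMeasureOfFunctional_apply hq Λ hE, ← withDensityᵥ_apply hfi hE,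
      SignedMeasure.withDensityᵥ_rnDeriv_eq _ _ hac]
  -- truncations of `f` are bounded in `L^p` by the norm of the functional
  have htrunc : ∀ N : ℕ, eLpNorm ({x | |f x| ≤ N}.indicator f) (ENNReal.ofReal p) μ ≤ ‖Λ‖ₑ := by
    intro N
    set A := {x | |f x| ≤ N} with hA
    have hAm : MeasurableSet A := measurableSet_le hfm.abs measurable_const
    have hm : Measurable (A.indicator f) := hfm.indicator hAm
    have hL : ∀ r : ℝ≥0∞, MemLp (A.indicator f) r μ := fun r => by
      refine MemLp.of_bound hm.aestronglyMeasurable (N : ℝ) (Eventually.of_forall fun x => ?_)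
      by_cases hx : x ∈ A
      · rw [indicator_of_mem hx, Real.norm_eq_abs]; exact hx
      · rw [indicator_of_notMem hx]; simp
    -- `T` multiplies by `1_A`, a contraction of `L^q`. Since `f` is bounded on `A`, `Λ ∘ T` is the
    -- pairing with `1_A f`, so converse Hölder with weight `1` bounds `1_A f` by `‖Λ‖`,
    -- independently of `N`.
    let T : Lp ℝ (ENNReal.ofReal q) μ →L[ℝ] Lp ℝ (ENNReal.ofReal q) μ :=
      (ContinuousLinearMap.mul ℝ ℝ).holderL μ ∞ (ENNReal.ofReal q) (ENNReal.ofReal q)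
        (indicatorConstLp ∞ hAm (measure_ne_top μ A) 1)
    have hT : ∀ g, T g =ᵐ[μ] A.indicator g := by
      intro g
      have h1 : T g =ᵐ[μ] _ := (ContinuousLinearMap.mul ℝ ℝ).coeFn_holder _ g
      filter_upwards [h1, indicatorConstLp_coeFn (μ := μ) (p := ∞) (hs := hAm)
        (hμs := measure_ne_top μ A) (c := (1 : ℝ))] with x hx hx'
      rw [hx, hx']
      by_cases hxA : x ∈ A <;> simp [hxA]
    have hTn : ∀ g, ‖T g‖ ≤ ‖g‖ := by
      intro g
      refine Lp.norm_le_norm_of_ae_le ?_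
      filter_upwards [hT g] with x hx
      rw [hx]
      exact norm_indicator_le_norm_self _ _
    let M : Lp ℝ (ENNReal.ofReal q) μ →L[ℝ] ℝ :=
      (ContinuousLinearMap.mul ℝ ℝ).lpPairing μ (ENNReal.ofReal p) (ENNReal.ofReal q) ((hL _).toLp)
    have hM : ∀ g : Lp ℝ (ENNReal.ofReal q) μ, M g = ∫ x, A.indicator f x * g x ∂μ := by
      intro g
      rw [ContinuousLinearMap.lpPairing_eq_integral]
      refine integral_congr_ae ?_
      filter_upwards [(hL (ENNReal.ofReal p)).coeFn_toLp] with x hx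
      simp [hx]
    have hEq : Λ.comp T = M := by
      refine clm_Lp_eq_of_indicator hq _ _ fun {E} hE => ?_
      have h1 : T (indicatorConstLp (ENNReal.ofReal q) hE (measure_ne_top μ E) 1) =
          indicatorConstLp (ENNReal.ofReal q) (hAm.inter hE) (measure_ne_top μ _) 1 := by
        refine Lp.ext ?_
        filter_upwards [hT (indicatorConstLp (ENNReal.ofReal q) hE (measure_ne_top μ E) 1),
          indicatorConstLp_coeFn (μ := μ) (p := ENNReal.ofReal q) (hs := hAm.inter hE)
            (hμs := measure_ne_top μ _) (c := (1 : ℝ)),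
          indicatorConstLp_coeFn (μ := μ) (p := ENNReal.ofReal q) (hs := hE)
            (hμs := measure_ne_top μ _) (c := (1 : ℝ))] with x hx hx' hx''
        rw [hx, hx', ← indicator_indicator]
        by_cases hxA : x ∈ A <;> simp [hxA, hx'']
      rw [ContinuousLinearMap.comp_apply, h1, hfE, hM]
      rw [inter_comm, ← integral_indicator (hE.inter hAm)]
      refine integral_congr_ae ?_
      filter_upwards [indicatorConstLp_coeFn (μ := μ) (p := ENNReal.ofReal q) (hs := hE)
            (hμs := measure_ne_top μ _) (c := (1 : ℝ))] with x hx
      rw [hx, ← indicator_indicator]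
      by_cases hxE : x ∈ E <;> simp [hxE]
    have hw := lintegral_rpow_le_of_forall_integral_mul_le (μ := μ) hpq (w := fun _ => 1)
      measurable_const (lo := 1) (hi := 1) one_ne_zero ENNReal.one_ne_top ENNReal.one_ne_top
      (fun _ => le_rfl) (fun _ => le_rfl) hm (hL _) (C := ‖Λ‖ₑ) (by
        intro ψ hψ
        have h1 : ∫ x, A.indicator f x * ψ x ∂μ = Λ (T hψ.toLp) := by
          rw [← ContinuousLinearMap.comp_apply, hEq, hM]
          refine integral_congr_ae ?_
          filter_upwards [hψ.coeFn_toLp] with x hx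
          rw [hx]
        have h2 : ‖Λ (T hψ.toLp)‖ₑ ≤ ‖Λ‖ₑ * ‖hψ.toLp‖ₑ := by
          refine (Λ.le_opENorm _).trans ?_
          gcongr
          exact enorm_le_iff_norm_le.2 (hTn _)
        rw [h1]
        refine h2.trans_eq ?_
        rw [Lp.enorm_toLp, eLpNorm_eq_lintegral_rpow_enorm_toReal
          (by simpa using hpq.symm.pos) hq, ENNReal.toReal_ofReal hpq.symm.nonneg]
        simp)
    rw [eLpNorm_eq_lintegral_rpow_enorm_toReal (by simpa using hp0) ENNReal.ofReal_ne_top,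
      ENNReal.toReal_ofReal hp0.le]
    simp only [ENNReal.one_rpow, one_mul] at hw
    calc _ ≤ (‖Λ‖ₑ ^ p) ^ (1 / p) := by gcongr
      _ = _ := by rw [← ENNReal.rpow_mul, mul_one_div_cancel hp0.ne', ENNReal.rpow_one]
  -- Fatou's lemma carries the uniform bound from the truncations to `f`.
  have hfL : MemLp f (ENNReal.ofReal p) μ := by
    refine ⟨hfm.aestronglyMeasurable, ?_⟩
    refine (Lp.eLpNorm_lim_le_liminf_eLpNorm (f := fun N : ℕ => {x | |f x| ≤ N}.indicator f)
      (fun N => (hfm.indicator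
        (measurableSet_le hfm.abs measurable_const)).aestronglyMeasurable) f
      (Eventually.of_forall fun x => ?_)).trans_lt ?_
    · refine tendsto_const_nhds.congr' ?_
      filter_upwards [eventually_ge_atTop (Nat.ceil |f x|)] with N hN
      rw [indicator_of_mem]
      exact Nat.ceil_le.1 hN
    · refine lt_of_le_of_lt ?_ (enorm_lt_top (x := Λ))
      exact liminf_le_of_le (by isBoundedDefault) fun b hb => by
        obtain ⟨N, hN⟩ := hb.exists
        exact hN.trans (htrunc N)
  refine ⟨f, hfm, hfL, fun g => ?_⟩
  have hEq : Λ = (ContinuousLinearMap.mul ℝ ℝ).lpPairing μ (ENNReal.ofReal p) (ENNReal.ofReal q)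
      hfL.toLp := by
    refine clm_Lp_eq_of_indicator hq _ _ fun {E} hE => ?_
    rw [ContinuousLinearMap.lpPairing_eq_integral, hfE, ← integral_indicator hE]
    refine integral_congr_ae ?_
    filter_upwards [indicatorConstLp_coeFn (μ := μ) (p := ENNReal.ofReal q) (hs := hE)
            (hμs := measure_ne_top μ _) (c := (1 : ℝ)), hfL.coeFn_toLp] with x hx hx'
    rw [hx, hx']
    by_cases hxE : x ∈ E <;> simp [hxE]
  rw [hEq, ContinuousLinearMap.lpPairing_eq_integral]
  refine integral_congr_ae ?_
  filter_upwards [hfL.coeFn_toLp] with x hx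
  simp [hx]

/-! ### Functionals on test functions that are bounded in (weighted) `L^q(ℝⁿ)`. -/

/-- Euclidean space of dimension `n`. -/
abbrev Euc (n : ℕ) := EuclideanSpace ℝ (Fin n)

/-- The space of smooth compactly supported functions on `ℝⁿ`. -/
def testFunctions (n : ℕ) : Submodule ℝ (Euc n → ℝ) where
  carrier := {φ | ContDiff ℝ (⊤ : ℕ∞) φ ∧ HasCompactSupport φ}
  add_mem' h1 h2 := ⟨h1.1.add h2.1, h1.2.add h2.2⟩
  zero_mem' := ⟨contDiff_const, HasCompactSupport.zero⟩
  smul_mem' c _ h := ⟨contDiff_const.smul h.1, h.2.smul_left (f := fun _ => c)⟩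

theorem testFunctions.memLp {n : ℕ} {φ : Euc n → ℝ} (hφ : φ ∈ testFunctions n) (q : ℝ≥0∞)
    (μ : Measure (Euc n)) [IsFiniteMeasureOnCompacts μ] : MemLp φ q μ :=
  hφ.1.continuous.memLp_of_hasCompactSupport hφ.2

theorem enorm_rpow_toReal_eLpNorm {α F : Type*} [MeasurableSpace α] [NormedAddCommGroup F]
    (μ : Measure α) {q : ℝ} (hq : 0 < q) (f : α → F) :
    eLpNorm f (ENNReal.ofReal q) μ = (∫⁻ x, ‖f x‖ₑ ^ q ∂μ) ^ (1 / q) := by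
  rw [eLpNorm_eq_lintegral_rpow_enorm_toReal (by simpa using hq) ENNReal.ofReal_ne_top,
    ENNReal.toReal_ofReal hq.le]

/-- A functional on test functions which is bounded in `L^q` is represented by an `L^p` function. -/
theorem exists_memLp_forall_test_eq_integral {n : ℕ} {p q : ℝ} (hpq : p.HolderConjugate q)
    (L : testFunctions n →ₗ[ℝ] ℝ) {C : ℝ} (hC : 0 ≤ C)
    (hL : ∀ φ : testFunctions n,
      ‖L φ‖ₑ ≤ ENNReal.ofReal C * eLpNorm (φ : Euc n → ℝ) (ENNReal.ofReal q) volume) :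
    ∃ g : Euc n → ℝ, Measurable g ∧ MemLp g (ENNReal.ofReal p) ∧
      ∀ φ : testFunctions n, L φ = ∫ x, g x * (φ : Euc n → ℝ) x := by
  have hp0 := hpq.pos
  have hq0 := hpq.symm.pos
  have hq1 := hpq.symm.lt
  have hq := ENNReal.ofReal_ne_top (r := q)
  have : Fact (1 ≤ ENNReal.ofReal q) := ⟨by simpa using hq1.le⟩
  -- A smooth positive integrable weight reduces Lebesgue measure to the finite measure `ν = η^q
  -- dx`: `φ ↦ ηφ` preserves test functions and is isometric from `L^q(ν)` to `L^q(dx)`.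
  set η : Euc n → ℝ := fun x => ((1 + ‖x‖ ^ 2) ^ (n + 1))⁻¹ with hη
  have hη0 : ∀ x, 0 < η x := fun x => by positivity
  have hη1 : ∀ x, η x ≤ 1 := fun x => by
    apply inv_le_one_of_one_le₀
    exact one_le_pow₀ (by nlinarith [sq_nonneg ‖x‖])
  have hηs : ContDiff ℝ (⊤ : ℕ∞) η := by
    refine ContDiff.inv ?_ fun x => by positivity
    exact (contDiff_const.add (contDiff_norm_sq ℝ)).pow _
  have hηm : Measurable η := hηs.continuous.measurable
  have hηi : Integrable η := by
    have h1 := integrable_rpow_neg_one_add_norm_sq (E := Euc n) (μ := volume)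
      (r := 2 * (n + 1 : ℕ)) (by
        rw [finrank_euclideanSpace_fin]; push_cast; nlinarith [(Nat.cast_nonneg n : (0:ℝ) ≤ n)])
    refine h1.congr (Eventually.of_forall fun x => ?_)
    simp only [hη]
    rw [show -(2 * ((n + 1 : ℕ) : ℝ)) / 2 = -((n + 1 : ℕ) : ℝ) by ring,
      Real.rpow_neg (by positivity), Real.rpow_natCast]
  set d : Euc n → ℝ≥0∞ := fun x => ENNReal.ofReal (η x ^ q) with hd
  have hdm : Measurable d := (hηm.pow_const _).ennreal_ofReal
  set ν : Measure (Euc n) := volume.withDensity d with hν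
  have hfin : IsFiniteMeasure ν := by
    refine isFiniteMeasure_withDensity_ofReal ?_
    refine (hηi.mono' (hηm.pow_const _).aestronglyMeasurable
      (Eventually.of_forall fun x => ?_)).2
    rw [Real.norm_eq_abs, abs_of_nonneg (Real.rpow_nonneg (hη0 x).le _)]
    calc η x ^ q ≤ η x ^ (1 : ℝ) := Real.rpow_le_rpow_of_exponent_ge (hη0 x) (hη1 x) hq1.le
      _ = η x := Real.rpow_one _
  -- multiplication by `η` and by its inverse
  let mulη : testFunctions n →ₗ[ℝ] testFunctions n :=
    { toFun := fun φ => ⟨fun x => η x * (φ : Euc n → ℝ) x, hηs.mul φ.2.1, φ.2.2.mul_left⟩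
      map_add' := fun φ ψ => by ext x; simp [mul_add]
      map_smul' := fun c φ => by ext x; simp; ring }
  let e : testFunctions n →ₗ[ℝ] Lp ℝ (ENNReal.ofReal q) ν :=
    { toFun := fun φ => (testFunctions.memLp φ.2 (ENNReal.ofReal q) ν).toLp
      map_add' := fun φ ψ => rfl
      map_smul' := fun c φ => rfl }
  have he : DenseRange e := by
    refine (Lp.dense_hasCompactSupport_contDiff (E := Euc n) (F := ℝ) (μ := ν) hq).mono ?_
    rintro f ⟨g, hfg, hg1, hg2⟩
    refine ⟨⟨g, hg2, hg1⟩, ?_⟩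
    refine Lp.ext ?_
    exact ((testFunctions.memLp ⟨hg2, hg1⟩ (ENNReal.ofReal q) ν).coeFn_toLp).trans hfg.symm
  have hnorm : ∀ φ : testFunctions n,
      eLpNorm (mulη φ : Euc n → ℝ) (ENNReal.ofReal q) volume =
        eLpNorm (φ : Euc n → ℝ) (ENNReal.ofReal q) ν := by
    intro φ
    rw [enorm_rpow_toReal_eLpNorm _ hq0, enorm_rpow_toReal_eLpNorm _ hq0, hν,
      lintegral_withDensity_eq_lintegral_mul _ hdm
        ((φ.2.1.continuous.measurable.enorm).pow_const _)]
    congr 1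
    refine lintegral_congr fun x => ?_
    simp only [mulη, LinearMap.coe_mk, AddHom.coe_mk, Pi.mul_apply, hd]
    rw [enorm_mul, ENNReal.mul_rpow_of_nonneg _ _ hq0.le, Real.enorm_eq_ofReal (hη0 x).le,
      ENNReal.ofReal_rpow_of_nonneg (hη0 x).le hq0.le]
  have hbd : ∀ φ, ‖(L.comp mulη) φ‖ ≤ C * ‖e φ‖ := by
    intro φ
    have h1 := hL (mulη φ)
    rw [hnorm] at h1
    have h2 : eLpNorm (φ : Euc n → ℝ) (ENNReal.ofReal q) ν = ENNReal.ofReal ‖e φ‖ := by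
      rw [ofReal_norm]
      exact (Lp.enorm_toLp (testFunctions.memLp φ.2 (ENNReal.ofReal q) ν)).symm
    rw [h2, ← ENNReal.ofReal_mul hC, ← ofReal_norm,
      ENNReal.ofReal_le_ofReal_iff (by positivity)] at h1
    exact h1
  obtain ⟨g, hgm, hgL, hg⟩ := exists_memLp_forall_functional_eq_integral hpq
    ((L.comp mulη).extendOfNorm e)
  -- `L φ` is the extended functional at `φ/η`, that is `∫ g (φ/η) η^q dx`. The `L^p` norm is kept
  -- because `(q-1)p = q`.
  refine ⟨fun x => g x * η x ^ (q - 1), hgm.mul (hηm.pow_const _), ?_, fun φ => ?_⟩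
  · refine ⟨(hgm.mul (hηm.pow_const _)).aestronglyMeasurable, ?_⟩
    have h1 := hgL.2
    rw [enorm_rpow_toReal_eLpNorm _ hp0] at h1 ⊢
    refine lt_of_eq_of_lt ?_ h1
    rw [hν, lintegral_withDensity_eq_lintegral_mul _ hdm (hgm.enorm.pow_const _)]
    congr 1
    refine lintegral_congr fun x => ?_
    simp only [Pi.mul_apply, hd]
    rw [enorm_mul, ENNReal.mul_rpow_of_nonneg _ _ hp0.le,
      Real.enorm_eq_ofReal (Real.rpow_nonneg (hη0 x).le _),
      ENNReal.ofReal_rpow_of_nonneg (Real.rpow_nonneg (hη0 x).le _) hp0.le,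
      ← Real.rpow_mul (hη0 x).le, hpq.symm.sub_one_mul_conj, mul_comm]
  · let ψ : testFunctions n := ⟨fun x => (η x)⁻¹ * (φ : Euc n → ℝ) x,
      (hηs.inv fun x => (hη0 x).ne').mul φ.2.1, φ.2.2.mul_left⟩
    have h1 : mulη ψ = φ := by
      ext x
      simp only [mulη, ψ, LinearMap.coe_mk, AddHom.coe_mk]
      rw [mul_inv_cancel_left₀ (hη0 x).ne']
    have h2 : (L.comp mulη).extendOfNorm e (e ψ) = L φ := by
      rw [LinearMap.extendOfNorm_eq he ⟨C, hbd⟩, LinearMap.comp_apply, h1]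
    rw [← h2, hg]
    have h3 : ∫ x, g x * (e ψ) x ∂ν = ∫ x, g x * ψ.1 x ∂ν := by
      refine integral_congr_ae ?_
      filter_upwards [(testFunctions.memLp ψ.2 (ENNReal.ofReal q) ν).coeFn_toLp] with x hx
      exact congrArg (g x * ·) hx
    rw [h3, hν, integral_withDensity_eq_integral_toReal_smul hdm
      (Eventually.of_forall fun x => ENNReal.ofReal_lt_top)]
    refine integral_congr_ae (Eventually.of_forall fun x => ?_)
    simp only [hd, ψ, smul_eq_mul]
    rw [ENNReal.toReal_ofReal (Real.rpow_nonneg (hη0 x).le _), Real.rpow_sub_one (hη0 x).ne']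
    ring

/-- Weighted form of the representation of functionals on test functions. -/
theorem exists_memLp_forall_test_eq_integral_and_weighted_le {n : ℕ} {p q : ℝ}
    (hpq : p.HolderConjugate q) (L : testFunctions n →ₗ[ℝ] ℝ) {w : Euc n → ℝ≥0∞}
    (hw : Measurable w) {lo hi : ℝ≥0∞} (hlo : lo ≠ 0) (hlo' : lo ≠ ∞) (hhi : hi ≠ ∞)
    (hwlo : ∀ x, lo ≤ w x) (hwhi : ∀ x, w x ≤ hi) {C : ℝ≥0∞} (hC : C ≠ ∞)
    (hL : ∀ φ : testFunctions n,
      ‖L φ‖ₑ ≤ C * (∫⁻ x, w x * ‖(φ : Euc n → ℝ) x‖ₑ ^ q) ^ (1 / q)) :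
    ∃ g : Euc n → ℝ, Measurable g ∧ MemLp g (ENNReal.ofReal p) ∧
      (∀ φ : testFunctions n, L φ = ∫ x, g x * (φ : Euc n → ℝ) x) ∧
      ∫⁻ x, w x ^ (1 - p) * ‖g x‖ₑ ^ p ≤ C ^ p := by
  have hp0 := hpq.pos
  have hq0 := hpq.symm.pos
  have hq1 := hpq.symm.lt
  have hq := ENNReal.ofReal_ne_top (r := q)
  -- comparison of the weighted norm with the plain norm
  have hcomp : ∀ ψ : Euc n → ℝ, (∫⁻ x, w x * ‖ψ x‖ₑ ^ q) ^ (1 / q) ≤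
      hi ^ (1 / q) * eLpNorm ψ (ENNReal.ofReal q) volume := by
    intro ψ
    rw [enorm_rpow_toReal_eLpNorm _ hq0, ← ENNReal.mul_rpow_of_nonneg _ _ (by positivity),
      ← lintegral_const_mul' _ _ hhi]
    gcongr with x
    exact hwhi x
  have hCf : C * hi ^ (1 / q) ≠ ∞ :=
    ENNReal.mul_ne_top hC (ENNReal.rpow_ne_top_of_nonneg (by positivity) hhi)
  obtain ⟨g, hgm, hgL, hg⟩ := exists_memLp_forall_test_eq_integral hpq L
    (C := (C * hi ^ (1 / q)).toReal) ENNReal.toReal_nonneg (fun φ => by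
      rw [ENNReal.ofReal_toReal hCf, mul_assoc]
      exact (hL φ).trans (by gcongr; exact hcomp _))
  refine ⟨g, hgm, hgL, hg, ?_⟩
  refine lintegral_rpow_le_of_forall_integral_mul_le hpq hw hlo hlo' hhi hwlo hwhi hgm hgL ?_
  intro ψ hψ
  -- approximation by test functions
  have happ : ∀ k : ℕ, ∃ φ : testFunctions n,
      eLpNorm (ψ - φ.1) (ENNReal.ofReal q) volume ≤ ENNReal.ofReal (1 / (k + 1)) := by
    intro k
    obtain ⟨φ, h1, h2, h3⟩ := hψ.exist_eLpNorm_sub_le hq (by simpa using hq1.le)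
      (ε := 1 / (k + 1)) (by positivity)
    exact ⟨⟨φ, h2, h1⟩, h3⟩
  choose φ hφ using happ
  have hlim : Tendsto (fun k => eLpNorm (ψ - (φ k).1) (ENNReal.ofReal q) volume) atTop (𝓝 0) := by
    refine tendsto_of_tendsto_of_tendsto_of_le_of_le tendsto_const_nhds ?_ (fun _ => zero_le) hφ
    rw [← ENNReal.ofReal_zero]
    exact ENNReal.tendsto_ofReal tendsto_one_div_add_atTop_nhds_zero_nat
  have hbound : ∀ k, ‖∫ x, g x * ψ x‖ₑ ≤ C * (∫⁻ x, w x * ‖ψ x‖ₑ ^ q) ^ (1 / q) +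
      (eLpNorm g (ENNReal.ofReal p) volume + C * hi ^ (1 / q)) *
        eLpNorm (ψ - (φ k).1) (ENNReal.ofReal q) volume := by
    intro k
    have hφL := testFunctions.memLp (φ k).2 (ENNReal.ofReal q) volume
    have := hpq.ennrealOfReal
    have i1 : Integrable (fun x => g x * (φ k).1 x) := hgL.integrable_mul hφL
    have i2 : Integrable (fun x => g x * (ψ - (φ k).1) x) := hgL.integrable_mul (hψ.sub hφL)
    have h1 : ∫ x, g x * ψ x = (∫ x, g x * (φ k).1 x) + ∫ x, g x * (ψ - (φ k).1) x := by
      rw [← integral_add i1 i2]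
      congr 1; ext x; simp; ring
    have h2 : ‖∫ x, g x * (ψ - (φ k).1) x‖ₑ ≤
        eLpNorm g (ENNReal.ofReal p) volume * eLpNorm (ψ - (φ k).1) (ENNReal.ofReal q) volume := by
      refine (enorm_integral_le_lintegral_enorm _).trans ?_
      rw [enorm_rpow_toReal_eLpNorm _ hp0, enorm_rpow_toReal_eLpNorm _ hq0]
      simp_rw [enorm_mul]
      exact ENNReal.lintegral_mul_le_Lp_mul_Lq volume hpq hgm.enorm.aemeasurable
        (hψ.sub hφL).1.enorm
    have h3 : ‖∫ x, g x * (φ k).1 x‖ₑ ≤ C * ((∫⁻ x, w x * ‖ψ x‖ₑ ^ q) ^ (1 / q) +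
        hi ^ (1 / q) * eLpNorm (ψ - (φ k).1) (ENNReal.ofReal q) volume) := by
      rw [← hg]
      refine (hL _).trans ?_
      gcongr
      refine le_trans ?_ (add_le_add le_rfl (hcomp _))
      have h4 := ENNReal.lintegral_Lp_add_le (μ := volume) (p := q)
        (f := fun x => w x ^ (1 / q) * ‖ψ x‖ₑ) (g := fun x => w x ^ (1 / q) * ‖(ψ - (φ k).1) x‖ₑ)
        ((hw.pow_const _).aemeasurable.mul hψ.1.enorm)
        ((hw.pow_const _).aemeasurable.mul (hψ.sub hφL).1.enorm) hq1.le
      have h5 : ∀ f : Euc n → ℝ, ∀ x, (w x ^ (1 / q) * ‖f x‖ₑ) ^ q = w x * ‖f x‖ₑ ^ q := by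
        intro f x
        rw [ENNReal.mul_rpow_of_nonneg _ _ hq0.le, ← ENNReal.rpow_mul,
          one_div_mul_cancel hq0.ne', ENNReal.rpow_one]
      simp_rw [h5] at h4
      refine le_trans ?_ h4
      simp_rw [← h5]
      gcongr with x
      simp only [Pi.add_apply]
      rw [← mul_add]
      gcongr
      have : (φ k).1 x = ψ x - (ψ - (φ k).1) x := by simp
      rw [this]
      exact enorm_sub_le
    rw [h1]
    calc _ ≤ _ := enorm_add_le _ _
      _ ≤ _ := add_le_add h3 h2
      _ = _ := by ring
  have h6 := ENNReal.Tendsto.const_mul hlim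
    (a := eLpNorm g (ENNReal.ofReal p) volume + C * hi ^ (1 / q))
    (Or.inr (ENNReal.add_ne_top.2 ⟨hgL.2.ne, hCf⟩))
  have h7 := (tendsto_const_nhds (x := C * (∫⁻ x, w x * ‖ψ x‖ₑ ^ q) ^ (1 / q))).add h6
  rw [mul_zero, add_zero] at h7
  exact ge_of_tendsto' h7 hbound

/-! ### Difference quotients and distributional directional derivatives. -/

/-- Uniform bounds on the difference quotients of a test function in a fixed direction. -/
theorem exists_forall_test_difference_le {n : ℕ} {φ : Euc n → ℝ} (hφ : φ ∈ testFunctions n)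
    (e : Euc n) : ∃ M : ℝ, 0 ≤ M ∧ ∀ r ∈ Ioo (0 : ℝ) 1, ∀ x,
      |(φ x - φ (x + r • e)) / r| ≤ M ∧
      |(φ x - φ (x + r • e)) / r + fderiv ℝ φ x e| ≤ M * r := by
  obtain ⟨C1, h1⟩ := hφ.1.lipschitzWith_of_hasCompactSupport hφ.2 (by simp)
  have hd : ContDiff ℝ 1 (fderiv ℝ φ) := hφ.1.fderiv_right (by norm_cast)
  obtain ⟨C2, h2⟩ := hd.lipschitzWith_of_hasCompactSupport (hφ.2.fderiv ℝ) one_ne_zero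
  -- The first summand is the Lipschitz bound for `φ`, the second the Lipschitz bound for its
  -- derivative; their sum serves both estimates.
  refine ⟨C1 * ‖e‖ + C2 * ‖e‖ * ‖e‖, by positivity, fun r hr x => ?_⟩
  have hr0 := hr.1
  have hre : ‖r • e‖ = r * ‖e‖ := by rw [norm_smul, Real.norm_eq_abs, abs_of_pos hr0]
  constructor
  · rw [abs_div, abs_of_pos hr0, div_le_iff₀ hr0]
    have h3 := h1.dist_le_mul x (x + r • e)
    rw [Real.dist_eq, dist_self_add_right, hre] at h3
    refine h3.trans ?_
    have : 0 ≤ (C2 : ℝ) * ‖e‖ * ‖e‖ * r := by positivity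
    nlinarith
  · have h3 : ‖φ (x + r • e) - φ x - fderiv ℝ φ x ((x + r • e) - x)‖ ≤
        (C2 * (r * ‖e‖)) * ‖(x + r • e) - x‖ := by
      refine (convex_closedBall x (r * ‖e‖)).norm_image_sub_le_of_norm_hasFDerivWithin_le'
        (𝕜 := ℝ) (f' := fun y => fderiv ℝ φ y) (fun y _ =>
          ((hφ.1.differentiable (by simp)) y).hasFDerivAt.hasFDerivWithinAt) ?_
        (Metric.mem_closedBall_self (by positivity)) ?_
      · intro y hy
        have h4 := h2.dist_le_mul y x
        rw [dist_eq_norm] at h4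
        refine h4.trans ?_
        gcongr
        exact hy
      · simp [hre]
    rw [add_sub_cancel_left, hre, map_smul, smul_eq_mul, Real.norm_eq_abs] at h3
    have h5 : (φ x - φ (x + r • e)) / r + fderiv ℝ φ x e =
        -(φ (x + r • e) - φ x - r * fderiv ℝ φ x e) / r := by
      field_simp; ring
    rw [h5, abs_div, abs_neg, abs_of_pos hr0, div_le_iff₀ hr0]
    refine h3.trans ?_
    have : 0 ≤ (C1 : ℝ) * ‖e‖ * r * r := by positivity
    nlinarith

/-- The functional `φ ↦ -∫ v ∂ₑφ` on test functions. -/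
def distribDeriv {n : ℕ} {v : Euc n → ℝ} (hv : LocallyIntegrable v) (e : Euc n) :
    testFunctions n →ₗ[ℝ] ℝ where
  toFun φ := -∫ x, v x * fderiv ℝ (φ : Euc n → ℝ) x e
  map_add' φ ψ := by
    have hi : ∀ φ : testFunctions n, Integrable fun x => v x * fderiv ℝ (φ : Euc n → ℝ) x e :=
      fun φ => hv.integrable_smul_right_of_hasCompactSupport
        ((φ.2.1.continuous_fderiv (by simp)).clm_apply continuous_const)
        (φ.2.2.fderiv_apply ℝ e)
    rw [← neg_add, ← integral_add (hi φ) (hi ψ)]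
    congr 2
    ext x
    have := fderiv_add (φ.2.1.differentiable (by simp) x) (ψ.2.1.differentiable (by simp) x)
    simp only [Submodule.coe_add]
    rw [this]
    simp [mul_add]
  map_smul' c φ := by
    simp only [Submodule.coe_smul, RingHom.id_apply, smul_eq_mul, mul_neg]
    rw [← integral_const_mul]
    congr 2
    ext x
    have := fderiv_const_smul (φ.2.1.differentiable (by simp) x) c
    rw [this]
    simp
    ring

/-- Translation invariance moves the difference quotient from `u` onto `φ`. Replacing `u` by `v`,
and then the quotient of `φ` by `-∂ₑφ`, costs the two error terms. The order of quantifiers matters: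
`M` and `K` depend neither on `u` nor on `r`, so the estimate can be averaged in `r` and used along
a sequence. `K` contains the supports of all shifts `φ(· + re)` because `r < 1`. -/
theorem enorm_distribDeriv_le {n : ℕ} {v : Euc n → ℝ} (hv : LocallyIntegrable v) (e : Euc n)
    (φ : testFunctions n) : ∃ (M : ℝ≥0∞) (K : Set (Euc n)), M ≠ ∞ ∧ IsCompact K ∧
      ∀ u : Euc n → ℝ, LocallyIntegrable u → ∀ r ∈ Ioo (0 : ℝ) 1,
        ‖distribDeriv hv e φ‖ₑ ≤ (∫⁻ x, ‖(u x - u (x - r • e)) / r‖ₑ * ‖(φ : Euc n → ℝ) x‖ₑ) +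
          M * (∫⁻ x in K, ‖u x - v x‖ₑ) + M * (∫⁻ x in K, ‖v x‖ₑ) * ENNReal.ofReal r := by
  obtain ⟨M, hM0, hM⟩ := exists_forall_test_difference_le φ.2 e
  set f : Euc n → ℝ := φ.1 with hf
  have hfc : Continuous f := φ.2.1.continuous
  set K := Metric.cthickening ‖e‖ (tsupport f) with hK
  have hKc : IsCompact K := IsCompact.cthickening φ.2.2
  refine ⟨ENNReal.ofReal M, K, ENNReal.ofReal_ne_top, hKc, fun u hu r hr => ?_⟩
  have hr0 := hr.1
  set Q : Euc n → ℝ := fun x => (f x - f (x + r • e)) / r with hQ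
  have hQc : Continuous Q := by
    refine (hfc.sub (hfc.comp (continuous_id.add continuous_const))).div_const _
  have hfK : ∀ x, x ∉ K → f x = 0 ∧ f (x + r • e) = 0 ∧ fderiv ℝ f x e = 0 := by
    intro x hx
    have h1 : x ∉ tsupport f := fun h => hx (Metric.self_subset_cthickening _ h)
    refine ⟨image_eq_zero_of_notMem_tsupport h1, image_eq_zero_of_notMem_tsupport fun h => hx ?_, ?_⟩
    · refine Metric.mem_cthickening_of_dist_le x (x + r • e) _ _ h ?_
      rw [dist_self_add_right, norm_smul, Real.norm_eq_abs, abs_of_pos hr0]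
      nlinarith [norm_nonneg e, hr.2]
    · have : fderiv ℝ f x = 0 := by
        by_contra h
        exact h1 (support_fderiv_subset ℝ h)
      simp [this]
  have hdc : Continuous fun x => fderiv ℝ f x e :=
    (φ.2.1.continuous_fderiv (by simp)).clm_apply continuous_const
  have hQs : HasCompactSupport Q := HasCompactSupport.intro hKc fun x hx => by
    simp [hQ, (hfK x hx).1, (hfK x hx).2.1]
  have hds : HasCompactSupport fun x => fderiv ℝ f x e := φ.2.2.fderiv_apply ℝ e
  have iuQ : Integrable fun x => u x * Q x := hu.integrable_smul_right_of_hasCompactSupport hQc hQs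
  have ivQ : Integrable fun x => v x * Q x := hv.integrable_smul_right_of_hasCompactSupport hQc hQs
  have ivd : Integrable fun x => v x * fderiv ℝ f x e :=
    hv.integrable_smul_right_of_hasCompactSupport hdc hds
  have huf : Integrable fun x => u x * f x :=
    hu.integrable_smul_right_of_hasCompactSupport hfc φ.2.2
  have huf' : Integrable fun x => u x * f (x + r • e) :=
    hu.integrable_smul_right_of_hasCompactSupport (hfc.comp (continuous_id.add continuous_const))
      (HasCompactSupport.intro hKc fun x hx => (hfK x hx).2.1)
  have huf'' : Integrable fun x => u (x - r • e) * f x := by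
    have := huf'.comp_sub_right (r • e)
    simpa using this
  have hdis : ∫ x, (u x - u (x - r • e)) / r * f x = ∫ x, u x * Q x := by
    have h1 : ∫ x, u (x - r • e) * f x = ∫ x, u x * f (x + r • e) := by
      rw [← integral_sub_right_eq_self (fun x => u x * f (x + r • e)) (r • e)]
      simp
    have h2 : ∀ x, (u x - u (x - r • e)) / r * f x = r⁻¹ * (u x * f x - u (x - r • e) * f x) := by
      intro x; ring
    have h3 : ∀ x, u x * Q x = r⁻¹ * (u x * f x - u x * f (x + r • e)) := by
      intro x; simp only [hQ]; ring
    simp_rw [h2, h3]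
    rw [integral_const_mul, integral_const_mul, integral_sub huf huf'', integral_sub huf huf', h1]
  have hsplit : distribDeriv hv e φ = (∫ x, (u x - u (x - r • e)) / r * f x) +
      (-∫ x, (u x - v x) * Q x) + (-∫ x, v x * (Q x + fderiv ℝ f x e)) := by
    have h1 : ∫ x, (u x - v x) * Q x = (∫ x, u x * Q x) - ∫ x, v x * Q x := by
      simp_rw [sub_mul]; exact integral_sub iuQ ivQ
    have h2 : ∫ x, v x * (Q x + fderiv ℝ f x e) = (∫ x, v x * Q x) + ∫ x, v x * fderiv ℝ f x e := by
      simp_rw [mul_add]; exact integral_add ivQ ivd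
    rw [h1, h2, hdis]
    change -∫ x, v x * fderiv ℝ f x e = _
    ring
  have hrestrict : ∀ g : Euc n → ℝ, (∀ x, x ∉ K → g x = 0) →
      ∫⁻ x, ‖g x‖ₑ = ∫⁻ x in K, ‖g x‖ₑ := by
    intro g hg
    rw [← lintegral_indicator hKc.measurableSet]
    refine lintegral_congr fun x => ?_
    by_cases hx : x ∈ K
    · simp [hx]
    · simp [hx, hg x hx]
  rw [hsplit]
  refine (enorm_add_le _ _).trans (add_le_add ((enorm_add_le _ _).trans (add_le_add ?_ ?_)) ?_)
  · refine (enorm_integral_le_lintegral_enorm _).trans_eq ?_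
    simp_rw [enorm_mul]
  · rw [enorm_neg]
    refine (enorm_integral_le_lintegral_enorm _).trans ?_
    rw [hrestrict _ fun x hx => by simp [hQ, (hfK x hx).1, (hfK x hx).2.1],
      ← lintegral_const_mul' _ _ ENNReal.ofReal_ne_top]
    refine lintegral_mono fun x => ?_
    dsimp only
    rw [enorm_mul, mul_comm]
    gcongr
    rw [Real.enorm_eq_ofReal_abs]
    exact ENNReal.ofReal_le_ofReal (hM r hr x).1
  · rw [enorm_neg]
    refine (enorm_integral_le_lintegral_enorm _).trans ?_
    rw [hrestrict _ fun x hx => by simp [hQ, (hfK x hx).1, (hfK x hx).2.1, (hfK x hx).2.2],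
      mul_right_comm, ← ENNReal.ofReal_mul hM0, ← lintegral_const_mul' _ _ ENNReal.ofReal_ne_top]
    refine lintegral_mono fun x => ?_
    dsimp only
    rw [enorm_mul, mul_comm]
    gcongr
    rw [Real.enorm_eq_ofReal_abs]
    exact ENNReal.ofReal_le_ofReal (hM r hr x).2

/-! ### The liminf inequality in one direction. -/

/-- Hölder's inequality for the difference quotients, with a weight. -/
theorem lintegral_lintegral_enorm_mul_le {X : Type*} [MeasurableSpace X] {μ : Measure X}
    [SFinite μ] {p q : ℝ} (hpq : p.HolderConjugate q) (ρ : Measure ℝ) [SFinite ρ]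
    {B : X × ℝ → ℝ≥0∞} (hB : Measurable B) (hB0 : ∀ z, B z ≠ 0) (hBt : ∀ z, B z ≠ ∞)
    {D : X → ℝ → ℝ} (hD : Measurable (Function.uncurry D)) {φ : X → ℝ} (hφ : Measurable φ) :
    ∫⁻ r, ∫⁻ x, ‖D x r‖ₑ * ‖φ x‖ₑ ∂μ ∂ρ ≤
      (∫⁻ r, ∫⁻ x, B (x, r) * ‖D x r‖ₑ ^ p ∂μ ∂ρ) ^ (1 / p) *
        (∫⁻ x, (∫⁻ r, B (x, r) ^ (1 - q) ∂ρ) * ‖φ x‖ₑ ^ q ∂μ) ^ (1 / q) := by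
  have hp0 := hpq.pos
  have hq0 := hpq.symm.pos
  have hB' : Measurable fun z : ℝ × X => B (z.2, z.1) := hB.comp measurable_swap
  have hD' : Measurable fun z : ℝ × X => ‖D z.2 z.1‖ₑ :=
    (hD.comp (measurable_swap (α := ℝ) (β := X))).enorm
  have hφ' : Measurable fun z : ℝ × X => ‖φ z.2‖ₑ := (hφ.comp measurable_snd).enorm
  -- Hölder on the product space after inserting `1 = B^{1/p} B^{-1/p}`; the dual weight is
  -- `B^{-q/p} = B^{1-q}`.
  have h1 := ENNReal.lintegral_mul_le_Lp_mul_Lq (ρ.prod μ) hpq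
    (f := fun z : ℝ × X => B (z.2, z.1) ^ (1 / p) * ‖D z.2 z.1‖ₑ)
    (g := fun z : ℝ × X => B (z.2, z.1) ^ (-(1 / p)) * ‖φ z.2‖ₑ)
    ((hB'.pow_const _).mul hD').aemeasurable ((hB'.pow_const _).mul hφ').aemeasurable
  have e1 : ∀ z : ℝ × X, ((fun z : ℝ × X => B (z.2, z.1) ^ (1 / p) * ‖D z.2 z.1‖ₑ) *
      fun z : ℝ × X => B (z.2, z.1) ^ (-(1 / p)) * ‖φ z.2‖ₑ) z = ‖D z.2 z.1‖ₑ * ‖φ z.2‖ₑ := by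
    intro z
    simp only [Pi.mul_apply]
    rw [mul_mul_mul_comm, ← ENNReal.rpow_add _ _ (hB0 _) (hBt _), add_neg_cancel,
      ENNReal.rpow_zero, one_mul]
  have e2 : ∀ z : ℝ × X, (B (z.2, z.1) ^ (1 / p) * ‖D z.2 z.1‖ₑ) ^ p =
      B (z.2, z.1) * ‖D z.2 z.1‖ₑ ^ p := by
    intro z
    rw [ENNReal.mul_rpow_of_nonneg _ _ hp0.le, ← ENNReal.rpow_mul, one_div_mul_cancel hp0.ne',
      ENNReal.rpow_one]
  have e3 : ∀ z : ℝ × X, (B (z.2, z.1) ^ (-(1 / p)) * ‖φ z.2‖ₑ) ^ q =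
      B (z.2, z.1) ^ (1 - q) * ‖φ z.2‖ₑ ^ q := by
    intro z
    rw [ENNReal.mul_rpow_of_nonneg _ _ hq0.le, ← ENNReal.rpow_mul]
    congr 2
    have := hpq.symm.sub_one_mul_conj
    field_simp
    linarith [hpq.mul_eq_add]
  simp_rw [e1, e2, e3] at h1
  have m1 : Measurable fun z : ℝ × X => ‖D z.2 z.1‖ₑ * ‖φ z.2‖ₑ := hD'.mul hφ'
  have m2 : Measurable fun z : ℝ × X => B (z.2, z.1) * ‖D z.2 z.1‖ₑ ^ p :=
    hB'.mul (hD'.pow_const _)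
  have m3 : Measurable fun z : ℝ × X => B (z.2, z.1) ^ (1 - q) * ‖φ z.2‖ₑ ^ q :=
    (hB'.pow_const _).mul (hφ'.pow_const _)
  rw [lintegral_prod _ m1.aemeasurable, lintegral_prod _ m2.aemeasurable,
    lintegral_prod _ m3.aemeasurable] at h1
  refine h1.trans_eq ?_
  congr 2
  rw [lintegral_lintegral_swap m3.aemeasurable]
  refine lintegral_congr fun x => ?_
  have m4 : Measurable fun r => B (x, r) ^ (1 - q) :=
    (hB.comp measurable_prodMk_left).pow_const _
  exact lintegral_mul_const (‖φ x‖ₑ ^ q) m4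

/-- The `Γ`-liminf inequality in a fixed direction `e`. -/
theorem exists_directional_derivative_liminf_le {n : ℕ} {p q : ℝ} (hpq : p.HolderConjugate q)
    (e : Euc n) (ρ : ℕ → Measure ℝ) [∀ k, IsProbabilityMeasure (ρ k)]
    (hsupp : ∀ k, ∀ᵐ r ∂ρ k, r ∈ Ioo (0 : ℝ) 1)
    (hρ : Tendsto (fun k => ∫⁻ r, ENNReal.ofReal r ∂ρ k) atTop (𝓝 0))
    {B : Euc n × ℝ → ℝ≥0∞} (hB : Measurable B) {lo hi : ℝ≥0∞} (hlo : lo ≠ 0) (hhi : hi ≠ ∞)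
    (hBlo : ∀ z, lo ≤ B z) (hBhi : ∀ z, B z ≤ hi) {w : Euc n → ℝ≥0∞} (hw : Measurable w)
    (hc : ∀ᵐ x, Tendsto (fun k => ∫⁻ r, B (x, r) ^ (1 - q) ∂ρ k) atTop (𝓝 (w x)))
    {u : ℕ → Euc n → ℝ} (hu : ∀ k, Measurable (u k)) (hui : ∀ k, LocallyIntegrable (u k))
    {v : Euc n → ℝ} (hv : LocallyIntegrable v)
    (huv : ∀ K : Set (Euc n), IsCompact K →
      Tendsto (fun k => ∫⁻ x in K, ‖u k x - v x‖ₑ) atTop (𝓝 0))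
    (hE : liminf (fun k => ∫⁻ r, ∫⁻ x, B (x, r) * ‖(u k x - u k (x - r • e)) / r‖ₑ ^ p ∂volume ∂ρ k)
      atTop ≠ ∞) :
    ∃ g : Euc n → ℝ, Measurable g ∧ MemLp g (ENNReal.ofReal p) ∧
      (∀ φ : testFunctions n, distribDeriv hv e φ = ∫ x, g x * (φ : Euc n → ℝ) x) ∧
      ∫⁻ x, w x ^ (1 - p) * ‖g x‖ₑ ^ p ≤
        liminf (fun k => ∫⁻ r, ∫⁻ x, B (x, r) * ‖(u k x - u k (x - r • e)) / r‖ₑ ^ p ∂volume ∂ρ k)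
          atTop := by
  have hp0 := hpq.pos
  have hq0 := hpq.symm.pos
  have hq1 := hpq.symm.lt
  have hlo' : lo ≠ ∞ := ne_top_of_le_ne_top hhi ((hBlo (0, 0)).trans (hBhi (0, 0)))
  have hhi' : hi ≠ 0 := fun h => hlo (le_zero_iff.1 (h ▸ (hBlo (0, 0)).trans (hBhi (0, 0))))
  have hB0 : ∀ z, B z ≠ 0 := fun z h0 => hlo (by simpa [h0] using hBlo z)
  have hBt : ∀ z, B z ≠ ∞ := fun z h0 => hhi (by simpa [h0] using hBhi z)
  set E : ℕ → ℝ≥0∞ := fun k =>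
    ∫⁻ r, ∫⁻ x, B (x, r) * ‖(u k x - u k (x - r • e)) / r‖ₑ ^ p ∂volume ∂ρ k with hEdef
  set c : ℕ → Euc n → ℝ≥0∞ := fun k x => ∫⁻ r, B (x, r) ^ (1 - q) ∂ρ k with hcdef
  have hcm : ∀ k, Measurable (c k) := fun k => (hB.pow_const (1 - q)).lintegral_prod_right'
  have hanti : ∀ a b : ℝ≥0∞, a ≤ b → b ^ (1 - q) ≤ a ^ (1 - q) := by
    intro a b hab
    rw [show 1 - q = -(q - 1) by ring, ENNReal.rpow_neg, ENNReal.rpow_neg]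
    gcongr
  have hclo : ∀ k x, hi ^ (1 - q) ≤ c k x := by
    intro k x
    calc hi ^ (1 - q) = ∫⁻ _, hi ^ (1 - q) ∂ρ k := by simp
      _ ≤ _ := lintegral_mono fun r => hanti _ _ (hBhi _)
  have hchi : ∀ k x, c k x ≤ lo ^ (1 - q) := by
    intro k x
    calc c k x ≤ ∫⁻ _, lo ^ (1 - q) ∂ρ k := lintegral_mono fun r => hanti _ _ (hBlo _)
      _ = _ := by simp
  have hLt : lo ^ (1 - q) ≠ ∞ := ENNReal.rpow_ne_top_of_ne_zero hlo hlo'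
  have hHt : hi ^ (1 - q) ≠ ∞ := ENNReal.rpow_ne_top_of_ne_zero hhi' hhi
  have hH0 : hi ^ (1 - q) ≠ 0 := by
    simp [ENNReal.rpow_eq_zero_iff, hhi', hhi]
  -- clamp `w`
  set w' : Euc n → ℝ≥0∞ := fun x => max (hi ^ (1 - q)) (min (w x) (lo ^ (1 - q))) with hw'
  have hw'm : Measurable w' := measurable_const.max (hw.min measurable_const)
  have hww' : ∀ᵐ x, w x = w' x := by
    filter_upwards [hc] with x hx
    have h1 := ge_of_tendsto' hx fun k => hclo k x
    have h2 := le_of_tendsto' hx fun k => hchi k x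
    simp only [hw']
    rw [min_eq_left h2, max_eq_right h1]
  have hLH : hi ^ (1 - q) ≤ lo ^ (1 - q) := (hclo 0 0).trans (hchi 0 0)
  set ℓ := liminf E atTop with hℓ
  have hbound : ∀ φ : testFunctions n, ‖distribDeriv hv e φ‖ₑ ≤
      ℓ ^ (1 / p) * (∫⁻ x, w' x * ‖(φ : Euc n → ℝ) x‖ₑ ^ q) ^ (1 / q) := by
    intro φ
    obtain ⟨M, K, hM, hK, hMK⟩ := enorm_distribDeriv_le hv e φ
    have hφm : Measurable (φ : Euc n → ℝ) := φ.2.1.continuous.measurable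
    have hφq : ∫⁻ x, ‖(φ : Euc n → ℝ) x‖ₑ ^ q ≠ ∞ := by
      have h1 := (testFunctions.memLp φ.2 (ENNReal.ofReal q) volume).2
      rw [enorm_rpow_toReal_eLpNorm _ hq0] at h1
      intro h2
      rw [h2, ENNReal.top_rpow_of_pos (by positivity)] at h1
      exact lt_irrefl _ h1
    set A : ℕ → ℝ≥0∞ := fun k => ∫⁻ x, c k x * ‖(φ : Euc n → ℝ) x‖ₑ ^ q with hA
    set err : ℕ → ℝ≥0∞ := fun k => M * (∫⁻ x in K, ‖u k x - v x‖ₑ) +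
      M * (∫⁻ x in K, ‖v x‖ₑ) * ∫⁻ r, ENNReal.ofReal r ∂ρ k with herr
    have hstep : ∀ k, ‖distribDeriv hv e φ‖ₑ ≤ E k ^ (1 / p) * A k ^ (1 / q) + err k := by
      intro k
      have hDm : Measurable (Function.uncurry fun (x : Euc n) (r : ℝ) =>
          (u k x - u k (x - r • e)) / r) := by
        refine Measurable.div (((hu k).comp measurable_fst).sub ((hu k).comp ?_)) measurable_snd
        exact measurable_fst.sub (measurable_snd.smul_const e)
      have h1 := lintegral_lintegral_enorm_mul_le (μ := (volume : Measure (Euc n))) hpq (ρ k) hB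
        hB0 hBt hDm hφm
      -- The left side does not depend on `r`, so it equals its average over the probability measure
      -- `ρ k`.
      calc ‖distribDeriv hv e φ‖ₑ = ∫⁻ _, ‖distribDeriv hv e φ‖ₑ ∂ρ k := by simp
        _ ≤ ∫⁻ r, ((∫⁻ x, ‖(u k x - u k (x - r • e)) / r‖ₑ * ‖(φ : Euc n → ℝ) x‖ₑ) +
            (M * (∫⁻ x in K, ‖u k x - v x‖ₑ) + M * (∫⁻ x in K, ‖v x‖ₑ) * ENNReal.ofReal r))
              ∂ρ k := by
          refine lintegral_mono_ae ?_
          filter_upwards [hsupp k] with r hr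
          rw [← add_assoc]
          exact hMK (u k) (hui k) r hr
        _ = (∫⁻ r, ∫⁻ x, ‖(u k x - u k (x - r • e)) / r‖ₑ * ‖(φ : Euc n → ℝ) x‖ₑ ∂volume ∂ρ k) +
            err k := by
          rw [lintegral_add_right _ (by fun_prop), lintegral_add_right _ (by fun_prop),
            lintegral_const_mul (M * ∫⁻ x in K, ‖v x‖ₑ) ENNReal.measurable_ofReal]
          simp [herr]
        _ ≤ _ := by gcongr
    -- Pointwise convergence of the averaged weights suffices here, since they are bounded by
    -- `lo^{1-q}`.
    have hAlim : Tendsto A atTop (𝓝 (∫⁻ x, w' x * ‖(φ : Euc n → ℝ) x‖ₑ ^ q)) := by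
      refine tendsto_lintegral_of_dominated_convergence
        (fun x => lo ^ (1 - q) * ‖(φ : Euc n → ℝ) x‖ₑ ^ q)
        (fun k => (hcm k).mul (hφm.enorm.pow_const _)) (fun k => Eventually.of_forall fun x => ?_)
        ?_ ?_
      · dsimp only
        gcongr
        exact hchi k x
      · rw [lintegral_const_mul' _ _ hLt]
        exact ENNReal.mul_ne_top hLt hφq
      · filter_upwards [hc, hww'] with x hx hx'
        rw [← hx']
        exact ENNReal.Tendsto.mul_const hx
          (Or.inr (ENNReal.rpow_ne_top_of_nonneg hq0.le enorm_ne_top))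
    have hA'fin : (∫⁻ x, w' x * ‖(φ : Euc n → ℝ) x‖ₑ ^ q) ≠ ∞ := by
      refine ne_top_of_le_ne_top (ENNReal.mul_ne_top hLt hφq) ?_
      rw [← lintegral_const_mul' _ _ hLt]
      gcongr with x
      exact max_le hLH (min_le_right _ _)
    have herrlim : Tendsto err atTop (𝓝 0) := by
      have hvK : ∫⁻ x in K, ‖v x‖ₑ ≠ ∞ := (hv.integrableOn_isCompact hK).2.ne
      have h1 := ENNReal.Tendsto.const_mul (huv K hK) (Or.inr hM)
      have h2 := ENNReal.Tendsto.const_mul hρ (Or.inr (ENNReal.mul_ne_top hM hvK))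
      simpa [herr] using h1.add h2
    -- The energies need not converge: for `b > ℓ` one has `E k < b` for infinitely many `k`, which
    -- is enough to pass to the limit in the convergent right side. Then `b ↓ ℓ`, where `ℓ < ∞`
    -- ensures that such `b` exist.
    have hgt : ∀ b, ℓ < b → b ≠ ∞ → ‖distribDeriv hv e φ‖ₑ ≤
        b ^ (1 / p) * (∫⁻ x, w' x * ‖(φ : Euc n → ℝ) x‖ₑ ^ q) ^ (1 / q) := by
      intro b hb hbt
      have hfreq := frequently_lt_of_liminf_lt (by isBoundedDefault) hb
      have hlim : Tendsto (fun k => b ^ (1 / p) * A k ^ (1 / q) + err k) atTop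
          (𝓝 (b ^ (1 / p) * (∫⁻ x, w' x * ‖(φ : Euc n → ℝ) x‖ₑ ^ q) ^ (1 / q) + 0)) := by
        refine Tendsto.add (ENNReal.Tendsto.const_mul
          ((ENNReal.continuous_rpow_const.tendsto _).comp hAlim) (Or.inr ?_)) herrlim
        exact ENNReal.rpow_ne_top_of_nonneg (by positivity) hbt
      rw [add_zero] at hlim
      refine ge_of_tendsto_of_frequently hlim (hfreq.mono fun k hk => (hstep k).trans ?_)
      gcongr
    have hcont : Tendsto (fun b : ℝ≥0∞ =>
        b ^ (1 / p) * (∫⁻ x, w' x * ‖(φ : Euc n → ℝ) x‖ₑ ^ q) ^ (1 / q)) (𝓝[>] ℓ)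
        (𝓝 (ℓ ^ (1 / p) * (∫⁻ x, w' x * ‖(φ : Euc n → ℝ) x‖ₑ ^ q) ^ (1 / q))) := by
      refine ENNReal.Tendsto.mul_const ((ENNReal.continuous_rpow_const.tendsto _).mono_left
        nhdsWithin_le_nhds) (Or.inr (ENNReal.rpow_ne_top_of_nonneg (by positivity) hA'fin))
    have : (𝓝[>] ℓ).NeBot := nhdsGT_neBot_of_exists_gt ⟨∞, hE.lt_top⟩
    refine ge_of_tendsto hcont ?_
    have hlt : ∀ᶠ b in 𝓝[>] ℓ, b < ∞ :=
      nhdsWithin_le_nhds (isOpen_Iio.mem_nhds hE.lt_top)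
    filter_upwards [self_mem_nhdsWithin, hlt] with b hb hbt
    exact hgt b hb hbt.ne
  obtain ⟨g, hgm, hgL, hg, hgw⟩ := exists_memLp_forall_test_eq_integral_and_weighted_le hpq
    (distribDeriv hv e) hw'm hH0 hHt hLt (fun x => le_max_left _ _)
    (fun x => max_le hLH (min_le_right _ _))
    (ENNReal.rpow_ne_top_of_nonneg (by positivity) hE) hbound
  refine ⟨g, hgm, hgL, hg, ?_⟩
  rw [← ENNReal.rpow_mul, one_div_mul_cancel hp0.ne', ENNReal.rpow_one] at hgw
  refine le_trans (le_of_eq ?_) hgw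
  refine lintegral_congr_ae ?_
  filter_upwards [hww'] with x hx
  rw [hx]

/-! ### Translation energies on dyadic annuli. -/

/-- The translation energy `h ↦ ∫ |u(x) - u(x-h)|^p dx`. -/
def translationEnergy {n : ℕ} (p : ℝ) (u : Euc n → ℝ) (h : Euc n) : ℝ≥0∞ :=
  ∫⁻ x, ‖u x - u (x - h)‖ₑ ^ p

theorem measurable_enorm_sub_translate {n : ℕ} (p : ℝ) {u : Euc n → ℝ} (hu : Measurable u) :
    Measurable fun z : Euc n × Euc n => ‖u z.1 - u (z.1 - z.2)‖ₑ ^ p :=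
  ((hu.comp measurable_fst).sub (hu.comp (measurable_fst.sub measurable_snd))).enorm.pow_const _

theorem measurable_translationEnergy {n : ℕ} (p : ℝ) {u : Euc n → ℝ} (hu : Measurable u) :
    Measurable (translationEnergy p u) :=
  (measurable_enorm_sub_translate p hu).lintegral_prod_left'

/-- A shift by `2h` is two shifts by `h`; convexity of `t ↦ t^p` gives the factor `2^{p-1}`, and
translation invariance makes the two contributions equal. -/
theorem translationEnergy_two_smul_le {n : ℕ} {p : ℝ} (hp : 1 ≤ p) {u : Euc n → ℝ}
    (hu : Measurable u) (h : Euc n) :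
    translationEnergy p u ((2 : ℝ) • h) ≤ 2 ^ p * translationEnergy p u h := by
  have hm : Measurable fun x => ‖u x - u (x - h)‖ₑ ^ p :=
    (hu.sub (hu.comp (measurable_id.sub_const h))).enorm.pow_const _
  have htr : ∫⁻ x, ‖u (x - h) - u (x - h - h)‖ₑ ^ p = translationEnergy p u h :=
    lintegral_sub_right_eq_self (fun x => ‖u x - u (x - h)‖ₑ ^ p) h
  calc translationEnergy p u ((2 : ℝ) • h)
      ≤ ∫⁻ x, 2 ^ (p - 1) * (‖u x - u (x - h)‖ₑ ^ p + ‖u (x - h) - u (x - h - h)‖ₑ ^ p) := by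
        refine lintegral_mono fun x => ?_
        refine le_trans ?_ (ENNReal.rpow_add_le_mul_rpow_add_rpow _ _ hp)
        refine ENNReal.rpow_le_rpow ?_ (by linarith)
        have : u x - u (x - (2 : ℝ) • h) = (u x - u (x - h)) + (u (x - h) - u (x - h - h)) := by
          rw [two_smul, ← sub_sub]; ring
        rw [this]
        exact enorm_add_le _ _
    _ = 2 ^ (p - 1) * (translationEnergy p u h + translationEnergy p u h) := by
        rw [lintegral_const_mul' _ _ (ENNReal.rpow_ne_top_of_nonneg (by linarith)
          ENNReal.ofNat_ne_top), lintegral_add_left hm, htr]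
        rfl
    _ = 2 ^ p * translationEnergy p u h := by
        rw [← two_mul, ← mul_assoc]
        congr 1
        nth_rewrite 2 [← ENNReal.rpow_one 2]
        rw [← ENNReal.rpow_add _ _ two_ne_zero ENNReal.ofNat_ne_top]
        simp

theorem gagliardoPow_eq_lintegral {n : ℕ} {s p : ℝ} (hp : 0 ≤ p) {u : Euc n → ℝ}
    (hu : Measurable u) : gagliardoPow s p u =
      ∫⁻ h, translationEnergy p u h * ENNReal.ofReal ((‖h‖ ^ ((n : ℝ) + s * p))⁻¹) := by
  have hk : Measurable fun h : Euc n => ENNReal.ofReal ((‖h‖ ^ ((n : ℝ) + s * p))⁻¹) :=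
    ((measurable_norm.pow_const _).inv).ennreal_ofReal
  have h1 : gagliardoPow s p u = ∫⁻ z : Euc n × Euc n, ‖u z.1 - u (z.1 - z.2)‖ₑ ^ p *
      ENNReal.ofReal ((‖z.2‖ ^ ((n : ℝ) + s * p))⁻¹) := by
    refine lintegral_congr fun z => ?_
    rw [div_eq_mul_inv, ENNReal.ofReal_mul (by positivity), Real.enorm_eq_ofReal_abs,
      ENNReal.ofReal_rpow_of_nonneg (abs_nonneg _) hp]
  have hm : Measurable fun z : Euc n × Euc n => ‖u z.1 - u (z.1 - z.2)‖ₑ ^ p *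
      ENNReal.ofReal ((‖z.2‖ ^ ((n : ℝ) + s * p))⁻¹) :=
    (measurable_enorm_sub_translate p hu).mul (hk.comp measurable_snd)
  rw [h1, Measure.volume_eq_prod, lintegral_prod_symm _ hm.aemeasurable]
  refine lintegral_congr fun h => ?_
  dsimp only
  have hm' : Measurable fun x => ‖u x - u (x - h)‖ₑ ^ p :=
    (hu.sub (hu.comp (measurable_id.sub_const h))).enorm.pow_const _
  rw [lintegral_mul_const _ hm']
  rfl

/-- The dyadic annulus `{t/2 ≤ |h| < t}`. -/
def annulus (n : ℕ) (t : ℝ) : Set (Euc n) := {h | ‖h‖ ∈ Ico (t / 2) t}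

theorem measurableSet_annulus (n : ℕ) (t : ℝ) : MeasurableSet (annulus n t) :=
  measurable_norm measurableSet_Ico

/-- The substitution `h ↦ 2h` contributes `2^{-n}` from the volume, `2^{n+sp}` from the kernel and
`2^{-p}` from the doubling inequality, in total `2^{-p(1-s)}`. This ratio tends to `1` as `s → 1`,
so the energy is spread almost evenly over the smaller scales. -/
theorem setLIntegral_annulus_le_half {n : ℕ} {s p : ℝ} (hp : 1 ≤ p) {u : Euc n → ℝ}
    (hu : Measurable u) (t : ℝ) :
    ENNReal.ofReal (2 ^ (-(p * (1 - s)))) * ∫⁻ h in annulus n t,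
      translationEnergy p u h * ENNReal.ofReal ((‖h‖ ^ ((n : ℝ) + s * p))⁻¹) ≤
    ∫⁻ h in annulus n (t / 2),
      translationEnergy p u h * ENNReal.ofReal ((‖h‖ ^ ((n : ℝ) + s * p))⁻¹) := by
  set F := translationEnergy p u
  set k : Euc n → ℝ≥0∞ := fun h => ENNReal.ofReal ((‖h‖ ^ ((n : ℝ) + s * p))⁻¹) with hk
  have hkm : Measurable k := ((measurable_norm.pow_const _).inv).ennreal_ofReal
  have hGm : Measurable ((annulus n t).indicator fun h => F h * k h) :=
    ((measurable_translationEnergy p hu).mul hkm).indicator (measurableSet_annulus n t)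
  have hscale : ∫⁻ h, (annulus n t).indicator (fun h => F h * k h) ((2 : ℝ) • h) =
      ENNReal.ofReal ((2 ^ n)⁻¹) * ∫⁻ h, (annulus n t).indicator (fun h => F h * k h) h := by
    rw [← lintegral_map hGm (measurable_const_smul (2 : ℝ)),
      Measure.map_addHaar_smul _ (two_ne_zero), lintegral_smul_measure, finrank_euclideanSpace_fin,
      abs_of_pos (by positivity), smul_eq_mul]
  rw [← lintegral_indicator (measurableSet_annulus n t),
    ← lintegral_indicator (measurableSet_annulus n (t / 2))]
  have h2 : ENNReal.ofReal (2 ^ (-(p * (1 - s)))) =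
      (ENNReal.ofReal (2 ^ ((n : ℝ) + s * p)) * (2 ^ p)⁻¹) * ENNReal.ofReal ((2 ^ n)⁻¹) := by
    rw [show (2 : ℝ≥0∞) = ENNReal.ofReal 2 by simp, ENNReal.ofReal_rpow_of_pos two_pos,
      ← ENNReal.ofReal_inv_of_pos (by positivity), ← ENNReal.ofReal_mul (by positivity),
      ← ENNReal.ofReal_mul (by positivity)]
    congr 1
    rw [← Real.rpow_natCast, ← Real.rpow_neg (by norm_num), ← Real.rpow_neg (by norm_num),
      ← Real.rpow_add two_pos, ← Real.rpow_add two_pos]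
    congr 1
    ring
  rw [h2, mul_assoc, ← hscale, ← lintegral_const_mul' _ _ (ENNReal.mul_ne_top ENNReal.ofReal_ne_top
    (ENNReal.inv_ne_top.2 (by positivity)))]
  refine lintegral_mono fun h => ?_
  have hmem : (2 : ℝ) • h ∈ annulus n t ↔ h ∈ annulus n (t / 2) := by
    simp only [annulus, mem_ofPred_eq, norm_smul, Real.norm_eq_abs, abs_two, mem_Ico]
    constructor <;> rintro ⟨h1, h2⟩ <;> constructor <;> linarith
  by_cases hh : h ∈ annulus n (t / 2)
  · rw [indicator_of_mem (hmem.2 hh), indicator_of_mem hh]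
    have hk2 : ENNReal.ofReal (2 ^ ((n : ℝ) + s * p)) * k ((2 : ℝ) • h) = k h := by
      simp only [hk]
      rw [← ENNReal.ofReal_mul (by positivity), norm_smul, Real.norm_eq_abs, abs_two,
        Real.mul_rpow (by norm_num) (norm_nonneg _), mul_inv, mul_inv_cancel_left₀ (by positivity)]
    calc _ = ((2 ^ p)⁻¹ * F ((2 : ℝ) • h)) *
          (ENNReal.ofReal (2 ^ ((n : ℝ) + s * p)) * k ((2 : ℝ) • h)) := by ring
      _ ≤ F h * k h := by
        rw [hk2]
        gcongr
        have hp0 : (2 : ℝ≥0∞) ^ p ≠ 0 := by positivity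
        have hpt : (2 : ℝ≥0∞) ^ p ≠ ∞ :=
          ENNReal.rpow_ne_top_of_nonneg (by linarith) ENNReal.ofNat_ne_top
        rw [mul_comm, ← div_eq_mul_inv, ENNReal.div_le_iff hp0 hpt, mul_comm]
        exact translationEnergy_two_smul_le hp hu h
  · rw [indicator_of_notMem (fun h' => hh (hmem.1 h')), mul_zero]
    exact zero_le

/-- The mean translation energy over a dyadic annulus is controlled by the Gagliardo energy, with
the factor `1 - s`. -/
theorem setLIntegral_annulus_translationEnergy_le {n : ℕ} {s p : ℝ} (hp : 1 ≤ p) (hs0 : 0 ≤ s)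
    (hs1 : s < 1) {u : Euc n → ℝ} (hu : Measurable u) {t : ℝ} (ht : 0 < t) :
    ∫⁻ h in annulus n t, translationEnergy p u h ≤
      ENNReal.ofReal (t ^ ((n : ℝ) + s * p) * p) *
        (ENNReal.ofReal (1 - s) * gagliardoPow s p u) := by
  set F := translationEnergy p u with hF
  set k : Euc n → ℝ≥0∞ := fun h => ENNReal.ofReal ((‖h‖ ^ ((n : ℝ) + s * p))⁻¹) with hk
  have hkm : Measurable k := ((measurable_norm.pow_const _).inv).ennreal_ofReal
  have hFm : Measurable F := measurable_translationEnergy p hu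
  set I : ℝ → ℝ≥0∞ := fun t => ∫⁻ h in annulus n t, F h * k h with hI
  set θ := ENNReal.ofReal (2 ^ (-(p * (1 - s)))) with hθ
  have hiter : ∀ j : ℕ, θ ^ j * I t ≤ I (t / 2 ^ j) := by
    intro j
    induction j with
    | zero => simp
    | succ j ih =>
      calc θ ^ (j + 1) * I t = θ * (θ ^ j * I t) := by ring
        _ ≤ θ * I (t / 2 ^ j) := by gcongr
        _ ≤ I (t / 2 ^ j / 2) := setLIntegral_annulus_le_half hp hu _
        _ = I (t / 2 ^ (j + 1)) := by rw [div_div, pow_succ]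
  have hdisj : Pairwise (Function.onFun Disjoint fun j : ℕ => annulus n (t / 2 ^ j)) := by
    have hlt : ∀ i j : ℕ, i < j → Disjoint (annulus n (t / 2 ^ i)) (annulus n (t / 2 ^ j)) := by
      intro i j hij
      rw [Set.disjoint_left]
      intro h hi hj
      have h1 : t / 2 ^ i / 2 ≤ ‖h‖ := hi.1
      have h2 : ‖h‖ < t / 2 ^ j := hj.2
      have h3 : t / 2 ^ j ≤ t / 2 ^ (i + 1) := by
        gcongr
        · norm_num
        · exact hij
      rw [pow_succ, ← div_div] at h3
      linarith
    intro i j hij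
    rcases lt_or_gt_of_ne hij with h | h
    · exact hlt i j h
    · exact (hlt j i h).symm
  have hsum : ∑' j : ℕ, I (t / 2 ^ j) ≤ gagliardoPow s p u := by
    rw [gagliardoPow_eq_lintegral (by linarith) hu, ← lintegral_iUnion
      (fun j => measurableSet_annulus n _) hdisj]
    exact setLIntegral_le_lintegral _ _
  -- Source of the factor `1 - s`: with `a = p(1-s)`, `2^{-a} ≥ 1 - a log 2 ≥ 1 - a`.
  have hθle : 1 - θ ≤ ENNReal.ofReal (p * (1 - s)) := by
    rw [tsub_le_iff_right, hθ, ← ENNReal.ofReal_add (by nlinarith) (by positivity),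
      ← ENNReal.ofReal_one]
    refine ENNReal.ofReal_le_ofReal ?_
    set a := p * (1 - s)
    have ha : 0 ≤ a := by positivity
    have h1 : (2 : ℝ) ^ (-a) = Real.exp (Real.log 2 * (-a)) := Real.rpow_def_of_pos two_pos _
    have h2 := Real.add_one_le_exp (Real.log 2 * (-a))
    have h3 : Real.log 2 ≤ 1 := by
      have := Real.log_two_lt_d9; linarith
    rw [h1]
    nlinarith
  have hIle : I t ≤ ENNReal.ofReal p * (ENNReal.ofReal (1 - s) * gagliardoPow s p u) := by
    -- The annuli of radii `t/2^j` are disjoint and carry at least `θ^j I t` each; the geometric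
    -- series is summed.
    have h1 : (1 - θ)⁻¹ * I t ≤ gagliardoPow s p u := by
      rw [← ENNReal.tsum_geometric, ← ENNReal.tsum_mul_right]
      exact (ENNReal.tsum_le_tsum hiter).trans hsum
    have hθ1 : θ < 1 := by
      rw [hθ, ← ENNReal.ofReal_one]
      refine (ENNReal.ofReal_lt_ofReal_iff one_pos).2 ?_
      refine Real.rpow_lt_one_of_one_lt_of_neg one_lt_two ?_
      nlinarith
    have h0 : 1 - θ ≠ 0 := (tsub_pos_of_lt hθ1).ne'
    have h2 : I t ≤ (1 - θ) * gagliardoPow s p u := by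
      have : I t = (1 - θ) * ((1 - θ)⁻¹ * I t) := by
        rw [← mul_assoc, ENNReal.mul_inv_cancel h0 (ENNReal.sub_ne_top ENNReal.one_ne_top), one_mul]
      rw [this]
      gcongr
    refine h2.trans ?_
    rw [← mul_assoc, ← ENNReal.ofReal_mul (by linarith)]
    gcongr
  -- On the annulus `‖h‖ < t`, so the kernel is at least `t^{-(n+sp)}` and can be removed.
  have hFI : ∫⁻ h in annulus n t, F h ≤ ENNReal.ofReal (t ^ ((n : ℝ) + s * p)) * I t := by
    simp only [hI]
    rw [← lintegral_const_mul' _ _ ENNReal.ofReal_ne_top]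
    refine setLIntegral_mono' (measurableSet_annulus n t) fun h hh => ?_
    have hpos : 0 < ‖h‖ := lt_of_lt_of_le (by positivity) hh.1
    have h1 : 1 ≤ ENNReal.ofReal (t ^ ((n : ℝ) + s * p)) * k h := by
      simp only [hk]
      rw [← ENNReal.ofReal_mul (by positivity), ← ENNReal.ofReal_one]
      refine ENNReal.ofReal_le_ofReal ?_
      rw [← div_eq_mul_inv, one_le_div (by positivity)]
      exact Real.rpow_le_rpow hpos.le hh.2.le (by positivity)
    calc F h = F h * 1 := (mul_one _).symm
      _ ≤ F h * (ENNReal.ofReal (t ^ ((n : ℝ) + s * p)) * k h) := by gcongr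
      _ = _ := by ring
  refine hFI.trans ?_
  rw [ENNReal.ofReal_mul (by positivity), mul_assoc]
  gcongr

/-! ### Mollification at scale `t`. -/

/-- Smooth kernels of unit mass supported in the dyadic annuli. -/
theorem exists_annulus_mollifier {n : ℕ} (hn : 1 ≤ n) : ∃ C : ℝ, 0 ≤ C ∧ ∀ t : ℝ, 0 < t →
    ∃ κ : Euc n → ℝ, κ ∈ testFunctions n ∧ (∀ h, 0 ≤ κ h) ∧ ∫ h, κ h = 1 ∧
      (∀ h, h ∉ annulus n t → κ h = 0) ∧ ∀ h, κ h ≤ C * (t ^ n)⁻¹ := by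
  have : Nontrivial (Euc n) := by
    have : Nonempty (Fin n) := ⟨⟨0, hn⟩⟩
    infer_instance
  refine ⟨16 ^ n * (volume.real (Metric.ball (0 : Euc n) 1))⁻¹, by positivity, fun t ht => ?_⟩
  -- A ball of radius `t/8` about a point of norm `3t/4` stays inside the annulus. The inner radius
  -- `t/16` of the bump bounds its normalized height and produces the constant `16^n`.
  obtain ⟨h0, hh0⟩ := exists_norm_eq (Euc n) (show 0 ≤ 3 / 4 * t by positivity)
  let b : ContDiffBump h0 := ⟨t / 16, t / 8, by positivity, by linarith⟩
  refine ⟨b.normed volume, ⟨b.contDiff_normed, b.hasCompactSupport_normed⟩,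
    b.nonneg_normed, b.integral_normed, fun h hh => ?_, fun h => ?_⟩
  · by_contra hne
    have h1 : h ∈ Function.support (b.normed volume) := hne
    rw [b.support_normed_eq, mem_ball_iff_norm] at h1
    have h1' : ‖h - h0‖ < t / 8 := h1
    have h2 := norm_sub_norm_le h0 h
    have h3 := norm_sub_norm_le h h0
    rw [norm_sub_rev] at h2
    refine hh ⟨?_, ?_⟩ <;> linarith
  · refine (b.normed_le_div_measure_closedBall_rIn volume h).trans (le_of_eq ?_)
    rw [Measure.addHaar_real_closedBall _ _ b.rIn_pos.le, finrank_euclideanSpace_fin]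
    change 1 / ((t / 16) ^ n * _) = _
    rw [div_pow, one_div, mul_inv, inv_div]
    ring

/-- The convolution of `u` with the kernel `κ`. -/
def mollify {n : ℕ} (κ u : Euc n → ℝ) (x : Euc n) : ℝ := ∫ h, κ h * u (x - h)

theorem stronglyMeasurable_mollify {n : ℕ} {κ u : Euc n → ℝ} (hκ : Measurable κ)
    (hu : Measurable u) : StronglyMeasurable (mollify κ u) := by
  have : StronglyMeasurable fun z : Euc n × Euc n => κ z.2 * u (z.1 - z.2) :=
    ((hκ.comp measurable_snd).mul
      (hu.comp (measurable_fst.sub measurable_snd))).stronglyMeasurable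
  exact this.integral_prod_right'

/-- Jensen's inequality for the probability measure `κ dh`, in the form that its `L^1` norm is at
most its `L^p` norm, followed by Tonelli. -/
theorem lintegral_enorm_sub_mollify_le {n : ℕ} {p : ℝ} (hp : 1 ≤ p) {κ u : Euc n → ℝ}
    (hκ : κ ∈ testFunctions n) (hκ0 : ∀ h, 0 ≤ κ h) (hκ1 : ∫ h, κ h = 1) (hu : Measurable u)
    (hui : LocallyIntegrable u) :
    ∫⁻ x, ‖u x - mollify κ u x‖ₑ ^ p ≤
      ∫⁻ h, ENNReal.ofReal (κ h) * translationEnergy p u h := by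
  have hp0 : 0 < p := by linarith
  have hκc := hκ.1.continuous
  have hκm := hκc.measurable
  have hκi : Integrable κ := hκc.integrable_of_hasCompactSupport hκ.2
  set d : Euc n → ℝ≥0∞ := fun h => ENNReal.ofReal (κ h) with hd
  have hdm : Measurable d := hκm.ennreal_ofReal
  set π : Measure (Euc n) := volume.withDensity d with hπ
  have hprob : IsProbabilityMeasure π := by
    refine ⟨?_⟩
    rw [hπ, withDensity_apply _ .univ, Measure.restrict_univ, hd,
      ← ofReal_integral_eq_lintegral_ofReal hκi (Eventually.of_forall hκ0), hκ1, ENNReal.ofReal_one]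
  have hpt : ∀ x, ‖u x - mollify κ u x‖ₑ ^ p ≤ ∫⁻ h, d h * ‖u x - u (x - h)‖ₑ ^ p := by
    intro x
    have hi : Integrable fun h => κ h * u (x - h) := by
      have h1 : Integrable fun y => κ (x - y) * u y := by
        refine hui.integrable_smul_left_of_hasCompactSupport
          (hκc.comp (continuous_const.sub continuous_id)) ?_
        exact hκ.2.comp_homeomorph (Homeomorph.subLeft x)
      have h2 := h1.comp_sub_left x
      simpa using h2
    have h1 : u x - mollify κ u x = ∫ h, κ h * (u x - u (x - h)) := by
      simp_rw [mul_sub]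
      rw [integral_sub (hκi.mul_const _) hi, integral_mul_const, hκ1, one_mul]
      rfl
    have hm : Measurable fun h => u x - u (x - h) :=
      measurable_const.sub (hu.comp (measurable_const.sub measurable_id))
    have h2 : ‖u x - mollify κ u x‖ₑ ≤ eLpNorm (fun h => u x - u (x - h)) 1 π := by
      rw [h1, eLpNorm_one_eq_lintegral_enorm, hπ,
        lintegral_withDensity_eq_lintegral_mul _ hdm hm.enorm]
      refine (enorm_integral_le_lintegral_enorm _).trans_eq (lintegral_congr fun h => ?_)
      rw [enorm_mul, Real.enorm_eq_ofReal (hκ0 h)]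
      rfl
    have h3 := h2.trans (eLpNorm_le_eLpNorm_of_exponent_le
      (show 1 ≤ ENNReal.ofReal p by simpa using hp) hm.aestronglyMeasurable)
    rw [enorm_rpow_toReal_eLpNorm _ hp0] at h3
    calc ‖u x - mollify κ u x‖ₑ ^ p
        ≤ ((∫⁻ h, ‖u x - u (x - h)‖ₑ ^ p ∂π) ^ (1 / p)) ^ p := by gcongr
      _ = ∫⁻ h, ‖u x - u (x - h)‖ₑ ^ p ∂π := by
        rw [← ENNReal.rpow_mul, one_div_mul_cancel hp0.ne', ENNReal.rpow_one]
      _ = _ := by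
        rw [hπ, lintegral_withDensity_eq_lintegral_mul _ hdm (hm.enorm.pow_const _)]
        rfl
  refine (lintegral_mono hpt).trans_eq ?_
  have hjm : Measurable fun z : Euc n × Euc n => d z.2 * ‖u z.1 - u (z.1 - z.2)‖ₑ ^ p :=
    (hdm.comp measurable_snd).mul (measurable_enorm_sub_translate p hu)
  rw [lintegral_lintegral_swap hjm.aemeasurable]
  refine lintegral_congr fun h => ?_
  exact lintegral_const_mul' _ _ ENNReal.ofReal_ne_top

/-- Mollification at scale `t` approximates functions of bounded fractional energy, uniformly in
`s`. -/
theorem lintegral_enorm_sub_mollify_le_gagliardo {n : ℕ} {s p : ℝ} (hp : 1 ≤ p) (hs0 : 0 ≤ s)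
    (hs1 : s < 1) {κ u : Euc n → ℝ} (hκ : κ ∈ testFunctions n) (hκ0 : ∀ h, 0 ≤ κ h)
    (hκ1 : ∫ h, κ h = 1) {t C : ℝ} (ht : 0 < t) (hC : 0 ≤ C)
    (hκs : ∀ h, h ∉ annulus n t → κ h = 0) (hκC : ∀ h, κ h ≤ C * (t ^ n)⁻¹) (hu : Measurable u)
    (hui : LocallyIntegrable u) :
    ∫⁻ x, ‖u x - mollify κ u x‖ₑ ^ p ≤
      ENNReal.ofReal (C * p * t ^ (s * p)) * (ENNReal.ofReal (1 - s) * gagliardoPow s p u) := by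
  refine (lintegral_enorm_sub_mollify_le hp hκ hκ0 hκ1 hu hui).trans ?_
  calc ∫⁻ h, ENNReal.ofReal (κ h) * translationEnergy p u h
      ≤ ∫⁻ h, (annulus n t).indicator
          (fun h => ENNReal.ofReal (C * (t ^ n)⁻¹) * translationEnergy p u h) h := by
        refine lintegral_mono fun h => ?_
        by_cases hh : h ∈ annulus n t
        · rw [indicator_of_mem hh]
          dsimp only
          gcongr
          exact hκC h
        · simp [hκs h hh]
    _ = ENNReal.ofReal (C * (t ^ n)⁻¹) * ∫⁻ h in annulus n t, translationEnergy p u h := by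
        rw [lintegral_indicator (measurableSet_annulus n t),
          lintegral_const_mul' _ _ ENNReal.ofReal_ne_top]
    _ ≤ ENNReal.ofReal (C * (t ^ n)⁻¹) * (ENNReal.ofReal (t ^ ((n : ℝ) + s * p) * p) *
        (ENNReal.ofReal (1 - s) * gagliardoPow s p u)) := by
        gcongr
        exact setLIntegral_annulus_translationEnergy_le hp hs0 hs1 hu ht
    _ = _ := by
        rw [← mul_assoc, ← ENNReal.ofReal_mul (by positivity)]
        congr 2
        rw [Real.rpow_add ht, Real.rpow_natCast]
        field_simp

/-- Mollifications of functions bounded in `L^p` are uniformly bounded and equi-Lipschitz. -/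
theorem exists_mollify_bound {n : ℕ} {p : ℝ} (hp : 1 ≤ p) {κ : Euc n → ℝ}
    (hκ : κ ∈ testFunctions n) (hκs : ∀ h, 1 ≤ ‖h‖ → κ h = 0) {M : ℝ≥0∞} (hM : M ≠ ∞) :
    ∃ C : ℝ, 0 ≤ C ∧ ∀ u : Euc n → ℝ, MemLp u (ENNReal.ofReal p) →
      eLpNorm u (ENNReal.ofReal p) volume ≤ M →
      (∀ x, |mollify κ u x| ≤ C) ∧
      ∀ x y, dist x y ≤ 1 → |mollify κ u x - mollify κ u y| ≤ C * dist x y := by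
  have hκc := hκ.1.continuous
  obtain ⟨L, hL⟩ := hκ.1.lipschitzWith_of_hasCompactSupport hκ.2 (by simp)
  obtain ⟨S, hS⟩ := hκc.bounded_above_of_compact_support hκ.2
  have hS0 : 0 ≤ S := (norm_nonneg _).trans (hS 0)
  -- Hölder bound for the `L^1` norm of `u` on any ball of radius `2`. Such a ball about `x`
  -- contains the supports of both `κ(x - ·)` and `κ(y - ·)` when `dist x y ≤ 1`.
  set R : ℝ≥0∞ := M * volume (Metric.closedBall (0 : Euc n) 2) ^
    (1 / (1 : ℝ≥0∞).toReal - 1 / (ENNReal.ofReal p).toReal) with hR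
  have hexp : 0 ≤ 1 / (1 : ℝ≥0∞).toReal - 1 / (ENNReal.ofReal p).toReal := by
    rw [ENNReal.toReal_ofReal (by linarith)]
    simp only [ENNReal.toReal_one, div_one, one_div]
    linarith [inv_le_one_of_one_le₀ hp]
  have hRt : R ≠ ∞ := ENNReal.mul_ne_top hM
    (ENNReal.rpow_ne_top_of_nonneg hexp measure_closedBall_lt_top.ne)
  refine ⟨(S + L) * R.toReal, by positivity, fun u hu huM => ?_⟩
  have hui : LocallyIntegrable u := hu.locallyIntegrable (by simpa using hp)
  have hball : ∀ x, ∫⁻ z in Metric.closedBall x 2, ‖u z‖ₑ ≤ R := by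
    intro x
    have h1 := eLpNorm_le_eLpNorm_mul_rpow_measure_univ (μ := volume.restrict (Metric.closedBall x 2))
      (show 1 ≤ ENNReal.ofReal p by simpa using hp) hu.1.restrict
    rw [eLpNorm_one_eq_lintegral_enorm, Measure.restrict_apply_univ,
      Measure.addHaar_closedBall_center] at h1
    refine h1.trans ?_
    rw [hR]
    gcongr
    exact (eLpNorm_mono_measure _ Measure.restrict_le_self).trans huM
  have hmol : ∀ x, mollify κ u x = ∫ z, κ (x - z) * u z := by
    intro x
    rw [mollify, ← integral_sub_left_eq_self _ _ x]
    simp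
  have hi : ∀ x, Integrable fun z => κ (x - z) * u z := fun x =>
    hui.integrable_smul_left_of_hasCompactSupport
      (hκc.comp (continuous_const.sub continuous_id)) (hκ.2.comp_homeomorph (Homeomorph.subLeft x))
  have hgen : ∀ (x : Euc n) (g : Euc n → ℝ) (A : ℝ), 0 ≤ A → (∀ z, |g z| ≤ A) →
      (∀ z, z ∉ Metric.closedBall x 2 → g z = 0) → |∫ z, g z * u z| ≤ A * R.toReal := by
    intro x g A hA hg hgs
    have h1 : ‖∫ z, g z * u z‖ₑ ≤ ENNReal.ofReal A * R := by
      refine (enorm_integral_le_lintegral_enorm _).trans ?_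
      calc ∫⁻ z, ‖g z * u z‖ₑ ≤ ∫⁻ z, (Metric.closedBall x 2).indicator
            (fun z => ENNReal.ofReal A * ‖u z‖ₑ) z := by
            refine lintegral_mono fun z => ?_
            by_cases hz : z ∈ Metric.closedBall x 2
            · rw [indicator_of_mem hz, enorm_mul]
              gcongr
              rw [Real.enorm_eq_ofReal_abs]
              exact ENNReal.ofReal_le_ofReal (hg z)
            · simp [hgs z hz]
        _ = ENNReal.ofReal A * ∫⁻ z in Metric.closedBall x 2, ‖u z‖ₑ := by
            rw [lintegral_indicator Metric.isClosed_closedBall.measurableSet,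
              lintegral_const_mul' _ _ ENNReal.ofReal_ne_top]
        _ ≤ _ := by gcongr; exact hball x
    rw [← ENNReal.ofReal_toReal hRt, ← ENNReal.ofReal_mul hA, Real.enorm_eq_ofReal_abs] at h1
    exact (ENNReal.ofReal_le_ofReal_iff (by positivity)).1 h1
  constructor
  · intro x
    rw [hmol]
    refine (hgen x (fun z => κ (x - z)) S hS0 (fun z => hS _) fun z hz => hκs _ ?_).trans ?_
    · rw [Metric.mem_closedBall, dist_comm, dist_eq_norm] at hz
      linarith
    · gcongr
      linarith [L.2]
  · intro x y hxy
    rw [hmol, hmol, ← integral_sub (hi x) (hi y)]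
    simp_rw [← sub_mul]
    refine (hgen x (fun z => κ (x - z) - κ (y - z)) (L * dist x y) (by positivity) (fun z => ?_)
      fun z hz => ?_).trans ?_
    · have := hL.dist_le_mul (x - z) (y - z)
      rwa [dist_sub_right, Real.dist_eq] at this
    · rw [Metric.mem_closedBall, not_le] at hz
      have h1 : 1 ≤ ‖x - z‖ := by rw [← dist_eq_norm, dist_comm]; linarith
      have h2 : 1 ≤ ‖y - z‖ := by
        rw [← dist_eq_norm, dist_comm]
        linarith [dist_triangle z y x, dist_comm x y]
      rw [hκs _ h1, hκs _ h2, sub_zero]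
    · have : 0 ≤ S * R.toReal * dist x y := by positivity
      nlinarith

/-! ### Extraction of convergent subsequences. -/

/-- A finite measure dominated by Lebesgue measure and comparable to it on compact sets. -/
theorem exists_isFiniteMeasure_le_volume (n : ℕ) : ∃ ν : Measure (Euc n), IsFiniteMeasure ν ∧
    ν ≤ volume ∧ ∀ K, IsCompact K → ∃ c : ℝ≥0∞, c ≠ ∞ ∧ volume.restrict K ≤ c • ν := by
  set η : Euc n → ℝ := fun x => (1 + ‖x‖ ^ 2) ^ (-((n : ℝ) + 1) / 2) with hη
  have hη0 : ∀ x, 0 < η x := fun x => by positivity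
  have hηm : Measurable η := by fun_prop
  have hηi : Integrable η := integrable_rpow_neg_one_add_norm_sq (by
    rw [finrank_euclideanSpace_fin]; linarith)
  refine ⟨volume.withDensity fun x => ENNReal.ofReal (η x),
    isFiniteMeasure_withDensity_ofReal hηi.2, ?_, fun K hK => ?_⟩
  · conv_rhs => rw [← withDensity_one (μ := (volume : Measure (Euc n)))]
    refine withDensity_mono (Eventually.of_forall fun x => ?_)
    rw [Pi.one_apply, ← ENNReal.ofReal_one]
    refine ENNReal.ofReal_le_ofReal (Real.rpow_le_one_of_one_le_of_nonpos ?_ ?_)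
    · nlinarith [sq_nonneg ‖x‖]
    · have : (0 : ℝ) ≤ n := Nat.cast_nonneg n
      linarith
  · obtain ⟨R, hR⟩ := hK.isBounded.exists_norm_le
    set c := ENNReal.ofReal ((1 + R ^ 2) ^ (((n : ℝ) + 1) / 2)) with hc
    refine ⟨c, ENNReal.ofReal_ne_top, Measure.le_iff.2 fun A hA => ?_⟩
    rw [Measure.restrict_apply hA, Measure.smul_apply, withDensity_apply _ hA, smul_eq_mul,
      ← lintegral_const_mul' _ _ ENNReal.ofReal_ne_top, ← setLIntegral_one]
    refine (setLIntegral_mono' (hA.inter hK.measurableSet) fun x hx => ?_).trans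
      (lintegral_mono_set inter_subset_left)
    rw [← ENNReal.ofReal_mul (by positivity), ← ENNReal.ofReal_one]
    refine ENNReal.ofReal_le_ofReal ?_
    have h1 : η x = ((1 + ‖x‖ ^ 2) ^ (((n : ℝ) + 1) / 2))⁻¹ := by
      simp only [hη]
      rw [← Real.rpow_neg (by positivity), neg_div]
    rw [h1, ← div_eq_mul_inv, one_le_div (by positivity)]
    have := hR x hx.2
    gcongr

/-- Diagonal extraction for countably many bounded real sequences. -/
theorem exists_subseq_forall_tendsto {ι : Type*} [Countable ι] (a : ℕ → ι → ℝ) (C : ι → ℝ)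
    (h : ∀ k i, |a k i| ≤ C i) :
    ∃ φ : ℕ → ℕ, StrictMono φ ∧ ∀ i, ∃ l, Tendsto (fun k => a (φ k) i) atTop (𝓝 l) := by
  have hK : IsCompact (univ.pi fun i => Metric.closedBall (0 : ℝ) (C i)) :=
    isCompact_univ_pi fun i => isCompact_closedBall _ _
  obtain ⟨l, _, φ, hφ, hl⟩ := hK.tendsto_subseq (x := a) fun k i _ => by
    simpa using h k i
  exact ⟨φ, hφ, fun i => ⟨l i, (tendsto_pi_nhds.1 hl) i⟩⟩

/-- A local `L^p` limit of a sequence bounded in `L^p` belongs to `L^p`. -/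
theorem TendstoLpLoc.memLp {n : ℕ} {p : ℝ} (hp : 1 ≤ p) {u : ℕ → Euc n → ℝ} {v : Euc n → ℝ}
    (hu : ∀ k, AEStronglyMeasurable (u k)) (hv : AEStronglyMeasurable v) {M : ℝ≥0∞} (hM : M ≠ ∞)
    (huM : ∀ k, eLpNorm (u k) (ENNReal.ofReal p) volume ≤ M) (h : TendstoLpLoc p u v) :
    MemLp v (ENNReal.ofReal p) := by
  have hp1 : 1 ≤ ENNReal.ofReal p := by simpa using hp
  have hball : ∀ N : ℕ, eLpNorm ((Metric.closedBall 0 N).indicator v) (ENNReal.ofReal p) volume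
      ≤ M := by
    intro N
    rw [eLpNorm_indicator_eq_eLpNorm_restrict Metric.isClosed_closedBall.measurableSet]
    have h1 := h _ (isCompact_closedBall (0 : Euc n) N)
    have h2 := (tendsto_const_nhds (x := M)).add h1
    rw [add_zero] at h2
    refine ge_of_tendsto' h2 fun k => ?_
    have h3 : v = u k - fun x => u k x - v x := by ext x; simp
    calc eLpNorm v (ENNReal.ofReal p) (volume.restrict (Metric.closedBall 0 N))
        ≤ eLpNorm (u k) (ENNReal.ofReal p) (volume.restrict (Metric.closedBall 0 N)) +
          eLpNorm (fun x => u k x - v x) (ENNReal.ofReal p)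
            (volume.restrict (Metric.closedBall 0 N)) := by
          nth_rewrite 1 [h3]
          exact eLpNorm_sub_le (hu k).restrict ((hu k).sub hv).restrict hp1
      _ ≤ _ := by
          gcongr
          exact (eLpNorm_mono_measure _ Measure.restrict_le_self).trans (huM k)
  refine ⟨hv, (Lp.eLpNorm_lim_le_liminf_eLpNorm
    (f := fun N : ℕ => (Metric.closedBall (0 : Euc n) N).indicator v)
    (fun N => hv.indicator Metric.isClosed_closedBall.measurableSet) v
    (Eventually.of_forall fun x => ?_)).trans_lt (lt_of_le_of_lt ?_ hM.lt_top)⟩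
  · refine tendsto_const_nhds.congr' ?_
    filter_upwards [eventually_ge_atTop (Nat.ceil ‖x‖)] with N hN
    rw [indicator_of_mem]
    simpa using Nat.ceil_le.1 hN
  · exact liminf_le_of_le (by isBoundedDefault) fun b hb => by
      obtain ⟨N, hN⟩ := hb.exists
      exact hN.trans (hball N)

/-- Asymptotic approximation by Cauchy sequences gives a Cauchy sequence. -/
theorem cauchySeq_of_approx {X : Type*} [PseudoEMetricSpace X] {f : ℕ → X} {g : ℕ → ℕ → X}
    {e : ℕ → ℝ≥0∞} (he : Tendsto e atTop (𝓝 0)) (hg : ∀ j, CauchySeq (g j))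
    (hfg : ∀ j, ∀ᶠ k in atTop, edist (f k) (g j k) ≤ e j) : CauchySeq f := by
  rw [EMetric.cauchySeq_iff]
  intro ε hε
  have hε3 : 0 < ε / 3 := ENNReal.div_pos hε.ne' (by norm_num)
  obtain ⟨j, hj⟩ := (he.eventually (gt_mem_nhds hε3)).exists
  obtain ⟨N1, h1⟩ := EMetric.cauchySeq_iff.1 (hg j) (ε / 3) hε3
  obtain ⟨N2, h2⟩ := eventually_atTop.1 (hfg j)
  refine ⟨max N1 N2, fun k hk l hl => ?_⟩
  have e1 := (h2 k ((le_max_right _ _).trans hk)).trans_lt hj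
  have e2 := h1 k ((le_max_left _ _).trans hk) l ((le_max_left _ _).trans hl)
  have e3 := (h2 l ((le_max_right _ _).trans hl)).trans_lt hj
  rw [edist_comm] at e3
  calc edist (f k) (f l) ≤ edist (f k) (g j k) + edist (g j k) (g j l) + edist (g j l) (f l) :=
        edist_triangle4 _ _ _ _
    _ < ε / 3 + ε / 3 + ε / 3 := ENNReal.add_lt_add (ENNReal.add_lt_add e1 e2) e3
    _ = ε := ENNReal.add_thirds ε

/-- Equi-Lipschitz bounded sequences converging on a dense sequence converge everywhere. -/
theorem exists_tendsto_of_dense_of_lipschitz {X : Type*} [PseudoMetricSpace X] {f : ℕ → X → ℝ}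
    {D : ℕ → X} (hD : DenseRange D) {C : ℝ} (hC : 0 ≤ C)
    (hL : ∀ k x y, dist x y ≤ 1 → |f k x - f k y| ≤ C * dist x y)
    (h : ∀ i, ∃ l, Tendsto (fun k => f k (D i)) atTop (𝓝 l)) (x : X) :
    ∃ l, Tendsto (fun k => f k x) atTop (𝓝 l) := by
  refine cauchySeq_tendsto_of_complete (Metric.cauchySeq_iff'.2 fun ε hε => ?_)
  -- The bound `1` is needed because the Lipschitz estimate is only local; `C + 1` avoids dividing
  -- by zero.
  obtain ⟨i, hi⟩ := hD.exists_dist_lt x (show 0 < min 1 (ε / (4 * (C + 1))) by positivity)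
  have hi1 : dist x (D i) ≤ 1 := (hi.le).trans (min_le_left _ _)
  have hi2 : C * dist x (D i) ≤ ε / 4 := by
    have h1 : dist x (D i) ≤ ε / (4 * (C + 1)) := hi.le.trans (min_le_right _ _)
    calc C * dist x (D i) ≤ (C + 1) * (ε / (4 * (C + 1))) := by gcongr; linarith
      _ = ε / 4 := by field_simp
  obtain ⟨l, hl⟩ := h i
  obtain ⟨N, hN⟩ := Metric.cauchySeq_iff'.1 hl.cauchySeq (ε / 4) (by positivity)
  refine ⟨N, fun k hk => ?_⟩
  have e1 := hL k x (D i) hi1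
  have e2 := hN k hk
  have e3 := hL N x (D i) hi1
  rw [Real.dist_eq] at e2 ⊢
  rw [abs_lt] at e2 ⊢
  rw [abs_le] at e1 e3
  constructor <;> linarith [e1.1, e1.2, e2.1, e2.2, e3.1, e3.2]

/-- Bounded pointwise convergence implies convergence in `L^p` of a finite measure. -/
theorem tendsto_eLpNorm_sub_of_bounded {α : Type*} [MeasurableSpace α] {ν : Measure α}
    [IsFiniteMeasure ν] {p : ℝ} (hp : 0 < p) {f : ℕ → α → ℝ} {g : α → ℝ}
    (hf : ∀ k, Measurable (f k)) (hg : Measurable g) {C : ℝ} (hC : ∀ k x, |f k x| ≤ C)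
    (h : ∀ x, Tendsto (fun k => f k x) atTop (𝓝 (g x))) :
    Tendsto (fun k => eLpNorm (f k - g) (ENNReal.ofReal p) ν) atTop (𝓝 0) := by
  have hgC : ∀ x, |g x| ≤ C := fun x => le_of_tendsto' (h x).abs fun k => hC k x
  have h1 : Tendsto (fun k => ∫⁻ x, ‖(f k - g) x‖ₑ ^ p ∂ν) atTop (𝓝 (∫⁻ _, 0 ∂ν)) := by
    refine tendsto_lintegral_of_dominated_convergence (fun _ => ENNReal.ofReal (C + C) ^ p)
      (fun k => ((hf k).sub hg).enorm.pow_const _) (fun k => Eventually.of_forall fun x => ?_) ?_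
      (Eventually.of_forall fun x => ?_)
    · dsimp only
      gcongr
      rw [Real.enorm_eq_ofReal_abs]
      refine ENNReal.ofReal_le_ofReal ((abs_sub _ _).trans (add_le_add (hC k x) (hgC x)))
    · rw [lintegral_const]
      exact ENNReal.mul_ne_top (ENNReal.rpow_ne_top_of_nonneg hp.le ENNReal.ofReal_ne_top)
        (measure_ne_top _ _)
    · have h2 : Tendsto (fun k => ‖(f k - g) x‖ₑ) atTop (𝓝 0) := by
        have h3 := ((h x).sub_const (g x)).enorm
        simpa using h3
      have h4 := (ENNReal.continuous_rpow_const (y := p)).tendsto 0 |>.comp h2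
      simpa [ENNReal.zero_rpow_of_pos hp, Function.comp_def] using h4
  rw [lintegral_zero] at h1
  simp_rw [enorm_rpow_toReal_eLpNorm ν hp]
  have h4 := (ENNReal.continuous_rpow_const (y := 1 / p)).tendsto 0 |>.comp h1
  simpa [ENNReal.zero_rpow_of_pos (inv_pos.2 hp), Function.comp_def] using h4

/-- Compactness in `L^p_loc` of sequences with bounded rescaled fractional energy as `s → 1`. -/
theorem exists_subseq_tendstoLpLoc {n : ℕ} (hn : 1 ≤ n) {p : ℝ} (hp : 1 ≤ p) {s : ℕ → ℝ}
    (hs0 : ∀ k, 0 ≤ s k) (hs1 : ∀ k, s k < 1) (hs : Tendsto s atTop (𝓝 1))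
    {u : ℕ → Euc n → ℝ} (hum : ∀ k, Measurable (u k)) (hu : ∀ k, MemLp (u k) (ENNReal.ofReal p))
    {G M : ℝ≥0∞} (hG : G ≠ ∞) (hM : M ≠ ∞)
    (huG : ∀ k, ENNReal.ofReal (1 - s k) * gagliardoPow (s k) p (u k) ≤ G)
    (huM : ∀ k, eLpNorm (u k) (ENNReal.ofReal p) volume ≤ M) :
    ∃ (φ : ℕ → ℕ) (v : Euc n → ℝ), StrictMono φ ∧ MemLp v (ENNReal.ofReal p) ∧
      TendstoLpLoc p (fun j => u (φ j)) v := by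
  have hp0 : 0 < p := by linarith
  have hp1 : 1 ≤ ENNReal.ofReal p := by simpa using hp
  have : Fact (1 ≤ ENNReal.ofReal p) := ⟨hp1⟩
  have hui : ∀ k, LocallyIntegrable (u k) := fun k => (hu k).locallyIntegrable hp1
  obtain ⟨C, hC, hmoll⟩ := exists_annulus_mollifier hn
  set t : ℕ → ℝ := fun j => 1 / ((j : ℝ) + 1) with ht
  have ht0 : ∀ j, 0 < t j := fun j => by positivity
  have ht1 : ∀ j, t j ≤ 1 := fun j => by
    rw [ht]; exact (div_le_one (by positivity)).2 (by linarith [(Nat.cast_nonneg j : (0:ℝ) ≤ j)])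
  choose κ hκ hκ0 hκ1 hκs hκC using fun j => hmoll (t j) (ht0 j)
  have hκm : ∀ j, Measurable (κ j) := fun j => (hκ j).1.continuous.measurable
  have hκs1 : ∀ j h, 1 ≤ ‖h‖ → κ j h = 0 := fun j h hh =>
    hκs j h fun hm => absurd (hm.2.trans_le (ht1 j)) (not_lt.2 hh)
  choose S hS0 hS using fun j => exists_mollify_bound hp (hκ j) (hκs1 j) hM
  set m : ℕ → ℕ → Euc n → ℝ := fun j k => mollify (κ j) (u k) with hm
  have hmm : ∀ j k, Measurable (m j k) := fun j k =>
    (stronglyMeasurable_mollify (hκm j) (hum k)).measurable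
  have hmb : ∀ j k x, |m j k x| ≤ S j := fun j k => (hS j (u k) (hu k) (huM k)).1
  have hmL : ∀ j k x y, dist x y ≤ 1 → |m j k x - m j k y| ≤ S j * dist x y :=
    fun j k => (hS j (u k) (hu k) (huM k)).2
  -- extraction of a subsequence along which all mollifications converge pointwise
  obtain ⟨φ, hφ, hφl⟩ := exists_subseq_forall_tendsto
    (fun (k : ℕ) (i : ℕ × ℕ) => m i.1 k (TopologicalSpace.denseSeq (Euc n) i.2))
    (fun i => S i.1) (fun k i => hmb _ _ _)
  have hlim : ∀ j x, ∃ l, Tendsto (fun k => m j (φ k) x) atTop (𝓝 l) := fun j x =>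
    exists_tendsto_of_dense_of_lipschitz (TopologicalSpace.denseRange_denseSeq (Euc n)) (hS0 j)
      (fun k => hmL j (φ k)) (fun i => hφl (j, i)) x
  choose a ha using hlim
  have ham : ∀ j, Measurable (a j) := fun j =>
    measurable_of_tendsto_metrizable (fun k => hmm j (φ k)) (tendsto_pi_nhds.2 (ha j))
  -- Working in `L^p(ν)` with `ν` finite turns bounded pointwise convergence into norm convergence,
  -- and a single Cauchy sequence there handles all compact sets at once.
  obtain ⟨ν, hνf, hν, hνK⟩ := exists_isFiniteMeasure_le_volume n
  have huν : ∀ k, MemLp (u k) (ENNReal.ofReal p) ν := fun k => (hu k).mono_measure hν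
  have hmν : ∀ j k, MemLp (m j k) (ENNReal.ofReal p) ν := fun j k =>
    MemLp.of_bound (hmm j k).aestronglyMeasurable (S j) (Eventually.of_forall (hmb j k))
  have haν : ∀ j, MemLp (a j) (ENNReal.ofReal p) ν := fun j =>
    MemLp.of_bound (ham j).aestronglyMeasurable (S j) (Eventually.of_forall fun x =>
      le_of_tendsto' (ha j x).abs fun k => hmb j (φ k) x)
  have hcauchy : CauchySeq fun k => (huν (φ k)).toLp := by
    -- Eventually `s ≥ 1/2`, and `t j ≤ 1`, so `t^{sp} ≤ t^{p/2}`: the approximation error no longer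
    -- depends on `k`.
    refine cauchySeq_of_approx (g := fun j k => (hmν j (φ k)).toLp)
      (e := fun j => (ENNReal.ofReal (C * p * t j ^ (p / 2)) * G) ^ (1 / p)) ?_ (fun j => ?_)
      fun j => ?_
    · have h1 : Tendsto t atTop (𝓝 0) := tendsto_one_div_add_atTop_nhds_zero_nat
      have h2 : Tendsto (fun j => C * p * t j ^ (p / 2)) atTop (𝓝 0) := by
        have := (h1.rpow_const (p := p / 2) (Or.inr (by positivity))).const_mul (C * p)
        simpa [Real.zero_rpow (show p / 2 ≠ 0 by positivity)] using this
      have h3 := ENNReal.tendsto_ofReal h2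
      rw [ENNReal.ofReal_zero] at h3
      have h4 := ENNReal.Tendsto.mul_const h3 (Or.inr hG)
      rw [zero_mul] at h4
      have h5 := (ENNReal.continuous_rpow_const (y := 1 / p)).tendsto 0 |>.comp h4
      simpa [ENNReal.zero_rpow_of_pos (inv_pos.2 hp0), Function.comp_def] using h5
    · refine Tendsto.cauchySeq (x := (haν j).toLp) ?_
      rw [Lp.tendsto_Lp_iff_tendsto_eLpNorm'']
      exact tendsto_eLpNorm_sub_of_bounded hp0 (fun k => hmm j (φ k)) (ham j)
        (fun k => hmb j (φ k)) (ha j)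
    · have hev : ∀ᶠ k in atTop, 1 / 2 ≤ s (φ k) :=
        (hs.comp hφ.tendsto_atTop).eventually (Ici_mem_nhds (by norm_num))
      filter_upwards [hev] with k hk
      rw [Lp.edist_toLp_toLp]
      refine (eLpNorm_mono_measure _ hν).trans ?_
      rw [enorm_rpow_toReal_eLpNorm _ hp0]
      gcongr
      refine (lintegral_enorm_sub_mollify_le_gagliardo hp (hs0 (φ k)) (hs1 (φ k)) (hκ j) (hκ0 j)
        (hκ1 j) (ht0 j) hC (hκs j) (hκC j) (hum (φ k)) (hui (φ k))).trans ?_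
      gcongr ENNReal.ofReal (_ * ?_) * ?_
      · exact Real.rpow_le_rpow_of_exponent_ge (ht0 j) (ht1 j) (by nlinarith)
      · exact huG _
  obtain ⟨f, hf⟩ := cauchySeq_tendsto_of_complete hcauchy
  rw [Lp.tendsto_Lp_iff_tendsto_eLpNorm'] at hf
  set v : Euc n → ℝ := ⇑f with hv
  have hvm : StronglyMeasurable v := Lp.stronglyMeasurable f
  have hloc : TendstoLpLoc p (fun j => u (φ j)) v := by
    intro K hK
    obtain ⟨c, hc, hcK⟩ := hνK K hK
    have h1 : Tendsto (fun k => c ^ (1 / p) *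
        eLpNorm (⇑(huν (φ k)).toLp - v) (ENNReal.ofReal p) ν) atTop (𝓝 0) := by
      have := ENNReal.Tendsto.const_mul hf
        (Or.inr (ENNReal.rpow_ne_top_of_nonneg (show 0 ≤ 1 / p by positivity) hc))
      simpa using this
    refine tendsto_of_tendsto_of_tendsto_of_le_of_le tendsto_const_nhds h1 (fun _ => zero_le)
      fun k => ?_
    refine (eLpNorm_mono_measure _ hcK).trans ?_
    rw [enorm_rpow_toReal_eLpNorm _ hp0, lintegral_smul_measure, smul_eq_mul,
      ENNReal.mul_rpow_of_nonneg _ _ (by positivity), ← enorm_rpow_toReal_eLpNorm _ hp0]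
    refine le_of_eq ?_
    congr 1
    refine eLpNorm_congr_ae ?_
    filter_upwards [(huν (φ k)).coeFn_toLp] with x hx
    rw [Pi.sub_apply, hx]
  exact ⟨φ, v, hφ, hloc.memLp hp (fun k => (hum _).aestronglyMeasurable)
    hvm.aestronglyMeasurable hM (fun k => huM _), hloc⟩

/-! ### Polar coordinates and null sets on rays. -/

/-- Integration in polar coordinates. -/
theorem lintegral_eq_lintegral_sphere {n : ℕ} {f : Euc n → ℝ≥0∞} (hn : 1 ≤ n)
    (hf : Measurable f) :
    ∫⁻ x, f x = ∫⁻ ω : Metric.sphere (0 : Euc n) 1, ∫⁻ r in Ioi (0 : ℝ),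
      ENNReal.ofReal (r ^ (n - 1)) * f (r • (ω : Euc n)) ∂volume ∂(sphereMeasure n) := by
  have : Nontrivial (Euc n) := by
    have : Nonempty (Fin n) := ⟨⟨0, hn⟩⟩
    infer_instance
  have hmp := (volume : Measure (Euc n)).measurePreserving_homeomorphUnitSphereProd
  have hF : Measurable fun z : Metric.sphere (0 : Euc n) 1 × Ioi (0 : ℝ) =>
      f ((z.2 : ℝ) • (z.1 : Euc n)) :=
    hf.comp ((measurable_subtype_coe.comp measurable_snd).smul
      (measurable_subtype_coe.comp measurable_fst))
  have h1 := hmp.lintegral_comp hF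
  have h2 : ∀ x : ({0}ᶜ : Set (Euc n)),
      (((homeomorphUnitSphereProd (Euc n) x).2 : ℝ) •
        ((homeomorphUnitSphereProd (Euc n) x).1 : Euc n)) = (x : Euc n) := by
    intro x
    rw [← homeomorphUnitSphereProd_symm_apply_coe, Homeomorph.symm_apply_apply]
  simp_rw [h2] at h1
  rw [lintegral_subtype_comap (measurableSet_singleton (0 : Euc n)).compl,
    restrict_compl_singleton, lintegral_prod _ hF.aemeasurable, finrank_euclideanSpace_fin] at h1
  rw [h1]
  refine lintegral_congr fun ω => ?_
  have hG : Measurable fun r : Ioi (0 : ℝ) => f ((r : ℝ) • (ω : Euc n)) :=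
    hf.comp (measurable_subtype_coe.smul_const _)
  have hd : Measurable fun r : Ioi (0 : ℝ) => ENNReal.ofReal ((r : ℝ) ^ (n - 1)) :=
    (measurable_subtype_coe.pow_const _).ennreal_ofReal
  rw [Measure.volumeIoiPow, lintegral_withDensity_eq_lintegral_mul _ hd hG]
  exact lintegral_subtype_comap measurableSet_Ioi
    fun r => ENNReal.ofReal (r ^ (n - 1)) * f (r • (ω : Euc n))

/-- A property valid almost everywhere is valid almost everywhere on almost every ray. -/
theorem ae_sphere_ae_of_ae {n : ℕ} (hn : 1 ≤ n) {P : Euc n → Prop} (hP : ∀ᵐ x, P x) :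
    ∀ᵐ ω : Metric.sphere (0 : Euc n) 1 ∂(sphereMeasure n), ∀ᵐ r : ℝ, 0 < r → P (r • (ω : Euc n)) := by
  obtain ⟨N, hN, hNm, hN0⟩ := exists_measurable_superset_of_null (ae_iff.1 hP)
  have hfm : Measurable (N.indicator fun _ => (1 : ℝ≥0∞)) := measurable_const.indicator hNm
  have h0 : ∫⁻ x, N.indicator (fun _ => (1 : ℝ≥0∞)) x = 0 := by
    rw [lintegral_indicator hNm, setLIntegral_one, hN0]
  have hm : Measurable fun z : Metric.sphere (0 : Euc n) 1 × ℝ =>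
      ENNReal.ofReal (z.2 ^ (n - 1)) * N.indicator (fun _ => (1 : ℝ≥0∞)) (z.2 • (z.1 : Euc n)) :=
    (measurable_snd.pow_const _).ennreal_ofReal.mul
      (hfm.comp (measurable_snd.smul (measurable_subtype_coe.comp measurable_fst)))
  rw [lintegral_eq_lintegral_sphere hn hfm, lintegral_eq_zero_iff hm.lintegral_prod_right'] at h0
  filter_upwards [h0] with ω hω
  have hm' : Measurable fun r : ℝ =>
      ENNReal.ofReal (r ^ (n - 1)) * N.indicator (fun _ => (1 : ℝ≥0∞)) (r • (ω : Euc n)) :=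
    hm.comp measurable_prodMk_left
  rw [Pi.zero_apply, lintegral_eq_zero_iff hm'] at hω
  filter_upwards [(ae_restrict_iff' measurableSet_Ioi).1 hω] with r hr hr0
  by_contra hPr
  have h2 : r • (ω : Euc n) ∈ N := hN hPr
  have h1 := hr hr0
  simp only [indicator_of_mem h2, mul_one, Pi.zero_apply,
    ENNReal.ofReal_eq_zero] at h1
  exact absurd h1 (not_le.2 (pow_pos hr0 _))

/-! ### Radial probability measures concentrating at zero and averages of the kernel. -/

/-- The probability measure on `(0, 1)` with density `c r^{c-1}`. -/
def powerMeasure (c : ℝ) : Measure ℝ :=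
  (volume.restrict (Ioo 0 1)).withDensity fun r => ENNReal.ofReal (c * r ^ (c - 1))

theorem measurable_powerMeasure_density (c : ℝ) :
    Measurable fun r : ℝ => ENNReal.ofReal (c * r ^ (c - 1)) := by
  fun_prop

theorem isProbabilityMeasure_powerMeasure {c : ℝ} (hc : 0 < c) :
    IsProbabilityMeasure (powerMeasure c) := by
  refine ⟨?_⟩
  have hi : IntervalIntegrable (fun r : ℝ => c * r ^ (c - 1)) volume 0 1 :=
    (intervalIntegral.intervalIntegrable_rpow' (by linarith)).const_mul c
  rw [powerMeasure, withDensity_apply _ .univ, Measure.restrict_univ,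
    ← ofReal_integral_eq_lintegral_ofReal]
  · rw [← integral_Ioc_eq_integral_Ioo, ← intervalIntegral.integral_of_le zero_le_one,
      intervalIntegral.integral_const_mul, integral_rpow (Or.inl (by linarith))]
    simp [Real.zero_rpow hc.ne', hc.ne']
  · exact ((intervalIntegrable_iff_integrableOn_Ioo_of_le zero_le_one).1 hi)
  · filter_upwards [ae_restrict_mem measurableSet_Ioo] with r hr
    exact mul_nonneg hc.le (Real.rpow_nonneg hr.1.le _)

theorem powerMeasure_absolutelyContinuous (c : ℝ) : powerMeasure c ≪ volume :=
  (withDensity_absolutelyContinuous _ _).trans Measure.absolutelyContinuous_restrict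

theorem ae_powerMeasure_mem_Ioo (c : ℝ) : ∀ᵐ r ∂powerMeasure c, r ∈ Ioo (0 : ℝ) 1 :=
  (withDensity_absolutelyContinuous _ _).ae_le (ae_restrict_mem measurableSet_Ioo)

/-- On `(0,1)`, `r · c r^{c-1} = c r^c ≤ c`. The first moment quantifies concentration at `0` as `c
→ 0`, and matches errors that are linear in `r`. -/
theorem lintegral_powerMeasure_ofReal_le {c : ℝ} (hc : 0 < c) :
    ∫⁻ r, ENNReal.ofReal r ∂powerMeasure c ≤ ENNReal.ofReal c := by
  rw [powerMeasure, lintegral_withDensity_eq_lintegral_mul _ (measurable_powerMeasure_density c)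
    ENNReal.measurable_ofReal]
  calc _ ≤ ∫⁻ r in Ioo (0 : ℝ) 1, ENNReal.ofReal c := by
        refine setLIntegral_mono' measurableSet_Ioo fun r hr => ?_
        rw [Pi.mul_apply, ← ENNReal.ofReal_mul (mul_nonneg hc.le (Real.rpow_nonneg hr.1.le _))]
        refine ENNReal.ofReal_le_ofReal ?_
        rw [mul_assoc, ← Real.rpow_add_one hr.1.ne', sub_add_cancel]
        exact mul_le_of_le_one_right hc.le (Real.rpow_le_one hr.1.le hr.2.le hc.le)
    _ = _ := by simp

/-- Intervals to the right of `0` have positive measure, so a full-measure set meets each of them.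
This transfers bounds valid for almost every `r` to the limit at `0`. -/
theorem frequently_nhdsGT_of_ae {P : ℝ → Prop} {δ : ℝ} (hδ : 0 < δ)
    (hP : ∀ᵐ r : ℝ, r ∈ Ioo 0 δ → P r) : ∃ᶠ r in 𝓝[>] (0 : ℝ), P r := by
  intro hnot
  obtain ⟨ε, hε, hεP⟩ := (mem_nhdsGT_iff_exists_Ioo_subset).1 hnot
  have hε0 : (0 : ℝ) < ε := hε
  have h1 : volume (Ioo 0 (min ε δ)) = 0 := by
    refine measure_mono_null (fun r hr => ?_) (ae_iff.1 hP)
    have hr1 : r ∈ Ioo 0 ε := ⟨hr.1, hr.2.trans_le (min_le_left _ _)⟩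
    have hr2 : r ∈ Ioo 0 δ := ⟨hr.1, hr.2.trans_le (min_le_right _ _)⟩
    exact fun h => hεP hr1 (h hr2)
  rw [Real.volume_Ioo, ENNReal.ofReal_eq_zero] at h1
  have : 0 < min ε δ := lt_min hε0 hδ
  linarith

/-- Negative powers are Lipschitz away from zero. -/
theorem abs_rpow_one_sub_sub_le {q lo x y : ℝ} (hq : 1 < q) (hlo : 0 < lo) (hx : lo ≤ x)
    (hy : lo ≤ y) : |y ^ (1 - q) - x ^ (1 - q)| ≤ (q - 1) * lo ^ (-q) * |y - x| := by
  refine Convex.norm_image_sub_le_of_norm_hasDerivWithin_le (𝕜 := ℝ)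
    (f := fun t : ℝ => t ^ (1 - q)) (f' := fun t => (1 - q) * t ^ (1 - q - 1)) (s := Ici lo)
    (fun t ht => ?_) (fun t ht => ?_) (convex_Ici lo) hx hy
  · exact (Real.hasDerivAt_rpow_const (Or.inl (hlo.trans_le ht).ne')).hasDerivWithinAt
  · have ht0 : 0 < t := hlo.trans_le ht
    rw [norm_mul, Real.norm_eq_abs, Real.norm_eq_abs, abs_of_neg (by linarith),
      abs_of_pos (by positivity), neg_sub, show 1 - q - 1 = -q by ring]
    gcongr ?_ * ?_
    exact Real.rpow_le_rpow_of_nonpos hlo ht (by linarith)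

/-- Averages against measures concentrating at `0` of a negative power of a function with a limit
at `0`. -/
theorem tendsto_lintegral_rpow_of_radial_limit {ρ : ℕ → Measure ℝ}
    [∀ k, IsProbabilityMeasure (ρ k)] (hac : ∀ k, ρ k ≪ volume)
    (hsupp : ∀ k, ∀ᵐ r ∂ρ k, r ∈ Ioo (0 : ℝ) 1)
    (hρ : Tendsto (fun k => ∫⁻ r, ENNReal.ofReal r ∂ρ k) atTop (𝓝 0))
    {f : ℝ → ℝ} (hf : Measurable f) {lo hi : ℝ} (hlo : 0 < lo) (hflo : ∀ r, lo ≤ f r)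
    (hfhi : ∀ r, f r ≤ hi) {a C δ : ℝ} (hδ : 0 < δ)
    (ha : ∀ᵐ r : ℝ, r ∈ Ioo 0 δ → |f r - a| ≤ C * r) {q : ℝ} (hq : 1 < q) :
    lo ≤ a ∧ Tendsto (fun k => ∫⁻ r, ENNReal.ofReal (f r) ^ (1 - q) ∂ρ k) atTop
      (𝓝 (ENNReal.ofReal a ^ (1 - q))) := by
  have hfreq := frequently_nhdsGT_of_ae hδ ha
  have hloa : lo ≤ a := by
    have h1 : Tendsto (fun r : ℝ => a + C * r) (𝓝[>] 0) (𝓝 a) := by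
      have : Continuous fun r : ℝ => a + C * r := by fun_prop
      simpa using (this.tendsto 0).mono_left nhdsWithin_le_nhds
    refine ge_of_tendsto_of_frequently h1 (hfreq.mono fun r hr => ?_)
    linarith [hflo r, (abs_le.1 hr).2]
  have hahi : a ≤ hi := by
    have h1 : Tendsto (fun r : ℝ => a - C * r) (𝓝[>] 0) (𝓝 a) := by
      have : Continuous fun r : ℝ => a - C * r := by fun_prop
      simpa using (this.tendsto 0).mono_left nhdsWithin_le_nhds
    refine le_of_tendsto_of_frequently h1 (hfreq.mono fun r hr => ?_)
    linarith [hfhi r, (abs_le.1 hr).1]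
  refine ⟨hloa, ?_⟩
  have ha0 : 0 < a := hlo.trans_le hloa
  set L := (q - 1) * lo ^ (-q) with hL
  have hL0 : 0 ≤ L := mul_nonneg (by linarith) (by positivity)
  -- `D` makes the error linear on all of `(0,1)`: below `δ` the radial expansion applies, and for
  -- `r ≥ δ` the trivial bound `hi - lo` is at most `(hi - lo) r / δ`.
  set D := L * (|C| + (hi - lo) / δ) with hD
  have hlohi : 0 ≤ hi - lo := by linarith
  have hD0 : 0 ≤ D := by positivity
  have hbd : ∀ᵐ r : ℝ, r ∈ Ioo (0 : ℝ) 1 → |f r ^ (1 - q) - a ^ (1 - q)| ≤ D * r := by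
    filter_upwards [ha] with r hr hr1
    have hr0 := hr1.1
    refine (abs_rpow_one_sub_sub_le hq hlo hloa (hflo r)).trans ?_
    rw [hD, mul_assoc L]
    refine mul_le_mul_of_nonneg_left ?_ hL0
    by_cases hrδ : r < δ
    · refine (hr ⟨hr0, hrδ⟩).trans ?_
      have h1 : C * r ≤ |C| * r := by gcongr; exact le_abs_self C
      have h2 : 0 ≤ (hi - lo) / δ * r := by positivity
      linarith [add_mul |C| ((hi - lo) / δ) r]
    · have h1 : |f r - a| ≤ hi - lo := by
        rw [abs_le]; constructor <;> linarith [hflo r, hfhi r]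
      have h2 : hi - lo ≤ (hi - lo) / δ * r := by
        rw [div_mul_eq_mul_div, le_div_iff₀ hδ]
        exact mul_le_mul_of_nonneg_left (not_lt.1 hrδ) hlohi
      have h3 : 0 ≤ |C| * r := by positivity
      linarith [add_mul |C| ((hi - lo) / δ) r]
  have hfr : ∀ r, ENNReal.ofReal (f r) ^ (1 - q) = ENNReal.ofReal (f r ^ (1 - q)) := fun r =>
    ENNReal.ofReal_rpow_of_pos (hlo.trans_le (hflo r))
  have har : ENNReal.ofReal a ^ (1 - q) = ENNReal.ofReal (a ^ (1 - q)) :=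
    ENNReal.ofReal_rpow_of_pos ha0
  simp_rw [hfr, har]
  have hgm : Measurable fun r => ENNReal.ofReal (f r ^ (1 - q)) := by fun_prop
  have hup : ∀ k, ∫⁻ r, ENNReal.ofReal (f r ^ (1 - q)) ∂ρ k ≤ ENNReal.ofReal (a ^ (1 - q)) +
      ENNReal.ofReal D * ∫⁻ r, ENNReal.ofReal r ∂ρ k := by
    intro k
    calc ∫⁻ r, ENNReal.ofReal (f r ^ (1 - q)) ∂ρ k
        ≤ ∫⁻ r, (ENNReal.ofReal (a ^ (1 - q)) + ENNReal.ofReal D * ENNReal.ofReal r) ∂ρ k := by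
          refine lintegral_mono_ae ?_
          filter_upwards [hsupp k, (hac k).ae_le hbd] with r hr hr'
          rw [← ENNReal.ofReal_mul hD0, ← ENNReal.ofReal_add (by positivity)
            (mul_nonneg hD0 hr.1.le)]
          refine ENNReal.ofReal_le_ofReal ?_
          linarith [(abs_le.1 (hr' hr)).2]
      _ = _ := by
          rw [lintegral_add_left measurable_const, lintegral_const_mul' _ _ ENNReal.ofReal_ne_top]
          simp
  have hdown : ∀ k, ENNReal.ofReal (a ^ (1 - q)) - ENNReal.ofReal D * ∫⁻ r, ENNReal.ofReal r ∂ρ k ≤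
      ∫⁻ r, ENNReal.ofReal (f r ^ (1 - q)) ∂ρ k := by
    intro k
    rw [tsub_le_iff_right]
    calc ENNReal.ofReal (a ^ (1 - q)) = ∫⁻ _, ENNReal.ofReal (a ^ (1 - q)) ∂ρ k := by simp
      _ ≤ ∫⁻ r, (ENNReal.ofReal (f r ^ (1 - q)) + ENNReal.ofReal D * ENNReal.ofReal r) ∂ρ k := by
          refine lintegral_mono_ae ?_
          filter_upwards [hsupp k, (hac k).ae_le hbd] with r hr hr'
          have := hlo.trans_le (hflo r)
          rw [← ENNReal.ofReal_mul hD0, ← ENNReal.ofReal_add (by positivity)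
            (mul_nonneg hD0 hr.1.le)]
          refine ENNReal.ofReal_le_ofReal ?_
          linarith [(abs_le.1 (hr' hr)).1]
      _ = _ := by
          rw [lintegral_add_left hgm, lintegral_const_mul' _ _ ENNReal.ofReal_ne_top]
  have hlim0 : Tendsto (fun k => ENNReal.ofReal D * ∫⁻ r, ENNReal.ofReal r ∂ρ k) atTop (𝓝 0) := by
    simpa using ENNReal.Tendsto.const_mul hρ (Or.inr (ENNReal.ofReal_ne_top (r := D)))
  refine tendsto_of_tendsto_of_tendsto_of_le_of_le ?_ ?_ hdown hup
  · simpa using ENNReal.Tendsto.sub (tendsto_const_nhds (x := ENNReal.ofReal (a ^ (1 - q)))) hlim0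
      (Or.inl ENNReal.ofReal_ne_top)
  · simpa using (tendsto_const_nhds (x := ENNReal.ofReal (a ^ (1 - q)))).add hlim0

/-! ### Slicing of the energy. -/

/-- Slicing of the anisotropic energy along rays. -/
theorem lintegral_sphere_powerMeasure_le {n : ℕ} (hn : 1 ≤ n) {s p : ℝ} (hp : 1 ≤ p) (hs1 : s < 1)
    {m : Euc n × Euc n → ℝ} (hm : Measurable m) (hm0 : ∀ z, 0 ≤ m z) {u : Euc n → ℝ}
    (hu : Measurable u) :
    ∫⁻ ω : Metric.sphere (0 : Euc n) 1, ∫⁻ r, ∫⁻ x, ENNReal.ofReal (m (x, r • (ω : Euc n))) *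
        ‖(u x - u (x - r • (ω : Euc n))) / r‖ₑ ^ p ∂volume ∂powerMeasure (p * (1 - s))
          ∂(sphereMeasure n) ≤
      ENNReal.ofReal (p ^ 2) * anisoEnergy (fun x h => m (x, h)) s p u := by
  have hp0 : 0 < p := by linarith
  -- The factor `p²` on the right turns the prefactor `(1-s)/p` of the energy into `c`, the
  -- normalization of the power measure.
  set c := p * (1 - s) with hc
  have hc0 : 0 < c := mul_pos hp0 (by linarith)
  set k : Euc n → ℝ≥0∞ := fun h => ENNReal.ofReal ((‖h‖ ^ ((n : ℝ) + s * p))⁻¹) with hk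
  have hkm : Measurable k := ((measurable_norm.pow_const _).inv).ennreal_ofReal
  set H : Euc n → ℝ≥0∞ := fun h =>
    (∫⁻ x, ENNReal.ofReal (m (x, h)) * ‖u x - u (x - h)‖ₑ ^ p) * k h with hH
  have hjm : Measurable fun z : Euc n × Euc n =>
      ENNReal.ofReal (m z) * ‖u z.1 - u (z.1 - z.2)‖ₑ ^ p :=
    hm.ennreal_ofReal.mul (measurable_enorm_sub_translate p hu)
  have hIm : Measurable fun h => ∫⁻ x, ENNReal.ofReal (m (x, h)) * ‖u x - u (x - h)‖ₑ ^ p :=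
    hjm.lintegral_prod_left'
  have hHm : Measurable H := hIm.mul hkm
  have haniso : ENNReal.ofReal (p ^ 2) * anisoEnergy (fun x h => m (x, h)) s p u =
      ENNReal.ofReal c * ∫⁻ h, H h := by
    rw [anisoEnergy, ← mul_assoc, ← ENNReal.ofReal_mul (by positivity)]
    congr 1
    · congr 1
      rw [hc]; field_simp
    · have h1 : ∀ z : Euc n × Euc n, ENNReal.ofReal (m (z.1, z.2) *
          (|u z.1 - u (z.1 - z.2)| ^ p / ‖z.2‖ ^ ((n : ℝ) + s * p))) =
          ENNReal.ofReal (m z) * ‖u z.1 - u (z.1 - z.2)‖ₑ ^ p * k z.2 := by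
        intro z
        rw [div_eq_mul_inv, ENNReal.ofReal_mul (hm0 _), ENNReal.ofReal_mul (by positivity),
          Real.enorm_eq_ofReal_abs, ENNReal.ofReal_rpow_of_nonneg (abs_nonneg _) hp0.le, mul_assoc]
      simp_rw [h1]
      have hjk : Measurable fun z : Euc n × Euc n =>
          ENNReal.ofReal (m z) * ‖u z.1 - u (z.1 - z.2)‖ₑ ^ p * k z.2 :=
        hjm.mul (hkm.comp measurable_snd)
      rw [Measure.volume_eq_prod, lintegral_prod_symm _ hjk.aemeasurable]
      refine lintegral_congr fun h => ?_
      have h2 : Measurable fun x => ENNReal.ofReal (m (x, h)) * ‖u x - u (x - h)‖ₑ ^ p :=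
        hjm.comp measurable_prodMk_right
      simp only [hH]
      exact lintegral_mul_const (k h) h2
  rw [haniso, lintegral_eq_lintegral_sphere hn hHm, ← lintegral_const_mul' _ _ ENNReal.ofReal_ne_top]
  refine lintegral_mono fun ω => ?_
  dsimp only
  rw [← lintegral_const_mul' _ _ ENNReal.ofReal_ne_top]
  have hωn : ‖(ω : Euc n)‖ = 1 := norm_eq_of_mem_sphere ω
  have hIr : Measurable fun r : ℝ => ∫⁻ x, ENNReal.ofReal (m (x, r • (ω : Euc n))) *
        ‖(u x - u (x - r • (ω : Euc n))) / r‖ₑ ^ p := by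
    have : Measurable fun z : ℝ × Euc n => ENNReal.ofReal (m (z.2, z.1 • (ω : Euc n))) *
        ‖(u z.2 - u (z.2 - z.1 • (ω : Euc n))) / z.1‖ₑ ^ p := by
      have h1 : Measurable fun z : ℝ × Euc n => z.1 • (ω : Euc n) := measurable_fst.smul_const _
      refine (hm.comp (measurable_snd.prodMk h1)).ennreal_ofReal.mul ?_
      exact (((hu.comp measurable_snd).sub (hu.comp (measurable_snd.sub h1))).div
        measurable_fst).enorm.pow_const _
    exact this.lintegral_prod_right'
  rw [powerMeasure, lintegral_withDensity_eq_lintegral_mul _ (measurable_powerMeasure_density c) hIr]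
  -- The only loss is the restriction to `r < 1`. On `(0,1)` the integrands coincide, because `(c-1)
  -- - p = (n-1) - (n+sp)`.
  refine (setLIntegral_mono' measurableSet_Ioo fun r hr => ?_).trans
    (lintegral_mono_set Ioo_subset_Ioi_self)
  have hr0 : 0 < r := hr.1
  have h1 : ∫⁻ x, ENNReal.ofReal (m (x, r • (ω : Euc n))) *
        ‖(u x - u (x - r • (ω : Euc n))) / r‖ₑ ^ p = ENNReal.ofReal (r ^ (-p)) *
      ∫⁻ x, ENNReal.ofReal (m (x, r • (ω : Euc n))) * ‖u x - u (x - r • (ω : Euc n))‖ₑ ^ p := by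
    rw [← lintegral_const_mul' _ _ ENNReal.ofReal_ne_top]
    refine lintegral_congr fun x => ?_
    rw [div_eq_mul_inv, enorm_mul, ENNReal.mul_rpow_of_nonneg _ _ hp0.le,
      Real.enorm_eq_ofReal (inv_nonneg.2 hr0.le), ENNReal.ofReal_rpow_of_pos (inv_pos.2 hr0),
      Real.inv_rpow hr0.le, ← Real.rpow_neg hr0.le]
    ring
  rw [Pi.mul_apply, h1, hH]
  simp only [hk]
  rw [norm_smul, hωn, mul_one, Real.norm_eq_abs, abs_of_pos hr0]
  refine le_of_eq ?_
  set I := ∫⁻ x, ENNReal.ofReal (m (x, r • (ω : Euc n))) * ‖u x - u (x - r • (ω : Euc n))‖ₑ ^ p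
  have h2 : c * r ^ (c - 1) * r ^ (-p) = c * (r ^ (n - 1) * (r ^ ((n : ℝ) + s * p))⁻¹) := by
    rw [mul_assoc, ← Real.rpow_natCast, ← Real.rpow_neg hr0.le, ← Real.rpow_add hr0,
      ← Real.rpow_add hr0, Nat.cast_sub hn, hc]
    congr 2
    push_cast
    ring
  calc ENNReal.ofReal (c * r ^ (c - 1)) * (ENNReal.ofReal (r ^ (-p)) * I)
      = ENNReal.ofReal (c * r ^ (c - 1) * r ^ (-p)) * I := by
        rw [← mul_assoc, ← ENNReal.ofReal_mul (by positivity)]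
    _ = ENNReal.ofReal c * (ENNReal.ofReal (r ^ (n - 1)) *
        (I * ENNReal.ofReal (r ^ ((n : ℝ) + s * p))⁻¹)) := by
        rw [h2, ENNReal.ofReal_mul hc0.le, ENNReal.ofReal_mul (p := r ^ (n - 1)) (by positivity)]
        ring

/-! ### From directional derivatives to a weak gradient. -/

/-- A subspace containing almost every direction is everything. -/
theorem submodule_eq_top_of_ae_sphere {n : ℕ} (hn : 1 ≤ n) {S : Submodule ℝ (Euc n)}
    (hS : ∀ᵐ ω : Metric.sphere (0 : Euc n) 1 ∂(sphereMeasure n), (ω : Euc n) ∈ S) : S = ⊤ := by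
  have : Nontrivial (Euc n) := by
    have : Nonempty (Fin n) := ⟨⟨0, hn⟩⟩
    infer_instance
  by_contra hne
  have h0 : ∀ᵐ x : Euc n, x ∉ S := measure_eq_zero_iff_ae_notMem.1
    (Measure.addHaar_submodule volume S hne)
  have : NeBot (ae (sphereMeasure n)) := ae_neBot.2 (Measure.toSphere_ne_zero _)
  obtain ⟨ω, hω, hωS⟩ := ((ae_sphere_ae_of_ae hn h0).and hS).exists
  -- A proper subspace is Lebesgue null, hence missed by almost every point of this ray; but `ω ∈ S`
  -- puts the whole ray inside `S`.
  refine frequently_nhdsGT_of_ae (δ := 1) (P := fun _ => False) one_pos ?_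
    (Eventually.of_forall fun _ => id)
  filter_upwards [hω] with r hr hr1
  exact hr hr1.1 (S.smul_mem r hωS)

theorem distribDeriv_add {n : ℕ} {v : Euc n → ℝ} (hv : LocallyIntegrable v) (e f : Euc n)
    (φ : testFunctions n) : distribDeriv hv (e + f) φ = distribDeriv hv e φ + distribDeriv hv f φ := by
  have hi : ∀ e : Euc n, Integrable fun x => v x * fderiv ℝ (φ : Euc n → ℝ) x e :=
    fun e => hv.integrable_smul_right_of_hasCompactSupport
      ((φ.2.1.continuous_fderiv (by simp)).clm_apply continuous_const)
      (φ.2.2.fderiv_apply ℝ e)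
  change -∫ x, v x * fderiv ℝ (φ : Euc n → ℝ) x (e + f) =
    -(∫ x, v x * fderiv ℝ (φ : Euc n → ℝ) x e) + -∫ x, v x * fderiv ℝ (φ : Euc n → ℝ) x f
  rw [← neg_add, ← integral_add (hi e) (hi f)]
  simp_rw [map_add, mul_add]

theorem distribDeriv_smul {n : ℕ} {v : Euc n → ℝ} (hv : LocallyIntegrable v) (c : ℝ) (e : Euc n)
    (φ : testFunctions n) : distribDeriv hv (c • e) φ = c * distribDeriv hv e φ := by
  change -∫ x, v x * fderiv ℝ (φ : Euc n → ℝ) x (c • e) =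
    c * -∫ x, v x * fderiv ℝ (φ : Euc n → ℝ) x e
  rw [mul_neg, ← integral_const_mul]
  simp_rw [map_smul, smul_eq_mul, mul_left_comm]

theorem integrable_mul_testFunction {n : ℕ} {p : ℝ} (hp : 1 ≤ p) {γ : Euc n → ℝ}
    (hγ : MemLp γ (ENNReal.ofReal p)) (φ : testFunctions n) :
    Integrable fun x => γ x * (φ : Euc n → ℝ) x :=
  (hγ.locallyIntegrable (by simpa using hp)).integrable_smul_right_of_hasCompactSupport
    φ.2.1.continuous φ.2.2

/-- If almost every directional derivative is an `Lᵖ` function, then there is an `Lᵖ` gradient. -/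
theorem exists_memLp_gradient {n : ℕ} (hn : 1 ≤ n) {p : ℝ} (hp : 1 ≤ p) {v : Euc n → ℝ}
    (hv : LocallyIntegrable v)
    (h : ∀ᵐ ω : Metric.sphere (0 : Euc n) 1 ∂(sphereMeasure n), ∃ γ : Euc n → ℝ, Measurable γ ∧
      MemLp γ (ENNReal.ofReal p) ∧
      ∀ φ : testFunctions n, distribDeriv hv (ω : Euc n) φ = ∫ x, γ x * (φ : Euc n → ℝ) x) :
    ∃ g : Euc n → Euc n, Measurable g ∧ MemLp g (ENNReal.ofReal p) ∧
      ∀ (e : Euc n) (φ : testFunctions n),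
        distribDeriv hv e φ = ∫ x, inner ℝ (g x) e * (φ : Euc n → ℝ) x := by
  -- The coordinate directions may lie in the exceptional null set of directions; linearity of `e ↦
  -- distribDeriv hv e φ` recovers them.
  let S : Submodule ℝ (Euc n) :=
    { carrier := {e | ∃ γ : Euc n → ℝ, Measurable γ ∧ MemLp γ (ENNReal.ofReal p) ∧
        ∀ φ : testFunctions n, distribDeriv hv e φ = ∫ x, γ x * (φ : Euc n → ℝ) x}
      add_mem' := by
        rintro e f ⟨γ, hγ, hγp, hγe⟩ ⟨η, hη, hηp, hηf⟩
        refine ⟨fun x => γ x + η x, hγ.add hη, hγp.add hηp, fun φ => ?_⟩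
        rw [distribDeriv_add, hγe, hηf, ← integral_add (integrable_mul_testFunction hp hγp φ)
          (integrable_mul_testFunction hp hηp φ)]
        simp_rw [add_mul]
      zero_mem' := ⟨fun _ => 0, measurable_const, MemLp.zero, fun φ => by
        have := distribDeriv_smul hv 0 0 φ
        simpa using this⟩
      smul_mem' := by
        rintro c e ⟨γ, hγ, hγp, hγe⟩
        refine ⟨fun x => c * γ x, hγ.const_mul c, hγp.const_mul c, fun φ => ?_⟩
        rw [distribDeriv_smul, hγe, ← integral_const_mul]
        simp_rw [mul_assoc] }
  have hS : S = ⊤ := submodule_eq_top_of_ae_sphere hn h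
  have hmem : ∀ i : Fin n, EuclideanSpace.single i (1 : ℝ) ∈ S := fun i => hS ▸ Submodule.mem_top
  choose γ hγ hγp hγe using hmem
  refine ⟨fun x => WithLp.toLp 2 fun i => γ i x, ?_, ?_, fun e φ => ?_⟩
  · exact (WithLp.measurable_toLp 2 _).comp (measurable_pi_lambda _ hγ)
  · have h1 : (fun x => (WithLp.toLp 2 fun i => γ i x : Euc n)) =
        fun x => ∑ i, γ i x • EuclideanSpace.single i (1 : ℝ) := by
      ext x j
      simp [Finset.sum_apply, Pi.single_apply]
    rw [h1]
    refine memLp_finsetSum _ fun i _ => ?_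
    exact (ContinuousLinearMap.toSpanSingleton ℝ (EuclideanSpace.single i (1 : ℝ))).comp_memLp'
      (hγp i)
  · have h1 : e = ∑ i, e i • EuclideanSpace.single i (1 : ℝ) := by
      ext j
      simp [Finset.sum_apply, Pi.single_apply]
    have h2 : ∀ (t : Finset (Fin n)), distribDeriv hv (∑ i ∈ t, e i • EuclideanSpace.single i 1) φ =
        ∑ i ∈ t, e i * distribDeriv hv (EuclideanSpace.single i 1) φ := by
      intro t
      induction t using Finset.induction_on with
      | empty => simpa using distribDeriv_smul hv 0 0 φ
      | insert i t hi ih =>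
        rw [Finset.sum_insert hi, Finset.sum_insert hi, distribDeriv_add, distribDeriv_smul, ih]
    conv_lhs => rw [h1]
    rw [h2]
    simp_rw [hγe, ← integral_const_mul]
    rw [← integral_finsetSum _ fun i _ => (integrable_mul_testFunction hp (hγp i) φ).const_mul _]
    refine integral_congr_ae (Eventually.of_forall fun x => ?_)
    simp only [PiLp.inner_apply, RCLike.inner_apply, conj_trivial, Finset.sum_mul, mul_assoc]

theorem memSobolevOne_of_distribDeriv {n : ℕ} {p : ℝ} (hp : 1 ≤ p) {v : Euc n → ℝ}
    (hvp : MemLp v (ENNReal.ofReal p)) (hv : LocallyIntegrable v) {g : Euc n → Euc n}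
    (hg : MemLp g (ENNReal.ofReal p)) (h : ∀ (e : Euc n) (φ : testFunctions n),
        distribDeriv hv e φ = ∫ x, inner ℝ (g x) e * (φ : Euc n → ℝ) x) :
    MemSobolevOne p v g := by
  refine ⟨hvp, hg, hv, hg.locallyIntegrable (by simpa using hp), fun ψ hψ hψc i => ?_⟩
  have h1 := h (EuclideanSpace.single i 1) ⟨ψ, hψ, hψc⟩
  change -∫ x, v x * fderiv ℝ ψ x (EuclideanSpace.single i 1) = ∫ x, _ * ψ x at h1
  rw [← neg_eq_iff_eq_neg, h1]
  simp [EuclideanSpace.inner_single_right]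

theorem ae_eq_of_forall_test {n : ℕ} {f g : Euc n → ℝ} (hf : LocallyIntegrable f)
    (hg : LocallyIntegrable g) (h : ∀ φ : testFunctions n,
      ∫ x, f x * (φ : Euc n → ℝ) x = ∫ x, g x * (φ : Euc n → ℝ) x) : f =ᵐ[volume] g := by
  refine ae_eq_of_integral_contDiff_smul_eq hf hg fun φ hφ hφc => ?_
  have := h ⟨φ, hφ, hφc⟩
  simp only [smul_eq_mul, mul_comm (φ _)]
  exact this

/-- Hölder on a compact set; the estimate of the distributional derivative only asks for local `L^1`
convergence. -/
theorem TendstoLpLoc.tendsto_lintegral_enorm {n : ℕ} {p : ℝ} (hp : 1 ≤ p) {u : ℕ → Euc n → ℝ}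
    {v : Euc n → ℝ} (hu : ∀ k, AEStronglyMeasurable (u k)) (hv : AEStronglyMeasurable v)
    (h : TendstoLpLoc p u v) {K : Set (Euc n)} (hK : IsCompact K) :
    Tendsto (fun k => ∫⁻ x in K, ‖u k x - v x‖ₑ) atTop (𝓝 0) := by
  have hp1 : 1 ≤ ENNReal.ofReal p := by simpa using hp
  have hC : (volume.restrict K univ) ^ (1 / (1 : ℝ≥0∞).toReal - 1 / (ENNReal.ofReal p).toReal) ≠ ∞ := by
    refine ENNReal.rpow_ne_top_of_nonneg ?_ ?_
    · rw [ENNReal.toReal_ofReal (by linarith)]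
      have : 1 / p ≤ 1 := by rw [div_le_one (by linarith)]; exact hp
      simpa using this
    · rw [Measure.restrict_apply_univ]
      exact hK.measure_lt_top.ne
  have h1 := ENNReal.Tendsto.mul_const (h K hK) (Or.inr hC)
  rw [zero_mul] at h1
  refine tendsto_of_tendsto_of_tendsto_of_le_of_le tendsto_const_nhds h1 (fun _ => zero_le)
    fun k => ?_
  have := eLpNorm_le_eLpNorm_mul_rpow_measure_univ hp1
    (((hu k).sub hv).restrict (s := K))
  rwa [eLpNorm_one_eq_lintegral_enorm] at this

/-- The averaged reciprocals of a kernel with a radial limit converge. -/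
theorem ae_ae_tendsto_of_hasRadialLimit {n : ℕ} {m : Euc n × Euc n → ℝ} (hm : Measurable m)
    {lo hi : ℝ} (hlo : 0 < lo) (hmlo : ∀ z, lo ≤ m z) (hmhi : ∀ z, m z ≤ hi)
    {a : Euc n → Metric.sphere (0 : Euc n) 1 → ℝ} (hma : HasRadialLimit (fun x h => m (x, h)) a)
    {ρ : ℕ → Measure ℝ} [∀ k, IsProbabilityMeasure (ρ k)] (hac : ∀ k, ρ k ≪ volume)
    (hsupp : ∀ k, ∀ᵐ r ∂ρ k, r ∈ Ioo (0 : ℝ) 1)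
    (hρ : Tendsto (fun k => ∫⁻ r, ENNReal.ofReal r ∂ρ k) atTop (𝓝 0)) {q : ℝ} (hq : 1 < q) :
    ∀ᵐ x, ∀ᵐ ω ∂(sphereMeasure n), lo ≤ a x ω ∧
      Tendsto (fun k => ∫⁻ r, ENNReal.ofReal (m (x, r • (ω : Euc n))) ^ (1 - q) ∂ρ k) atTop
        (𝓝 (ENNReal.ofReal (a x ω) ^ (1 - q))) := by
  filter_upwards [hma] with x ⟨C, δ, hδ, hx⟩
  filter_upwards [hx] with ω hω
  have hf : Measurable fun r : ℝ => m (x, r • (ω : Euc n)) :=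
    hm.comp (measurable_const.prodMk (measurable_id.smul_const _))
  exact tendsto_lintegral_rpow_of_radial_limit hac hsupp hρ hf hlo (fun _ => hmlo _)
    (fun _ => hmhi _) hδ hω hq

/-! ### The Γ-liminf inequality, integrated over all directions. -/

/-- The `Γ`-liminf inequality for measurable representatives. -/
theorem exists_memSobolevOne_lintegral_localDensity_le {n : ℕ} (hn : 1 ≤ n) {p : ℝ} (hp : 1 < p)
    {m : Euc n × Euc n → ℝ} (hm : Measurable m) {lo hi : ℝ} (hlo : 0 < lo) (hmlo : ∀ z, lo ≤ m z)
    (hmhi : ∀ z, m z ≤ hi) {a : Euc n → Metric.sphere (0 : Euc n) 1 → ℝ}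
    (hma : HasRadialLimit (fun x h => m (x, h)) a) {s : ℕ → ℝ} (hs1 : ∀ k, s k < 1)
    (hs : Tendsto s atTop (𝓝 1)) {u : ℕ → Euc n → ℝ} (hum : ∀ k, Measurable (u k))
    (hu : ∀ k, MemLp (u k) (ENNReal.ofReal p)) {v : Euc n → ℝ} (hv : MemLp v (ENNReal.ofReal p))
    (huv : TendstoLpLoc p u v)
    (hJ : liminf (fun k => anisoEnergy (fun x h => m (x, h)) (s k) p (u k)) atTop ≠ ∞) :
    ∃ g : Euc n → Euc n, MemSobolevOne p v g ∧ ∫⁻ x, localDensity a p x (g x) ≤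
      ENNReal.ofReal p *
        liminf (fun k => anisoEnergy (fun x h => m (x, h)) (s k) p (u k)) atTop := by
  set q := Real.conjExponent p
  have hpq : p.HolderConjugate q := .conjExponent hp
  have hp0 : 0 < p := hpq.pos
  have hp1 : 1 ≤ ENNReal.ofReal p := by simpa using hp.le
  have hc0 : ∀ k, 0 < p * (1 - s k) := fun k => mul_pos hp0 (by linarith [hs1 k])
  set ρ : ℕ → Measure ℝ := fun k => powerMeasure (p * (1 - s k)) with hρdef
  have hprob : ∀ k, IsProbabilityMeasure (ρ k) := fun k => isProbabilityMeasure_powerMeasure (hc0 k)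
  have hsupp : ∀ k, ∀ᵐ r ∂ρ k, r ∈ Ioo (0 : ℝ) 1 := fun k => ae_powerMeasure_mem_Ioo _
  have hac : ∀ k, ρ k ≪ volume := fun k => powerMeasure_absolutelyContinuous _
  have hρ : Tendsto (fun k => ∫⁻ r, ENNReal.ofReal r ∂ρ k) atTop (𝓝 0) := by
    have h1 : Tendsto (fun k => ENNReal.ofReal (p * (1 - s k))) atTop (𝓝 0) := by
      have := ENNReal.tendsto_ofReal ((tendsto_const_nhds (x := p)).mul
        ((tendsto_const_nhds (x := (1 : ℝ))).sub hs))
      simpa using this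
    exact tendsto_of_tendsto_of_tendsto_of_le_of_le tendsto_const_nhds h1 (fun _ => zero_le)
      fun k => lintegral_powerMeasure_ofReal_le (hc0 k)
  let B : Metric.sphere (0 : Euc n) 1 → Euc n × ℝ → ℝ≥0∞ := fun ω z =>
    ENNReal.ofReal (m (z.1, z.2 • (ω : Euc n)))
  have hBm : Measurable fun y : (Euc n × Metric.sphere (0 : Euc n) 1) × ℝ =>
      B y.1.2 (y.1.1, y.2) :=
    (hm.comp ((measurable_fst.comp measurable_fst).prodMk (measurable_snd.smul
      (measurable_subtype_coe.comp (measurable_snd.comp measurable_fst))))).ennreal_ofReal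
  have hBω : ∀ ω, Measurable (B ω) := fun ω =>
    (hm.comp (measurable_fst.prodMk (measurable_snd.smul_const _))).ennreal_ofReal
  set avg : ℕ → Euc n × Metric.sphere (0 : Euc n) 1 → ℝ≥0∞ := fun k y =>
    ∫⁻ r, B y.2 (y.1, r) ^ (1 - q) ∂ρ k with havg
  have havgm : ∀ k, Measurable (avg k) := fun k => (hBm.pow_const _).lintegral_prod_right'
  -- `a` is not assumed measurable. The limsup of the averages is a jointly measurable substitute
  -- for `a^{1-q}`, equal to it for almost every `x` and `ω`.
  set W : Euc n × Metric.sphere (0 : Euc n) 1 → ℝ≥0∞ := fun y => limsup (fun k => avg k y) atTop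
    with hW
  have hWm : Measurable W := Measurable.limsup havgm
  have hlim := ae_ae_tendsto_of_hasRadialLimit hm hlo hmlo hmhi hma hac hsupp hρ hpq.symm.lt
  -- The radial limit is given for almost every `x`, then almost every `ω`; the directional
  -- inequality needs the opposite order. Fubini applies because the convergence set is measurable.
  have hgood : ∀ᵐ ω ∂(sphereMeasure n), ∀ᵐ x : Euc n,
      Tendsto (fun k => avg k (x, ω)) atTop (𝓝 (W (x, ω))) := by
    rw [← Measure.ae_ae_comm (p := fun x ω => Tendsto (fun k => avg k (x, ω)) atTop (𝓝 (W (x, ω))))]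
    · filter_upwards [hlim] with x hx
      filter_upwards [hx] with ω hω
      simp only [hW]
      rw [Tendsto.limsup_eq hω.2]
      exact hω.2
    · exact measurableSet_tendsto_fun havgm hWm
  have hWa : ∀ᵐ x : Euc n, ∀ᵐ ω ∂(sphereMeasure n), 0 ≤ a x ω ∧
      W (x, ω) ^ (1 - p) = ENNReal.ofReal (a x ω) := by
    filter_upwards [hlim] with x hx
    filter_upwards [hx] with ω hω
    refine ⟨hlo.le.trans hω.1, ?_⟩
    simp only [hW]
    rw [Tendsto.limsup_eq hω.2, ← ENNReal.rpow_mul]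
    have : (1 - q) * (1 - p) = 1 := by
      have := hpq.mul_eq_add
      linarith
    rw [this, ENNReal.rpow_one]
  set e : ℕ → Metric.sphere (0 : Euc n) 1 → ℝ≥0∞ := fun k ω => ∫⁻ r, ∫⁻ x, B ω (x, r) *
    ‖(u k x - u k (x - r • (ω : Euc n))) / r‖ₑ ^ p ∂volume ∂ρ k with he
  have hem : ∀ k, Measurable (e k) := by
    intro k
    have h1 : Measurable fun y : (Metric.sphere (0 : Euc n) 1 × ℝ) × Euc n =>
        y.1.2 • (y.1.1 : Euc n) := (measurable_snd.comp measurable_fst).smul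
          (measurable_subtype_coe.comp (measurable_fst.comp measurable_fst))
    have h2 : Measurable fun y : (Metric.sphere (0 : Euc n) 1 × ℝ) × Euc n => B y.1.1 (y.2, y.1.2) *
        ‖(u k y.2 - u k (y.2 - y.1.2 • (y.1.1 : Euc n))) / y.1.2‖ₑ ^ p :=
      (hm.comp (measurable_snd.prodMk h1)).ennreal_ofReal.mul
        (((((hum k).comp measurable_snd).sub ((hum k).comp (measurable_snd.sub h1))).div
          (measurable_snd.comp measurable_fst)).enorm.pow_const _)
    exact h2.lintegral_prod_right'.lintegral_prod_right'
  set E : Metric.sphere (0 : Euc n) 1 → ℝ≥0∞ := fun ω => liminf (fun k => e k ω) atTop with hE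
  set J := liminf (fun k => anisoEnergy (fun x h => m (x, h)) (s k) p (u k)) atTop with hJdef
  have hEm : Measurable E := Measurable.liminf hem
  -- Fatou's lemma on the sphere; this also makes the directional liminf finite for almost every
  -- `ω`.
  have hEJ : ∫⁻ ω, E ω ∂(sphereMeasure n) ≤ ENNReal.ofReal (p ^ 2) * J := by
    calc ∫⁻ ω, E ω ∂(sphereMeasure n)
        ≤ liminf (fun k => ∫⁻ ω, e k ω ∂(sphereMeasure n)) atTop := lintegral_liminf_le hem
      _ ≤ liminf (fun k => ENNReal.ofReal (p ^ 2) *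
          anisoEnergy (fun x h => m (x, h)) (s k) p (u k)) atTop :=
        liminf_le_liminf (Eventually.of_forall fun k =>
          lintegral_sphere_powerMeasure_le hn hp.le (hs1 k) hm (fun z => hlo.le.trans (hmlo z))
            (hum k))
      _ = _ := ENNReal.liminf_const_mul_of_ne_top ENNReal.ofReal_ne_top
  have hEfin : ∀ᵐ ω ∂(sphereMeasure n), E ω < ∞ :=
    ae_lt_top hEm (ne_top_of_le_ne_top (ENNReal.mul_ne_top ENNReal.ofReal_ne_top hJ) hEJ)
  have hvl : LocallyIntegrable v := hv.locallyIntegrable hp1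
  have hdir : ∀ᵐ ω : Metric.sphere (0 : Euc n) 1 ∂(sphereMeasure n), ∃ γ : Euc n → ℝ, Measurable γ ∧
      MemLp γ (ENNReal.ofReal p) ∧
      (∀ φ : testFunctions n, distribDeriv hvl (ω : Euc n) φ = ∫ x, γ x * (φ : Euc n → ℝ) x) ∧
      ∫⁻ x, W (x, ω) ^ (1 - p) * ‖γ x‖ₑ ^ p ≤ E ω := by
    filter_upwards [hgood, hEfin] with ω hω hEω
    exact exists_directional_derivative_liminf_le hpq (ω : Euc n) ρ hsupp hρ (hBω ω)
      (lo := ENNReal.ofReal lo) (hi := ENNReal.ofReal hi) (by simpa using hlo)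
      ENNReal.ofReal_ne_top (fun z => ENNReal.ofReal_le_ofReal (hmlo _))
      (fun z => ENNReal.ofReal_le_ofReal (hmhi _)) (w := fun x => W (x, ω))
      (hWm.comp measurable_prodMk_right) hω hum (fun k => (hu k).locallyIntegrable hp1) hvl
      (fun K hK => huv.tendsto_lintegral_enorm hp.le (fun k => (hu k).1) hv.1 hK) hEω.ne
  obtain ⟨g, hgm, hg, hgrad⟩ := exists_memLp_gradient hn hp.le hvl
    (hdir.mono fun ω ⟨γ, h1, h2, h3, _⟩ => ⟨γ, h1, h2, h3⟩)
  refine ⟨g, memSobolevOne_of_distribDeriv hp.le hv hvl hg hgrad, ?_⟩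
  have hgω : ∀ᵐ ω : Metric.sphere (0 : Euc n) 1 ∂(sphereMeasure n),
      ∫⁻ x, W (x, ω) ^ (1 - p) * ‖inner ℝ (g x) (ω : Euc n)‖ₑ ^ p ≤ E ω := by
    filter_upwards [hdir] with ω ⟨γ, _, hγ, hγφ, hγE⟩
    refine le_of_eq_of_le (lintegral_congr_ae ?_) hγE
    -- Uniqueness of distributional derivatives identifies the directional derivative, found
    -- separately for each `ω`, with `g · ω`.
    have h1 : (fun x => inner ℝ (g x) (ω : Euc n)) =ᵐ[volume] γ :=
      ae_eq_of_forall_test ((hg.inner_const (ω : Euc n)).locallyIntegrable hp1)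
        (hγ.locallyIntegrable hp1) fun φ => by rw [← hgrad, hγφ]
    filter_upwards [h1] with x hx
    rw [hx]
  have hFm : Measurable fun y : Euc n × Metric.sphere (0 : Euc n) 1 =>
      W y ^ (1 - p) * ‖inner ℝ (g y.1) (y.2 : Euc n)‖ₑ ^ p :=
    (hWm.pow_const _).mul (((hgm.comp measurable_fst).inner
      (measurable_subtype_coe.comp measurable_snd)).enorm.pow_const _)
  calc ∫⁻ x, localDensity a p x (g x)
      = ∫⁻ x, ENNReal.ofReal (1 / p) * ∫⁻ ω : Metric.sphere (0 : Euc n) 1,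
          W (x, ω) ^ (1 - p) * ‖inner ℝ (g x) (ω : Euc n)‖ₑ ^ p ∂(sphereMeasure n) := by
        refine lintegral_congr_ae ?_
        filter_upwards [hWa] with x hx
        rw [localDensity]
        congr 1
        refine lintegral_congr_ae ?_
        filter_upwards [hx] with ω hω
        rw [hω.2, ENNReal.ofReal_mul hω.1, Real.enorm_eq_ofReal_abs,
          ENNReal.ofReal_rpow_of_nonneg (abs_nonneg _) hp0.le]
    _ = ENNReal.ofReal (1 / p) * ∫⁻ ω : Metric.sphere (0 : Euc n) 1, ∫⁻ x,
          W (x, ω) ^ (1 - p) * ‖inner ℝ (g x) (ω : Euc n)‖ₑ ^ p ∂volume ∂(sphereMeasure n) := by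
        rw [lintegral_const_mul' _ _ ENNReal.ofReal_ne_top, lintegral_lintegral_swap hFm.aemeasurable]
    _ ≤ ENNReal.ofReal (1 / p) * (ENNReal.ofReal (p ^ 2) * J) := by
        gcongr
        exact (lintegral_mono_ae hgω).trans hEJ
    _ = ENNReal.ofReal p * J := by
        rw [← mul_assoc, ← ENNReal.ofReal_mul (by positivity)]
        congr 2
        field_simp

/-! ### Independence of the chosen representatives. -/

/-- Preimages of null sets under `(x,h) ↦ x` and `(x,h) ↦ x - h` are null, so the nonlocal energies
depend only on the class of `u`. -/
theorem ae_prod_sub_translate_eq {n : ℕ} {u v : Euc n → ℝ} (h : u =ᵐ[volume] v) :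
    ∀ᵐ z : Euc n × Euc n, u z.1 - u (z.1 - z.2) = v z.1 - v (z.1 - z.2) := by
  have h1 : ∀ᵐ z : Euc n × Euc n, u z.1 = v z.1 :=
    (Measure.quasiMeasurePreserving_fst (μ := volume) (ν := volume)).ae h
  have h2 : ∀ᵐ z : Euc n × Euc n, u (z.1 - z.2) = v (z.1 - z.2) :=
    (quasiMeasurePreserving_sub_of_right_invariant volume volume).ae h
  filter_upwards [h1, h2] with z hz1 hz2
  rw [hz1, hz2]

theorem gagliardoPow_congr_ae {n : ℕ} (s p : ℝ) {u v : Euc n → ℝ} (h : u =ᵐ[volume] v) :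
    gagliardoPow s p u = gagliardoPow s p v := by
  refine lintegral_congr_ae ?_
  filter_upwards [ae_prod_sub_translate_eq h] with z hz
  rw [hz]

theorem anisoEnergy_congr_ae {n : ℕ} {m m' : Euc n → Euc n → ℝ} (s p : ℝ) {u v : Euc n → ℝ}
    (hm : ∀ᵐ z : Euc n × Euc n, m z.1 z.2 = m' z.1 z.2) (h : u =ᵐ[volume] v) :
    anisoEnergy m s p u = anisoEnergy m' s p v := by
  rw [anisoEnergy, anisoEnergy]
  congr 1
  refine lintegral_congr_ae ?_
  filter_upwards [ae_prod_sub_translate_eq h, hm] with z hz hz'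
  rw [hz, hz']

theorem TendstoLpLoc.congr_ae {n : ℕ} {p : ℝ} {u u' : ℕ → Euc n → ℝ} {v : Euc n → ℝ}
    (hu : ∀ k, u k =ᵐ[volume] u' k) (h : TendstoLpLoc p u v) : TendstoLpLoc p u' v := by
  intro K hK
  refine (h K hK).congr fun k => eLpNorm_congr_ae ?_
  filter_upwards [ae_restrict_of_ae (hu k)] with x hx
  rw [hx]

theorem anisoEnergy_le {n : ℕ} {m : Euc n → Euc n → ℝ} {hi : ℝ} (hhi0 : 0 ≤ hi)
    (hhi : ∀ᵐ z : Euc n × Euc n, m z.1 z.2 ≤ hi) {s p : ℝ} (hp : 0 ≤ p) (hs : s ≤ 1)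
    (u : Euc n → ℝ) : anisoEnergy m s p u ≤
      ENNReal.ofReal (hi / p) * (ENNReal.ofReal (1 - s) * gagliardoPow s p u) := by
  rw [anisoEnergy, gagliardoPow, ← mul_assoc, ← ENNReal.ofReal_mul (by positivity),
    show hi / p * (1 - s) = (1 - s) / p * hi by ring,
    ENNReal.ofReal_mul (div_nonneg (by linarith) hp), mul_assoc]
  gcongr
  rw [← lintegral_const_mul' _ _ ENNReal.ofReal_ne_top]
  refine lintegral_mono_ae ?_
  filter_upwards [hhi] with z hz
  rw [← ENNReal.ofReal_mul hhi0]
  gcongr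

/-- An elliptic kernel has a measurable representative which is bounded everywhere. -/
theorem IsEllipticKernel.exists_measurable_bounded {n : ℕ} {m : Euc n → Euc n → ℝ}
    (hm : IsEllipticKernel m) : ∃ (m' : Euc n × Euc n → ℝ) (lo hi : ℝ), Measurable m' ∧ 0 < lo ∧
      (∀ z, lo ≤ m' z) ∧ (∀ z, m' z ≤ hi) ∧ ∀ᵐ z : Euc n × Euc n, m z.1 z.2 = m' z := by
  obtain ⟨lo, hi, hlo, hb⟩ := hm.bounds
  refine ⟨fun z => max lo (min (hm.aestronglyMeasurable.mk _ z) hi), lo, max lo hi,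
    measurable_const.max (hm.aestronglyMeasurable.stronglyMeasurable_mk.measurable.min
      measurable_const), hlo, fun z => le_max_left _ _, fun z => max_le_max_left _ (min_le_right _ _),
    ?_⟩
  filter_upwards [hb, hm.aestronglyMeasurable.ae_eq_mk] with z hz hz'
  rw [← hz', min_eq_left hz.2, max_eq_right hz.1]

/-- For almost every `x` a null set of pairs `(x,h)` leaves a null set of `h`, which meets almost
every ray in a null set of radii. -/
theorem HasRadialLimit.congr_ae {n : ℕ} (hn : 1 ≤ n) {m m' : Euc n → Euc n → ℝ}
    {a : Euc n → Metric.sphere (0 : Euc n) 1 → ℝ} (h : HasRadialLimit m a)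
    (hm : ∀ᵐ z : Euc n × Euc n, m z.1 z.2 = m' z.1 z.2) : HasRadialLimit m' a := by
  filter_upwards [h, Measure.ae_ae_of_ae_prod hm] with x ⟨C, δ, hδ, hx⟩ hx'
  refine ⟨C, δ, hδ, ?_⟩
  filter_upwards [hx, ae_sphere_ae_of_ae hn hx'] with ω hω hω'
  filter_upwards [hω, hω'] with r hr hr' hrδ
  rw [← hr' hrδ.1]
  exact hr hrδ

/-- The `Γ`-liminf inequality. -/
theorem exists_memSobolevOne_of_tendstoLpLoc {n : ℕ} (hn : 1 ≤ n) {p : ℝ} (hp : 1 < p)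
    {m : Euc n → Euc n → ℝ} (hm : IsEllipticKernel m)
    {a : Euc n → Metric.sphere (0 : Euc n) 1 → ℝ} (hma : HasRadialLimit m a) {s : ℕ → ℝ}
    (hs1 : ∀ k, s k < 1) (hs : Tendsto s atTop (𝓝 1)) {u : ℕ → Euc n → ℝ}
    (hu : ∀ k, MemLp (u k) (ENNReal.ofReal p)) {G M : ℝ≥0∞} (hG : G ≠ ∞) (hM : M ≠ ∞)
    (huG : ∀ k, ENNReal.ofReal (1 - s k) * gagliardoPow (s k) p (u k) ≤ G)
    (huM : ∀ k, eLpNorm (u k) (ENNReal.ofReal p) volume ≤ M) {v : Euc n → ℝ}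
    (hv : AEStronglyMeasurable v) (huv : TendstoLpLoc p u v) :
    ∃ g : Euc n → Euc n, MemSobolevOne p v g ∧ ∫⁻ x, localDensity a p x (g x) ≤
      ENNReal.ofReal p * liminf (fun k => anisoEnergy m (s k) p (u k)) atTop := by
  obtain ⟨m', lo, hi, hm', hlo, hmlo, hmhi, hmm'⟩ := hm.exists_measurable_bounded
  have huu' : ∀ k, u k =ᵐ[volume] (hu k).1.mk (u k) := fun k => (hu k).1.ae_eq_mk
  have hJ : ∀ k, anisoEnergy m (s k) p (u k) =
      anisoEnergy (fun x h => m' (x, h)) (s k) p ((hu k).1.mk (u k)) := fun k =>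
    anisoEnergy_congr_ae _ _ hmm' (huu' k)
  have hhi0 : 0 ≤ hi := hlo.le.trans ((hmlo (0, 0)).trans (hmhi (0, 0)))
  -- The upper bound on `m` controls the energy by the Gagliardo bound, so the liminf is finite.
  have hJfin : liminf (fun k => anisoEnergy m (s k) p (u k)) atTop ≠ ∞ := by
    refine ne_top_of_le_ne_top (b := ENNReal.ofReal (hi / p) * G)
      (ENNReal.mul_ne_top ENNReal.ofReal_ne_top hG) ?_
    calc liminf (fun k => anisoEnergy m (s k) p (u k)) atTop
        ≤ liminf (fun _ : ℕ => ENNReal.ofReal (hi / p) * G) atTop := by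
          refine liminf_le_liminf (Eventually.of_forall fun k => ?_)
          refine (anisoEnergy_le hhi0 (hmm'.mono fun z hz => hz.trans_le (hmhi z)) (by linarith)
            (hs1 k).le (u k)).trans ?_
          gcongr
          exact huG k
      _ = _ := liminf_const _
  simp_rw [hJ] at hJfin ⊢
  exact exists_memSobolevOne_lintegral_localDensity_le hn hp hm' hlo hmlo hmhi
    (hma.congr_ae hn hmm') hs1 hs (fun k => (hu k).1.stronglyMeasurable_mk.measurable)
    (fun k => (hu k).ae_eq (huu' k))
    (TendstoLpLoc.memLp hp.le (fun k => (hu k).1) hv hM huM huv) (huv.congr_ae huu') hJfin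

/-- Compactness without pointwise measurability. -/
theorem exists_subseq_tendstoLpLoc_of_memLp {n : ℕ} (hn : 1 ≤ n) {p : ℝ} (hp : 1 ≤ p) {s : ℕ → ℝ}
    (hs0 : ∀ k, 0 ≤ s k) (hs1 : ∀ k, s k < 1) (hs : Tendsto s atTop (𝓝 1))
    {u : ℕ → Euc n → ℝ} (hu : ∀ k, MemLp (u k) (ENNReal.ofReal p))
    {G M : ℝ≥0∞} (hG : G ≠ ∞) (hM : M ≠ ∞)
    (huG : ∀ k, ENNReal.ofReal (1 - s k) * gagliardoPow (s k) p (u k) ≤ G)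
    (huM : ∀ k, eLpNorm (u k) (ENNReal.ofReal p) volume ≤ M) :
    ∃ (φ : ℕ → ℕ) (v : Euc n → ℝ), StrictMono φ ∧ MemLp v (ENNReal.ofReal p) ∧
      TendstoLpLoc p (fun j => u (φ j)) v := by
  have huu' : ∀ k, u k =ᵐ[volume] (hu k).1.mk (u k) := fun k => (hu k).1.ae_eq_mk
  obtain ⟨φ, v, hφ, hv, h⟩ := exists_subseq_tendstoLpLoc hn hp hs0 hs1 hs
    (fun k => (hu k).1.stronglyMeasurable_mk.measurable) (fun k => (hu k).ae_eq (huu' k)) hG hM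
    (fun k => by rw [← gagliardoPow_congr_ae _ _ (huu' k)]; exact huG k)
    (fun k => (eLpNorm_congr_ae (huu' k)).symm.trans_le (huM k))
  exact ⟨φ, v, hφ, hv, h.congr_ae fun k => (huu' (φ k)).symm⟩

theorem exists_strictMono_tendsto_liminf (f : ℕ → ℝ≥0∞) :
    ∃ φ : ℕ → ℕ, StrictMono φ ∧ Tendsto (f ∘ φ) atTop (𝓝 (liminf f atTop)) := by
  obtain ⟨x, hx, hxt⟩ := _root_.exists_seq_tendsto_liminf (f := atTop) (u := f)
  obtain ⟨ψ, hψ, hψ'⟩ := strictMono_subseq_of_tendsto_atTop hxt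
  exact ⟨x ∘ ψ, hψ', hx.comp hψ.tendsto_atTop⟩

end

/-! ### Conclusion. -/

/-- Compactness and the `Γ`-liminf inequality as `s_k ↑ 1`. -/
theorem theorem3p3 (n : ℕ) (hn : 1 ≤ n) (p : ℝ) (hp : 1 ≤ p)
    (m : EuclideanSpace ℝ (Fin n) → EuclideanSpace ℝ (Fin n) → ℝ)
    (a : EuclideanSpace ℝ (Fin n) → Metric.sphere (0 : EuclideanSpace ℝ (Fin n)) 1 → ℝ)
    (hm : IsEllipticKernel m) (hma : HasRadialLimit m a)
    (s : ℕ → ℝ) (hs0 : ∀ k, 0 ≤ s k) (hs1 : ∀ k, s k < 1) (hs : Tendsto s atTop (𝓝 1))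
    (u : ℕ → EuclideanSpace ℝ (Fin n) → ℝ)
    (hu : ∀ k, MemLp (u k) (ENNReal.ofReal p))
    (hseminorm : (⨆ k, ENNReal.ofReal (1 - s k) * gagliardoPow (s k) p (u k)) < ∞)
    (hnorm : (⨆ k, eLpNorm (u k) (ENNReal.ofReal p) volume) < ∞) :
    (∃ (φ : ℕ → ℕ) (v : EuclideanSpace ℝ (Fin n) → ℝ),
      StrictMono φ ∧ MemLp v (ENNReal.ofReal p) ∧
      TendstoLpLoc p (fun j => u (φ j)) v ∧
      (1 < p → ∃ g : EuclideanSpace ℝ (Fin n) → EuclideanSpace ℝ (Fin n),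
        MemSobolevOne p v g ∧
        ∫⁻ x, localDensity a p x (g x) ≤
          ENNReal.ofReal p * liminf (fun k => anisoEnergy m (s k) p (u k)) atTop)) ∧
    (1 < p → ∀ (φ : ℕ → ℕ) (v : EuclideanSpace ℝ (Fin n) → ℝ),
      StrictMono φ → AEStronglyMeasurable v volume →
      TendstoLpLoc p (fun j => u (φ j)) v →
      ∃ g : EuclideanSpace ℝ (Fin n) → EuclideanSpace ℝ (Fin n),
        MemSobolevOne p v g ∧
        ∫⁻ x, localDensity a p x (g x) ≤
          ENNReal.ofReal p *
            liminf (fun j => anisoEnergy m (s (φ j)) p (u (φ j))) atTop) := by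

  have huG : ∀ k, ENNReal.ofReal (1 - s k) * gagliardoPow (s k) p (u k) ≤ _ :=
    le_iSup fun k => ENNReal.ofReal (1 - s k) * gagliardoPow (s k) p (u k)
  have huM : ∀ k, eLpNorm (u k) (ENNReal.ofReal p) volume ≤ _ :=
    le_iSup fun k => eLpNorm (u k) (ENNReal.ofReal p) volume
  have hgamma : 1 < p → ∀ (φ : ℕ → ℕ) (v : EuclideanSpace ℝ (Fin n) → ℝ),
      StrictMono φ → AEStronglyMeasurable v volume → TendstoLpLoc p (fun j => u (φ j)) v →
      ∃ g : EuclideanSpace ℝ (Fin n) → EuclideanSpace ℝ (Fin n), MemSobolevOne p v g ∧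
        ∫⁻ x, localDensity a p x (g x) ≤ ENNReal.ofReal p *
          liminf (fun j => anisoEnergy m (s (φ j)) p (u (φ j))) atTop :=
    fun hp1 φ v hφ hv huv => exists_memSobolevOne_of_tendstoLpLoc hn hp1 hm hma
      (fun j => hs1 (φ j)) (hs.comp hφ.tendsto_atTop) (fun j => hu (φ j)) hseminorm.ne hnorm.ne
      (fun j => huG (φ j)) (fun j => huM (φ j)) hv huv
  refine ⟨?_, hgamma⟩
  -- The subsequence is first chosen to realize the liminf of the whole sequence. Further extraction
  -- for compactness keeps that limit, so the bound refers to the full liminf.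
  obtain ⟨ψ, hψ, hψlim⟩ :=
    exists_strictMono_tendsto_liminf fun k => anisoEnergy m (s k) p (u k)
  obtain ⟨φ, v, hφ, hv, huv⟩ := exists_subseq_tendstoLpLoc_of_memLp hn hp
    (fun j => hs0 (ψ j)) (fun j => hs1 (ψ j)) (hs.comp hψ.tendsto_atTop) (fun j => hu (ψ j))
    hseminorm.ne hnorm.ne (fun j => huG (ψ j)) (fun j => huM (ψ j))
  refine ⟨ψ ∘ φ, v, hψ.comp hφ, hv, huv, fun hp1 => ?_⟩
  obtain ⟨g, hg, hle⟩ := hgamma hp1 (ψ ∘ φ) v (hψ.comp hφ) hv.1 huv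
  exact ⟨g, hg, hle.trans_eq (congrArg _ (hψlim.comp hφ.tendsto_atTop).liminf_eq)⟩
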